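/- By a Riemann surface of genus $1$ with its group structure we mean a compact connected Riemann surface $X$ with $\dim_{\mathbb{C}} H^0(X,\Omega^1_X)=1$, equipped with a commutative group law, with neutral element $0$, whose operations are holomorphic. The following standard objects are attached to it. (a) Let $\mu=\frac{i}{2}\,\alpha\wedge\overline{\alpha}$, where $\alpha$ is a holomorphic differential on $X$ with $\frac{i}{2}\int_X\alpha\wedge\overline{\alpha}=1$. The Arakelov–Green function $G$ of $X$ is the unique function $G:X\times X\to\mathbb{R}_{\ge 0}$ such that (i) $G^2$ is $C^\infty$ on $X\times X$, and $G$ vanishes only on the diagonal, with multiplicity $1$ (that is, if $z$ is a local coordinate at a point, then near that point $G(P,Q)=|z(P)-z(Q)|\cdot u(P,Q)$ with $u$ smooth and positive); (ii) for all $P$, $\partial_Q\overline{\partial}_Q\log G(P,Q)^2=2\pi i\,\mu(Q)$ for $Q\ne P$; (iii) for all $P$, $\int_X\log G(P,Q)\,\mu(Q)=0$. (b) $\|\eta\|(X)=(\mathrm{Im}\,\tau)^{1/4}\,|\eta(\tau)|$ for any $\tau$ in the upper half plane with $X\cong\mathbb{C}/(\mathbb{Z}+\tau\mathbb{Z})$,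 where $\eta(\tau)=q^{1/24}\prod_{k\ge 1}(1-q^k)$, with $q=e^{2\pi i\tau}$ and $q^{1/24}=e^{2\pi i\tau/24}$, is the Dedekind eta function. This does not depend on the choice of $\tau$. **Theorem (Energy of an isogeny).** Let $X$ and $X'$ be Riemann surfaces of genus $1$ with their group structures, let $f:X\to X'$ be an isogeny, that is, a nonconstant holomorphic group homomorphism, and let $N$ be its degree. Let $G$ be the Arakelov–Green function of $X$. Then $\mathrm{Ker} f$ is finite and $$\prod_{P\in\mathrm{Ker} f,\ P\ne 0}G(0,P)=\frac{\sqrt{N}\cdot\|\eta\|(X')^2}{\|\eta\|(X)^2}.$$ -/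

import Mathlib

open scoped Manifold ContDiff Topology ENNReal
open MeasureTheory

noncomputable section

namespace ArakelovElliptic

section Differentials

variable {X : Type*} [TopologicalSpace X] [ChartedSpace ℂ X]

/-- The coefficient of a differential of type `(1,0)` in the local coordinate `z` given by the
chart `e`: the function `h` with `α = h dz` on the source of `e`. -/
def coeff (α : (x : X) → (TangentSpace 𝓘(ℂ, ℂ) x →L[ℂ] ℂ)) (e : OpenPartialHomeomorph X ℂ)
    (z : ℂ) : ℂ :=
  α (e.symm z) (mfderiv 𝓘(ℂ, ℂ) 𝓘(ℂ, ℂ) e.symm z (1 : ℂ))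

variable (X) in
/-- The space of holomorphic differentials `H⁰(X, Ω¹)`: sections of the holomorphic cotangent
bundle that have the form `h dz`, `h` holomorphic, in each local coordinate `z`. -/
def HolomorphicDifferentials : Submodule ℂ ((x : X) → (TangentSpace 𝓘(ℂ, ℂ) x →L[ℂ] ℂ)) where
  carrier := {α | ∀ e ∈ atlas ℂ X, DifferentiableOn ℂ (coeff α e) e.target}
  zero_mem' := fun _ _ => differentiableOn_const (0 : ℂ)
  add_mem' := fun hα hβ e he => (hα e he).add (hβ e he)
  smul_mem' := fun c _ hα e he => (hα e he).const_smul c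

variable (X) in
/-- The genus: the dimension of the space of holomorphic differentials. -/
def genus : ℕ := Module.finrank ℂ (HolomorphicDifferentials X)

variable [MeasurableSpace X]

/-- The nonnegative `(1,1)`-form `(i/2) α ∧ ᾱ` on `X`, as a measure. On the domain of a chart with
coordinate `z = x + iy`, where `α = h dz`, this form is `|h|² dx dy`. These local measures agree on
overlaps, and their supremum (the least measure on `X` above all of them) is the measure on `X`
that restricts to each of them. -/
def areaMeasure (α : (x : X) → (TangentSpace 𝓘(ℂ, ℂ) x →L[ℂ] ℂ)) : Measure X :=
  ⨆ e ∈ atlas ℂ X,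
    Measure.map e.symm ((volume.restrict e.target).withDensity fun z => ‖coeff α e z‖ₑ ^ 2)

/-- `α` has norm `1` for the hermitian inner product
`(α, β) ↦ (i/2) ∫_X α ∧ β̄` on holomorphic differentials. -/
def IsUnitDifferential (α : (x : X) → (TangentSpace 𝓘(ℂ, ℂ) x →L[ℂ] ℂ)) : Prop :=
  areaMeasure α Set.univ = 1

/-- The defining properties of the Arakelov–Green function of a compact Riemann surface of genus
one, whose fundamental form is `μ = (i/2) α ∧ ᾱ` with `α` a holomorphic differential of norm `1`. -/
structure IsArakelovGreen (α : (x : X) → (TangentSpace 𝓘(ℂ, ℂ) x →L[ℂ] ℂ)) (G : X → X → ℝ) :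
    Prop where
  nonneg : ∀ P Q, 0 ≤ G P Q
  /-- `G²` is smooth on `X × X` (as a real manifold). -/
  smooth_sq : ContMDiff (𝓘(ℝ, ℂ).prod 𝓘(ℝ, ℂ)) 𝓘(ℝ, ℝ) ∞ fun p : X × X => G p.1 p.2 ^ 2
  /-- `G` vanishes only on the diagonal. -/
  eq_zero_iff : ∀ P Q, G P Q = 0 ↔ P = Q
  /-- `G` vanishes with multiplicity one: near a point of the diagonal, `G(P, Q)` is
  `|z(P) - z(Q)|` times a positive smooth function, `z` a local coordinate. -/
  multiplicity_one : ∀ R : X, ∃ u : X × X → ℝ,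
    ContMDiffAt (𝓘(ℝ, ℂ).prod 𝓘(ℝ, ℂ)) 𝓘(ℝ, ℝ) ∞ u (R, R) ∧ 0 < u (R, R) ∧
      ∀ᶠ p in 𝓝 (R, R), G p.1 p.2 = ‖chartAt ℂ R p.1 - chartAt ℂ R p.2‖ * u p
  /-- `∂_Q ∂̄_Q log G(P,Q)² = 2πi μ(Q)` for `Q ≠ P`. Both sides are written as coefficients of
  `dz ∧ dz̄` in a local coordinate `z`, using `∂²/∂z∂z̄ = Δ/4`. -/
  ddbar_log : ∀ P, ∀ e ∈ atlas ℂ X, ∀ Q ∈ e.source, Q ≠ P →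
    (1 / 4 : ℂ) *
        ((Laplacian.laplacian (fun z : ℂ => Real.log (G P (e.symm z) ^ 2)) (e Q) : ℝ) : ℂ) =
      2 * Real.pi * Complex.I * (Complex.I / 2 * ((‖coeff α e (e Q)‖ ^ 2 : ℝ) : ℂ))
  integrable_log : ∀ P, Integrable (fun Q => Real.log (G P Q)) (areaMeasure α)
  integral_log : ∀ P, ∫ Q, Real.log (G P Q) ∂(areaMeasure α) = 0

open Classical in
variable (X) in
/-- The Arakelov–Green function of a compact Riemann surface `X` of genus one: the unique function
with the defining properties. -/
def arakelovGreen : X → X → ℝ :=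
  if h : ∃! G : X → X → ℝ, ∃ α ∈ HolomorphicDifferentials X,
      IsUnitDifferential α ∧ IsArakelovGreen α G then
    Classical.choose h.exists
  else 0

end Differentials

section Eta

/-- `X` is identified with the complex torus `ℂ / (ℤ + τ ℤ)`: a biholomorphic map from the torus
onto the compact Riemann surface `X` is the same as a holomorphic surjection `p : ℂ → X` whose
fibres are exactly the cosets of `ℤ + τ ℤ`. -/
def IsTorusOfPeriod (X : Type*) [TopologicalSpace X] [ChartedSpace ℂ X]
    (τ : UpperHalfPlane) : Prop :=
  ∃ p : ℂ → X, MDifferentiable 𝓘(ℂ, ℂ) 𝓘(ℂ, ℂ) p ∧ Function.Surjective p ∧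
    ∀ z w : ℂ, p z = p w ↔ ∃ m n : ℤ, z - w = m + n * (τ : ℂ)

open Classical in
/-- `‖η‖(X) = (Im τ)^{1/4} |η(τ)|` for any `τ` such that `X` is identified with
`ℂ / (ℤ + τ ℤ)`. -/
def etaNorm (X : Type*) [TopologicalSpace X] [ChartedSpace ℂ X] : ℝ :=
  if h : ∃ τ : UpperHalfPlane, IsTorusOfPeriod X τ then
    let τ : UpperHalfPlane := Classical.choose h
    τ.im ^ (1 / 4 : ℝ) * ‖ModularForm.eta (τ : ℂ)‖
  else 0

end Eta

section Isogeny

variable {X X' : Type*} [TopologicalSpace X] [ChartedSpace ℂ X] [AddCommGroup X]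
  [TopologicalSpace X'] [ChartedSpace ℂ X'] [AddCommGroup X']

/-- An isogeny of Riemann surfaces of genus one with their group structures: a nonconstant
holomorphic group homomorphism. -/
structure IsIsogeny (f : X →+ X') : Prop where
  holomorphic : MDifferentiable 𝓘(ℂ, ℂ) 𝓘(ℂ, ℂ) f
  ne_zero : f ≠ 0

/-- The degree of a nonconstant holomorphic map of compact Riemann surfaces: the number of points
in a general fibre, which is the largest number of points in a fibre. -/
def degree (f : X → X') : ℕ := ⨆ Q : X', (f ⁻¹' {Q}).ncard

end Isogeny

end ArakelovElliptic

end

noncomputable section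

namespace ArakelovElliptic

/-! Everything is explicit on ℂ/(ℤ + ℤτ). Put T = Im τ, q = exp(2πiτ), u = exp(2πiz), y = Im z, and
let θ(z) = ∏_{n ≥ 0} (1 - qⁿu) ∏_{n ≥ 1} (1 - qⁿ/u). The function g_τ(z) = exp(-π(y²/T - y + T/6))
|θ(z)| (`greenFun`) is doubly periodic and vanishes exactly on the lattice, to first order; log g_τ
+ πy²/T is harmonic off the lattice; log g_τ has mean zero; and g_τ(z)/|z| tends to 2π|η(τ)|² at 0
(`exists_greenFun_eq_norm_mul`). Hence g_τ(z - w) is the Arakelov–Green function in any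
uniformization (`arakelovGreen_apply`). Uniqueness is Liouville's theorem: the difference of the
logarithms of two candidates extends to a doubly periodic harmonic function, which is constant, and
the mean-zero condition makes the constant 0.

A compact connected complex Lie group of dimension one is such a torus
(`exists_additive_uniformization`), and f lifts to multiplication by some a ≠ 0
(`exists_multiplier`). Choose a representative s_x in ℂ of each x in Ker f and consider log
g_{τ'}(az) - ∑_x log g_τ(z + s_x). It is periodic, its logarithmic singularities cancel, and its
quadratic terms cancel because |a|²T = N T' (`norm_sq_mul_im`: multiplication by a carries the first
lattice to a sublattice of index N in the second). By Liouville it is constant, and since every term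
has mean zero the constant is 0 (`potentialDifference_eq_zero`). So g_{τ'}(az) = ∏_x g_τ(z + s_x).

Dividing by |z| and letting z tend to 0 gives |a| |η(τ')|² = |η(τ)|² ∏_{x ≠ 0} g_τ(s_x)
(`prod_greenFun_section`). With |a|√T = √N √T' this is the theorem, because ‖η‖² = √T |η(τ)|². That
this last quantity is independent of τ also follows from leading coefficients, now of one Green
function in two uniformizations (`sqrt_im_mul_norm_eta_sq_eq`). -/

open Complex in
/-- The `q`-Pochhammer product `∏_{n ≥ 0} (1 - qⁿ u)`. -/
def qProd (q u : ℂ) : ℂ := ∏' n : ℕ, (1 - q ^ n * u)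

/-! ### Convergence and zeros of the q-product -/

section QProd

variable {q : ℂ}

lemma summable_norm_qProd (hq : ‖q‖ < 1) (u : ℂ) : Summable fun n : ℕ => ‖-(q ^ n * u)‖ := by
  simp only [norm_neg, norm_mul, norm_pow]
  exact (summable_geometric_of_lt_one (norm_nonneg _) hq).mul_right _

lemma multipliable_qProd (hq : ‖q‖ < 1) (u : ℂ) : Multipliable fun n : ℕ => 1 - q ^ n * u := by
  simpa [sub_eq_add_neg] using multipliable_one_add_of_summable (summable_norm_qProd hq u)

lemma qProd_eq_mul (hq : ‖q‖ < 1) (u : ℂ) : qProd q u = (1 - u) * qProd q (q * u) := by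
  have h : Multipliable fun n : ℕ => 1 - q ^ (n + 1) * u := by
    simpa [pow_succ, mul_assoc] using multipliable_qProd hq (q * u)
  have h' := tprod_eq_zero_mul' (f := fun n : ℕ => 1 - q ^ n * u) h
  simpa [qProd, pow_succ, mul_assoc] using h'

lemma qProd_zero (q : ℂ) : qProd q 0 = 1 := by simp [qProd]

lemma qProd_ne_zero (hq : ‖q‖ < 1) {u : ℂ} (h : ∀ n : ℕ, q ^ n * u ≠ 1) : qProd q u ≠ 0 := by
  have := tprod_one_add_ne_zero_of_summable (f := fun n : ℕ => -(q ^ n * u))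
    (fun n => by rw [← sub_eq_add_neg]; exact sub_ne_zero.2 (h n).symm) (summable_norm_qProd hq u)
  simpa [qProd, sub_eq_add_neg] using this

lemma qProd_ne_zero_of_norm_lt (hq : ‖q‖ < 1) {u : ℂ} (hu : ‖u‖ < 1) : qProd q u ≠ 0 := by
  refine qProd_ne_zero hq fun n h => ?_
  have h1 : ‖q ^ n * u‖ < 1 := by
    rw [norm_mul, norm_pow]
    calc ‖q‖ ^ n * ‖u‖ ≤ 1 * ‖u‖ := by
          gcongr; exact pow_le_one₀ (norm_nonneg _) hq.le
      _ < 1 := by simpa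
  rw [h] at h1
  simp at h1

/-- The product converges locally uniformly on every ball, by comparison with a geometric series, so
holomorphy passes to the limit. -/
lemma differentiable_qProd (hq : ‖q‖ < 1) : Differentiable ℂ (qProd q) := by
  have key : ∀ R : ℝ, DifferentiableOn ℂ (qProd q) (Metric.ball 0 R) := by
    intro R
    have hs : Summable fun n : ℕ => ‖q‖ ^ n * R :=
      (summable_geometric_of_lt_one (norm_nonneg _) hq).mul_right _
    have := hs.hasProdLocallyUniformlyOn_nat_one_add (f := fun n u => -(q ^ n * u))
      (K := Metric.ball (0 : ℂ) R) Metric.isOpen_ball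
      (.of_forall fun n x hx => by
        have hx' : ‖x‖ ≤ R := by simpa using (Metric.mem_ball.1 hx).le
        simp only [norm_neg, norm_mul, norm_pow]
        gcongr) (fun n => by fun_prop)
    have h2 := this.differentiableOn
      (.of_forall fun _ ↦ by simpa [Finset.prod_fn] using
        DifferentiableOn.finsetProd (fun _ _ ↦ by fun_prop)) Metric.isOpen_ball
    simp only [← sub_eq_add_neg] at h2
    exact h2
  intro u
  exact (key (‖u‖ + 1)).differentiableAt (Metric.isOpen_ball.mem_nhds (by simp))

end QProd

/-- `exp (2πiz)`. -/
def expTwoPiI (z : ℂ) : ℂ := Complex.exp (2 * Real.pi * Complex.I * z)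

/-! ### The normalized exponential -/

section ExpTwoPiI

lemma expTwoPiI_add (z w : ℂ) : expTwoPiI (z + w) = expTwoPiI z * expTwoPiI w := by
  simp [expTwoPiI, mul_add, Complex.exp_add]

lemma expTwoPiI_neg (z : ℂ) : expTwoPiI (-z) = (expTwoPiI z)⁻¹ := by
  simp [expTwoPiI, Complex.exp_neg]

lemma expTwoPiI_ne_zero (z : ℂ) : expTwoPiI z ≠ 0 := Complex.exp_ne_zero _

lemma expTwoPiI_zero : expTwoPiI 0 = 1 := by simp [expTwoPiI]

lemma expTwoPiI_nat_mul (n : ℕ) (z : ℂ) : expTwoPiI (n * z) = expTwoPiI z ^ n := by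
  rw [expTwoPiI, expTwoPiI, ← Complex.exp_nat_mul]; ring_nf

lemma expTwoPiI_eq_one_iff {z : ℂ} : expTwoPiI z = 1 ↔ ∃ m : ℤ, z = m := by
  rw [expTwoPiI, Complex.exp_eq_one_iff]
  refine exists_congr fun m => ⟨fun h => ?_, fun h => by rw [h]; ring⟩
  have : (2 * Real.pi * Complex.I) * z = (2 * Real.pi * Complex.I) * m := by rw [h]; ring
  exact mul_left_cancel₀ Complex.two_pi_I_ne_zero this

lemma expTwoPiI_int (m : ℤ) : expTwoPiI m = 1 := expTwoPiI_eq_one_iff.2 ⟨m, rfl⟩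

lemma expTwoPiI_one : expTwoPiI 1 = 1 := by simpa using expTwoPiI_int 1

lemma norm_expTwoPiI (z : ℂ) : ‖expTwoPiI z‖ = Real.exp (-(2 * Real.pi * z.im)) := by
  simp [expTwoPiI, Complex.norm_exp]

lemma norm_expTwoPiI_lt_one {z : ℂ} (hz : 0 < z.im) : ‖expTwoPiI z‖ < 1 := by
  rw [norm_expTwoPiI, Real.exp_lt_one_iff]
  have := Real.pi_pos
  nlinarith [mul_pos this hz]

lemma hasDerivAt_expTwoPiI (z : ℂ) :
    HasDerivAt expTwoPiI (2 * Real.pi * Complex.I * expTwoPiI z) z := by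
  exact ((hasDerivAt_id' z).const_mul (2 * Real.pi * Complex.I)).cexp.congr_deriv
    (by rw [mul_one, mul_comm, expTwoPiI])

@[fun_prop]
lemma differentiable_expTwoPiI : Differentiable ℂ expTwoPiI :=
  fun z => (hasDerivAt_expTwoPiI z).differentiableAt

end ExpTwoPiI

/-! ### The theta product and the explicit Green function of a torus -/

section Theta

variable (τ : UpperHalfPlane)

lemma norm_nome_lt_one : ‖expTwoPiI τ‖ < 1 := norm_expTwoPiI_lt_one τ.im_pos

/-- The theta function `∏_{n ≥ 0} (1 - qⁿ u) ∏_{n ≥ 1} (1 - qⁿ / u)` with `q = exp (2πiτ)` and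
`u = exp (2πiz)`, in product form. -/
def thetaProd (z : ℂ) : ℂ :=
  qProd (expTwoPiI τ) (expTwoPiI z) * qProd (expTwoPiI τ) (expTwoPiI (τ - z))

/-- Isolates the only factor vanishing at 0; the remaining factor is even in z, which gives the
reflection formula and the derivative at 0. -/
lemma thetaProd_eq (z : ℂ) : thetaProd τ z = (1 - expTwoPiI z) *
    (qProd (expTwoPiI τ) (expTwoPiI (τ + z)) * qProd (expTwoPiI τ) (expTwoPiI (τ - z))) := by
  rw [thetaProd, qProd_eq_mul (norm_nome_lt_one τ) (expTwoPiI z), expTwoPiI_add, mul_assoc]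

lemma differentiable_thetaProd : Differentiable ℂ (thetaProd τ) := by
  have h := differentiable_qProd (norm_nome_lt_one τ)
  unfold thetaProd
  exact (h.comp differentiable_expTwoPiI).mul
    (h.comp (differentiable_expTwoPiI.comp (differentiable_const (τ : ℂ) |>.sub differentiable_id)))

lemma thetaProd_add_one (z : ℂ) : thetaProd τ (z + 1) = thetaProd τ z := by
  have h : (τ : ℂ) - (z + 1) = (τ - z) + (-1) := by ring
  rw [thetaProd, thetaProd, h, expTwoPiI_add, expTwoPiI_add, expTwoPiI_neg, expTwoPiI_one]
  simp

lemma thetaProd_neg (z : ℂ) : thetaProd τ (-z) = -expTwoPiI (-z) * thetaProd τ z := by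
  rw [thetaProd_eq, thetaProd_eq, sub_neg_eq_add, ← sub_eq_add_neg, expTwoPiI_neg]
  field_simp [expTwoPiI_ne_zero]
  ring

/-- The shift u ↦ qu drops the factor 1 - u from the first product and adds 1 - 1/u to the second;
the quotient of the two is -1/u. -/
lemma thetaProd_add_period (z : ℂ) :
    thetaProd τ (z + τ) = -expTwoPiI (-z) * thetaProd τ z := by
  have h : (τ : ℂ) - (z + τ) = -z := by ring
  have h1 : z + (τ : ℂ) = τ + z := by ring
  have h2 : expTwoPiI τ * expTwoPiI (-z) = expTwoPiI (τ - z) := by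
    rw [← expTwoPiI_add, ← sub_eq_add_neg]
  rw [thetaProd_eq τ z, thetaProd, h, qProd_eq_mul (norm_nome_lt_one τ) (expTwoPiI (-z)), h1, h2,
    expTwoPiI_neg]
  field_simp [expTwoPiI_ne_zero]
  ring

/-- The period lattice `ℤ + ℤτ`. -/
def periodLattice : AddSubgroup ℂ where
  carrier := {z | ∃ m n : ℤ, z = m + n * (τ : ℂ)}
  zero_mem' := ⟨0, 0, by simp⟩
  add_mem' := by
    rintro _ _ ⟨m, n, rfl⟩ ⟨m', n', rfl⟩
    exact ⟨m + m', n + n', by push_cast; ring⟩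
  neg_mem' := by
    rintro _ ⟨m, n, rfl⟩
    exact ⟨-m, -n, by push_cast; ring⟩

variable {τ} in
lemma mem_periodLattice {z : ℂ} : z ∈ periodLattice τ ↔ ∃ m n : ℤ, z = m + n * (τ : ℂ) := Iff.rfl

lemma period_mem_periodLattice : (τ : ℂ) ∈ periodLattice τ := ⟨0, 1, by simp⟩

lemma apply_add_of_mem_periodLattice {β : Type*} {F : ℂ → β} (h1 : ∀ z, F (z + 1) = F z)
    (h2 : ∀ z, F (z + τ) = F z) {l : ℂ} (hl : l ∈ periodLattice τ) (z : ℂ) : F (z + l) = F z := by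
  obtain ⟨m, n, rfl⟩ := hl
  have h1' : Function.Periodic F 1 := h1
  have h2' : Function.Periodic F (τ : ℂ) := h2
  rw [← add_assoc, h2'.int_mul n, ← mul_one (m : ℂ), h1'.int_mul m]

lemma qProd_expTwoPiI_eq_zero {z : ℂ} (h : qProd (expTwoPiI τ) (expTwoPiI z) = 0) :
    z ∈ periodLattice τ := by
  by_contra hz
  refine qProd_ne_zero (norm_nome_lt_one τ) (u := expTwoPiI z) (fun n hn => hz ?_) h
  rw [← expTwoPiI_nat_mul, ← expTwoPiI_add, expTwoPiI_eq_one_iff] at hn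
  obtain ⟨m, hm⟩ := hn
  exact ⟨m, -n, by push_cast; linear_combination hm⟩

lemma thetaProd_ne_zero {z : ℂ} (h : z ∉ periodLattice τ) : thetaProd τ z ≠ 0 := by
  refine mul_ne_zero (fun h0 => h (qProd_expTwoPiI_eq_zero τ h0)) (fun h0 => h ?_)
  have := (periodLattice τ).sub_mem (period_mem_periodLattice τ) (qProd_expTwoPiI_eq_zero τ h0)
  simpa using this

lemma thetaProd_zero : thetaProd τ 0 = 0 := by
  rw [thetaProd_eq, expTwoPiI_zero]; simp

lemma eta_eq : ‖ModularForm.eta (τ : ℂ)‖ =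
    Real.exp (-(Real.pi * τ.im / 12)) * ‖qProd (expTwoPiI τ) (expTwoPiI τ)‖ := by
  have h : ∀ n : ℕ, ModularForm.eta_q n (τ : ℂ) = expTwoPiI τ ^ n * expTwoPiI τ := by
    intro n
    rw [ModularForm.eta_q_eq_pow, pow_succ]; rfl
  rw [ModularForm.eta, norm_mul, Function.Periodic.norm_qParam, qProd]
  simp only [h]
  congr 2
  rw [UpperHalfPlane.coe_im]
  ring

lemma eta_norm_pos : 0 < ‖ModularForm.eta (τ : ℂ)‖ :=
  norm_pos_iff.2 (ModularForm.eta_ne_zero τ.im_pos)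

/-- The derivative at 0 is -2πi ∏ (1 - qⁿ)² over n ≥ 1, and exp(-πT/6) is |q|^{1/12}, the square of
the modulus of the prefactor q^{1/24} of η. -/
lemma norm_deriv_thetaProd_zero : Real.exp (-(Real.pi * τ.im / 6)) * ‖deriv (thetaProd τ) 0‖ =
    2 * Real.pi * ‖ModularForm.eta (τ : ℂ)‖ ^ 2 := by
  have hd := differentiable_qProd (norm_nome_lt_one τ)
  have hg : DifferentiableAt ℂ (fun z => qProd (expTwoPiI τ) (expTwoPiI (τ + z)) *
      qProd (expTwoPiI τ) (expTwoPiI (τ - z))) 0 := by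
    refine DifferentiableAt.mul ?_ ?_
    · exact (hd.comp (differentiable_expTwoPiI.comp
        ((differentiable_const (τ : ℂ)).add differentiable_id))) 0
    · exact (hd.comp (differentiable_expTwoPiI.comp
        ((differentiable_const (τ : ℂ)).sub differentiable_id))) 0
  have h1 : HasDerivAt (fun z => 1 - expTwoPiI z) (-(2 * Real.pi * Complex.I * expTwoPiI 0)) 0 :=
    (hasDerivAt_expTwoPiI 0).const_sub 1
  have h := (h1.mul hg.hasDerivAt).deriv
  have heq : thetaProd τ = (fun z => 1 - expTwoPiI z) * (fun z =>
      qProd (expTwoPiI τ) (expTwoPiI (τ + z)) * qProd (expTwoPiI τ) (expTwoPiI (τ - z))) :=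
    funext fun z => thetaProd_eq τ z
  rw [heq, h, expTwoPiI_zero, eta_eq, mul_pow, ← Real.exp_nat_mul]
  simp only [mul_one, neg_mul, add_zero, sub_zero, sub_self, zero_mul, norm_neg, norm_mul,
    Complex.norm_ofNat, Complex.norm_real, Real.norm_eq_abs, abs_of_pos Real.pi_pos,
    Complex.norm_I]
  rw [show ((2 : ℕ) : ℝ) * -(Real.pi * τ.im / 12) = -(Real.pi * τ.im / 6) by push_cast; ring]
  ring

/-- The Gaussian factor making the absolute value of the theta function doubly periodic. -/
def greenExponent (y : ℝ) : ℝ := -(Real.pi * (y ^ 2 / τ.im - y + τ.im / 6))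

/-- The Arakelov–Green function of `ℂ / (ℤ + ℤτ)`, as a function of the difference. -/
def greenFun (z : ℂ) : ℝ := Real.exp (greenExponent τ z.im) * ‖thetaProd τ z‖

lemma greenFun_nonneg (z : ℂ) : 0 ≤ greenFun τ z := by unfold greenFun; positivity

lemma greenFun_add_one (z : ℂ) : greenFun τ (z + 1) = greenFun τ z := by
  simp [greenFun, thetaProd_add_one]

/-- Under y ↦ y + T the Gaussian exponent changes by -2πy, which compensates the factor |1/u| =
exp(2πy) acquired by the theta product. -/
lemma greenFun_add_period (z : ℂ) : greenFun τ (z + τ) = greenFun τ z := by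
  have hT := τ.im_pos
  rw [greenFun, greenFun, thetaProd_add_period, norm_mul, norm_neg, norm_expTwoPiI, ← mul_assoc,
    ← Real.exp_add]
  congr 2
  simp only [greenExponent, Complex.add_im, UpperHalfPlane.coe_im, Complex.neg_im]
  field_simp
  ring

lemma greenFun_neg (z : ℂ) : greenFun τ (-z) = greenFun τ z := by
  rw [greenFun, greenFun, thetaProd_neg, norm_mul, norm_neg, norm_expTwoPiI, ← mul_assoc,
    ← Real.exp_add]
  congr 2
  simp only [greenExponent, Complex.neg_im]
  ring

lemma greenFun_add_of_mem {l : ℂ} (hl : l ∈ periodLattice τ) (z : ℂ) :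
    greenFun τ (z + l) = greenFun τ z :=
  apply_add_of_mem_periodLattice τ (greenFun_add_one τ) (greenFun_add_period τ) hl z

lemma greenFun_eq_zero_iff {z : ℂ} : greenFun τ z = 0 ↔ z ∈ periodLattice τ := by
  constructor
  · intro h
    by_contra hz
    exact mul_ne_zero (Real.exp_ne_zero _) (norm_ne_zero_iff.2 (thetaProd_ne_zero τ hz)) h
  · intro h
    have := greenFun_add_of_mem τ h 0
    rw [zero_add] at this
    rw [this, greenFun, thetaProd_zero]; simp

lemma greenFun_pos {z : ℂ} (h : z ∉ periodLattice τ) : 0 < greenFun τ z :=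
  (greenFun_nonneg τ z).lt_of_ne' fun h0 => h ((greenFun_eq_zero_iff τ).1 h0)

lemma log_greenFun {z : ℂ} (h : z ∉ periodLattice τ) :
    Real.log (greenFun τ z) = greenExponent τ z.im + Real.log ‖thetaProd τ z‖ := by
  rw [greenFun, Real.log_mul (Real.exp_ne_zero _) (norm_ne_zero_iff.2 (thetaProd_ne_zero τ h)),
    Real.log_exp]

lemma continuous_greenFun : Continuous (greenFun τ) := by
  have := (differentiable_thetaProd τ).continuous
  unfold greenFun greenExponent
  fun_prop

/-- The Green function is `‖z‖` times a positive smooth function near the origin. -/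
lemma exists_greenFun_eq_norm_mul : ∃ U : ℂ → ℝ, ContDiffAt ℝ ∞ U 0 ∧
    U 0 = 2 * Real.pi * ‖ModularForm.eta (τ : ℂ)‖ ^ 2 ∧ ∀ z, greenFun τ z = ‖z‖ * U z := by
  have hR : Differentiable ℂ (dslope (thetaProd τ) 0) := by
    rw [← differentiableOn_univ, Complex.differentiableOn_dslope Filter.univ_mem]
    exact (differentiable_thetaProd τ).differentiableOn
  have h0 : Real.exp (greenExponent τ 0) * ‖dslope (thetaProd τ) 0 0‖ =
      2 * Real.pi * ‖ModularForm.eta (τ : ℂ)‖ ^ 2 := by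
    rw [dslope_same, ← norm_deriv_thetaProd_zero, greenExponent]
    congr 2
    ring
  have hR0 : dslope (thetaProd τ) 0 0 ≠ 0 := by
    intro h
    have := eta_norm_pos τ
    have hpos : 0 < 2 * Real.pi * ‖ModularForm.eta (τ : ℂ)‖ ^ 2 := by positivity
    rw [← h0, h] at hpos
    simp at hpos
  refine ⟨fun z => Real.exp (greenExponent τ z.im) * ‖dslope (thetaProd τ) 0 z‖, ?_, ?_, ?_⟩
  · refine ContDiffAt.mul ?_ ?_
    · have : ContDiff ℝ ∞ fun z : ℂ => Real.exp (greenExponent τ z.im) := by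
        have him : ContDiff ℝ ∞ Complex.im := Complex.imCLM.contDiff
        unfold greenExponent
        fun_prop
      exact this.contDiffAt
    · exact ((hR.contDiff (n := ∞)).restrict_scalars ℝ).contDiffAt.norm ℝ hR0
  · simpa using h0
  · intro z
    have := sub_smul_dslope (thetaProd τ) 0 z
    rw [thetaProd_zero, sub_zero, sub_zero, smul_eq_mul] at this
    rw [greenFun, ← this, norm_mul]
    ring

lemma contDiff_greenFun_sq : ContDiff ℝ ∞ fun z => greenFun τ z ^ 2 := by
  have him : ContDiff ℝ ∞ Complex.im := Complex.imCLM.contDiff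
  have h1 : ContDiff ℝ ∞ fun z => ‖thetaProd τ z‖ ^ 2 :=
    (((differentiable_thetaProd τ).contDiff (n := ∞)).restrict_scalars ℝ).norm_sq ℝ
  have h2 : ContDiff ℝ ∞ fun z : ℂ => Real.exp (greenExponent τ z.im) ^ 2 := by
    unfold greenExponent
    fun_prop
  simp only [greenFun, mul_pow]
  exact h2.mul h1

lemma isClosed_periodLattice : IsClosed (periodLattice τ : Set ℂ) := by
  have : (periodLattice τ : Set ℂ) = greenFun τ ⁻¹' {0} := by
    ext z; simp [greenFun_eq_zero_iff]
  rw [this]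
  exact isClosed_singleton.preimage (continuous_greenFun τ)

/-- The logarithm of the Green function is harmonic up to a quadratic function. -/
lemma exists_log_greenFun_add_harmonic {z₀ : ℂ} (h : z₀ ∉ periodLattice τ) :
    InnerProductSpace.HarmonicAt
      (fun z : ℂ => Real.log (greenFun τ z) + Real.pi / τ.im * z.im ^ 2) z₀ := by
  have hev : ∀ᶠ z in 𝓝 z₀, z ∉ periodLattice τ :=
    (isClosed_periodLattice τ).isOpen_compl.mem_nhds h
  have h1 : InnerProductSpace.HarmonicAt (fun z : ℂ => Real.log ‖thetaProd τ z‖) z₀ :=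
    ((differentiable_thetaProd τ).analyticAt z₀).harmonicAt_log_norm (thetaProd_ne_zero τ h)
  have h2 : InnerProductSpace.HarmonicAt (fun z : ℂ => z.im) z₀ := analyticAt_id.harmonicAt_im
  have h3 := h1.add ((h2.const_smul (c := Real.pi)).add
    (InnerProductSpace.harmonicAt_const (-(Real.pi * (τ.im / 6)))))
  refine (InnerProductSpace.harmonicAt_congr_nhds ?_).1 h3
  filter_upwards [hev] with z hz
  simp only [Pi.add_apply, Pi.smul_apply, smul_eq_mul, log_greenFun τ hz, greenExponent]
  ring

end Theta

/-! ### The logarithm of the Green function has mean zero -/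

section MeanValue

variable (τ : UpperHalfPlane)

lemma continuous_log_norm_qProd_row {q a : ℂ} (hq : ‖q‖ < 1) (ha : ‖a‖ < 1) :
    Continuous fun x : ℝ => Real.log ‖qProd q (expTwoPiI x * a)‖ := by
  have h := (differentiable_qProd hq).continuous
  have h2 := differentiable_expTwoPiI.continuous
  refine Continuous.log (by fun_prop) fun x => norm_ne_zero_iff.2 ?_
  refine qProd_ne_zero_of_norm_lt hq ?_
  simpa [norm_mul, norm_expTwoPiI] using ha

/-- For |a| < 1 the function w ↦ `qProd q (w * a)` has no zero on the closed unit disc, so the mean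
of the logarithm of its modulus over the circle is the value at w = 0, namely log 1. -/
lemma integral_log_norm_qProd_row {q a : ℂ} (hq : ‖q‖ < 1) (ha : ‖a‖ < 1) :
    ∫ x : ℝ in (0)..1, Real.log ‖qProd q (expTwoPiI x * a)‖ = 0 := by
  have hd : Differentiable ℂ fun w => qProd q (w * a) :=
    (differentiable_qProd hq).comp (differentiable_id.mul_const a)
  have h := AnalyticOnNhd.circleAverage_log_norm_of_ne_zero (R := 1) (c := 0)
    (g := fun w => qProd q (w * a)) (fun z _ => hd.analyticAt z) (fun u hu => by
      refine qProd_ne_zero_of_norm_lt hq ?_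
      have hu' : ‖u‖ ≤ 1 := by simpa using hu
      rw [norm_mul]
      calc ‖u‖ * ‖a‖ ≤ 1 * ‖a‖ := by gcongr
        _ < 1 := by simpa)
  rw [Real.circleAverage_def] at h
  simp only [zero_mul, qProd_zero, norm_one, Real.log_one, smul_eq_mul] at h
  have hpi : (2 * Real.pi) ≠ 0 := by positivity
  have h2 := intervalIntegral.integral_comp_mul_left (a := 0) (b := 1)
    (fun θ => Real.log ‖qProd q (circleMap 0 1 θ * a)‖) hpi
  rw [mul_zero, mul_one, smul_eq_mul, h] at h2
  rw [← h2]
  congr 1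
  ext x
  congr 4
  simp only [circleMap, expTwoPiI]
  push_cast
  rw [zero_add, one_mul]
  ring_nf

lemma integral_log_norm_qProd_row_neg {q a : ℂ} (hq : ‖q‖ < 1) (ha : ‖a‖ < 1) :
    ∫ x : ℝ in (0)..1, Real.log ‖qProd q (expTwoPiI (-x) * a)‖ = 0 := by
  refine Eq.trans ?_ (integral_log_norm_qProd_row hq ha)
  have := intervalIntegral.integral_comp_sub_left (a := 0) (b := 1)
    (fun x : ℝ => Real.log ‖qProd q (expTwoPiI x * a)‖) 1
  rw [sub_zero, sub_self] at this
  refine Eq.trans ?_ this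
  congr 1
  ext x
  push_cast
  rw [sub_eq_add_neg, expTwoPiI_add, expTwoPiI_one, one_mul]

lemma im_row (x y : ℝ) : ((x : ℂ) + y * (τ : ℂ)).im = y * τ.im := by
  simp [UpperHalfPlane.coe_im]

lemma re_row (x y : ℝ) : ((x : ℂ) + y * (τ : ℂ)).re = x + y * τ.re := by
  simp [UpperHalfPlane.coe_re]

variable {τ} in
lemma row_mem_periodLattice {x y : ℝ} (h : (x : ℂ) + y * (τ : ℂ) ∈ periodLattice τ) :
    (∃ m : ℤ, x = m) ∧ ∃ n : ℤ, y = n := by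
  obtain ⟨m, n, h⟩ := h
  have hT := τ.im_pos.ne'
  have h1 := congrArg Complex.im h
  have h2 := congrArg Complex.re h
  rw [im_row, show (m : ℂ) + n * (τ : ℂ) = ((m : ℝ) : ℂ) + (n : ℝ) * (τ : ℂ) by push_cast; rfl,
    im_row] at h1
  rw [re_row, show (m : ℂ) + n * (τ : ℂ) = ((m : ℝ) : ℂ) + (n : ℝ) * (τ : ℂ) by push_cast; rfl,
    re_row] at h2
  have hy : y = n := mul_right_cancel₀ hT h1
  exact ⟨⟨m, by rw [hy] at h2; linarith⟩, n, hy⟩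

lemma row_notMem_periodLattice {y : ℝ} (hy : y ∈ Set.Ioo (0 : ℝ) 1) (x : ℝ) :
    (x : ℂ) + y * (τ : ℂ) ∉ periodLattice τ := by
  intro h
  obtain ⟨n, hn⟩ := (row_mem_periodLattice h).2
  have h0 : (0 : ℤ) < n := by exact_mod_cast hn ▸ hy.1
  have h1 : n < (1 : ℤ) := by exact_mod_cast hn ▸ hy.2
  omega

/-- For 0 < y < 1 both u and q/u have modulus less than 1. Written this way, each product falls
under the mean value property on the unit disc. -/
lemma log_greenFun_row {y : ℝ} (hy : y ∈ Set.Ioo (0 : ℝ) 1) (x : ℝ) :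
    Real.log (greenFun τ (x + y * τ)) = greenExponent τ (y * τ.im) +
      (Real.log ‖qProd (expTwoPiI τ) (expTwoPiI x * expTwoPiI (y * τ))‖ +
        Real.log ‖qProd (expTwoPiI τ) (expTwoPiI (-x) * expTwoPiI ((1 - y : ℝ) * τ))‖) := by
  have h := row_notMem_periodLattice τ hy x
  have h0 := thetaProd_ne_zero τ h
  rw [log_greenFun τ h, im_row]
  rw [thetaProd] at h0 ⊢
  rw [norm_mul, Real.log_mul (norm_ne_zero_iff.2 (left_ne_zero_of_mul h0))
    (norm_ne_zero_iff.2 (right_ne_zero_of_mul h0)), ← expTwoPiI_add, ← expTwoPiI_add,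
    show (-x : ℂ) + (1 - y : ℝ) * (τ : ℂ) = τ - (x + y * τ) by push_cast; ring]

lemma norm_expTwoPiI_mul_lt_one {y : ℝ} (hy : 0 < y) : ‖expTwoPiI (y * τ)‖ < 1 := by
  refine norm_expTwoPiI_lt_one ?_
  have := im_row τ 0 y
  rw [Complex.ofReal_zero, zero_add] at this
  rw [this]
  exact mul_pos hy τ.im_pos

lemma continuous_log_greenFun_row {y : ℝ} (hy : y ∈ Set.Ioo (0 : ℝ) 1) :
    Continuous fun x : ℝ => Real.log (greenFun τ (x + y * τ)) := by
  have := continuous_greenFun τ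
  exact Continuous.log (by fun_prop) fun x => (greenFun_pos τ (row_notMem_periodLattice τ hy x)).ne'

lemma integral_log_greenFun_row {y : ℝ} (hy : y ∈ Set.Ioo (0 : ℝ) 1) :
    ∫ x : ℝ in (0)..1, Real.log (greenFun τ (x + y * τ)) = greenExponent τ (y * τ.im) := by
  have hq := norm_nome_lt_one τ
  have h1 := norm_expTwoPiI_mul_lt_one τ hy.1
  have h2 := norm_expTwoPiI_mul_lt_one τ (sub_pos.2 hy.2)
  simp_rw [log_greenFun_row τ hy]
  have hc1 := continuous_log_norm_qProd_row hq h1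
  have hc2 : Continuous fun x : ℝ => Real.log ‖qProd (expTwoPiI τ)
      (expTwoPiI (-x) * expTwoPiI ((1 - y : ℝ) * τ))‖ := by
    have := (continuous_log_norm_qProd_row hq h2).comp continuous_neg
    simpa [Function.comp_def] using this
  rw [intervalIntegral.integral_add (by simp)
    (IntervalIntegrable.add (hc1.intervalIntegrable 0 1) (hc2.intervalIntegrable 0 1)), intervalIntegral.integral_add
    (hc1.intervalIntegrable _ _) (hc2.intervalIntegrable _ _), integral_log_norm_qProd_row hq h1,
    integral_log_norm_qProd_row_neg hq h2]
  simp

/-- The exponent is -πT times the Bernoulli polynomial y² - y + 1/6, whose integral over [0, 1] is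
0. This is what fixes the constant T/6 in the Green function. -/
lemma integral_greenExponent : ∫ y : ℝ in (0)..1, greenExponent τ (y * τ.im) = 0 := by
  have hT := τ.im_pos.ne'
  have h : ∀ y : ℝ, greenExponent τ (y * τ.im) = -(Real.pi * τ.im) * (y ^ 2 - y + 1 / 6) := by
    intro y
    rw [greenExponent]
    field_simp
  simp only [h]
  rw [intervalIntegral.integral_const_mul, intervalIntegral.integral_add,
    intervalIntegral.integral_sub]
  · norm_num [integral_pow, integral_id]
  any_goals exact Continuous.intervalIntegrable (by fun_prop) _ _

lemma exists_greenFun_row_le : ∃ K : ℝ, 0 ≤ K ∧ ∀ x ∈ Set.Ico (0 : ℝ) 1, ∀ y ∈ Set.Ico (0 : ℝ) 1,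
    Real.log (greenFun τ (x + y * τ)) ≤ K := by
  have hc : Continuous fun p : ℝ × ℝ => greenFun τ (p.1 + p.2 * τ) := by
    have := continuous_greenFun τ
    fun_prop
  obtain ⟨M, hM⟩ := ((isCompact_Icc.prod isCompact_Icc).bddAbove_image
    (hc.continuousOn (s := Set.Icc (0 : ℝ) 1 ×ˢ Set.Icc (0 : ℝ) 1)))
  refine ⟨|M|, abs_nonneg M, fun x hx y hy => ?_⟩
  have h1 : greenFun τ (x + y * τ) ≤ M :=
    hM ⟨(x, y), ⟨Set.Ico_subset_Icc_self hx, Set.Ico_subset_Icc_self hy⟩, rfl⟩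
  exact ((Real.log_le_self (greenFun_nonneg _ _)).trans h1).trans (le_abs_self M)

lemma integrableOn_log_greenFun_square :
    IntegrableOn (fun p : ℝ × ℝ => Real.log (greenFun τ (p.1 + p.2 * τ)))
      (Set.Ico (0 : ℝ) 1 ×ˢ Set.Ico (0 : ℝ) 1) ∧
    ∫ p in Set.Ico (0 : ℝ) 1 ×ˢ Set.Ico (0 : ℝ) 1, Real.log (greenFun τ (p.1 + p.2 * τ)) = 0 := by
  obtain ⟨K, hK0, hK⟩ := exists_greenFun_row_le τ
  have hmeas : Measurable fun p : ℝ × ℝ => Real.log (greenFun τ (p.1 + p.2 * τ)) := by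
    have hc : Continuous fun p : ℝ × ℝ => greenFun τ (p.1 + p.2 * τ) := by
      have := continuous_greenFun τ
      fun_prop
    exact Real.measurable_log.comp hc.measurable
  -- The row y = 0 runs through lattice points; it is discarded as a null set.
  have hae : ∀ᵐ y ∂(volume.restrict (Set.Ico (0 : ℝ) 1)), y ∈ Set.Ioo (0 : ℝ) 1 := by
    rw [← restrict_Ioo_eq_restrict_Ico]
    exact ae_restrict_mem measurableSet_Ioo
  have hrow : ∀ y ∈ Set.Ioo (0 : ℝ) 1, IntegrableOn
      (fun x : ℝ => Real.log (greenFun τ (x + y * τ))) (Set.Ico 0 1) := fun y hy =>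
    ((continuous_log_greenFun_row τ hy).integrableOn_Icc (a := 0) (b := 1)).mono_set
      Set.Ico_subset_Icc_self
  have hrowint : ∀ y ∈ Set.Ioo (0 : ℝ) 1,
      ∫ x in Set.Ico (0 : ℝ) 1, Real.log (greenFun τ (x + y * τ)) = greenExponent τ (y * τ.im) := by
    intro y hy
    rw [← integral_log_greenFun_row τ hy, intervalIntegral.integral_of_le zero_le_one,
      ← restrict_Ioo_eq_restrict_Ioc, restrict_Ioo_eq_restrict_Ico]
  have hvol : (volume : Measure (ℝ × ℝ)).restrict (Set.Ico (0 : ℝ) 1 ×ˢ Set.Ico (0 : ℝ) 1) =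
      (volume.restrict (Set.Ico (0 : ℝ) 1)).prod (volume.restrict (Set.Ico (0 : ℝ) 1)) := by
    rw [Measure.prod_restrict]; rfl
  have hexp : Continuous fun y : ℝ => greenExponent τ (y * τ.im) := by
    unfold greenExponent; fun_prop
  have hfin : IsFiniteMeasure (volume.restrict (Set.Ico (0 : ℝ) 1)) := inferInstance
  -- The logarithm is bounded above by K but not below. Since K minus it is nonnegative, the
  -- integral of its norm over a row is K minus the row mean, which is continuous in y;
  -- integrability on the square follows.
  have hintK : Integrable (fun p : ℝ × ℝ => K - Real.log (greenFun τ (p.1 + p.2 * τ)))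
      ((volume.restrict (Set.Ico (0 : ℝ) 1)).prod (volume.restrict (Set.Ico (0 : ℝ) 1))) := by
    refine (integrable_prod_iff' (Measurable.aestronglyMeasurable
      (measurable_const.sub hmeas))).2 ?_
    constructor
    · filter_upwards [hae] with y hy
      exact (integrable_const K).sub (hrow y hy)
    · have h1 : Integrable (fun y : ℝ => K - greenExponent τ (y * τ.im))
          (volume.restrict (Set.Ico (0 : ℝ) 1)) :=
        (((continuous_const.sub hexp).integrableOn_Icc (a := 0) (b := 1)).mono_set
          Set.Ico_subset_Icc_self)
      refine h1.congr ?_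
      filter_upwards [hae] with y hy
      rw [← hrowint y hy]
      have : ∫ x in Set.Ico (0 : ℝ) 1, ‖K - Real.log (greenFun τ (x + y * τ))‖ =
          ∫ x in Set.Ico (0 : ℝ) 1, (K - Real.log (greenFun τ (x + y * τ))) := by
        refine setIntegral_congr_fun measurableSet_Ico fun x hx => ?_
        exact Real.norm_of_nonneg (sub_nonneg.2 (hK x hx y ⟨hy.1.le, hy.2⟩))
      refine Eq.trans ?_ this.symm
      rw [integral_sub (integrable_const K) (hrow y hy)]
      simp
  have hint : Integrable (fun p : ℝ × ℝ => Real.log (greenFun τ (p.1 + p.2 * τ)))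
      ((volume.restrict (Set.Ico (0 : ℝ) 1)).prod (volume.restrict (Set.Ico (0 : ℝ) 1))) := by
    have := (integrable_const K).sub hintK
    simpa only [Pi.sub_def, sub_sub_cancel] using this
  rw [IntegrableOn, hvol]
  refine ⟨hint, ?_⟩
  rw [integral_prod_symm _ hint]
  have : ∫ y in Set.Ico (0 : ℝ) 1, ∫ x in Set.Ico (0 : ℝ) 1, Real.log (greenFun τ (x + y * τ)) =
      ∫ y in Set.Ico (0 : ℝ) 1, greenExponent τ (y * τ.im) :=
    integral_congr_ae (hae.mono fun y hy => hrowint y hy)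
  refine this.trans ?_
  have h0 := integral_greenExponent τ
  rwa [intervalIntegral.integral_of_le zero_le_one,
      ← restrict_Ioo_eq_restrict_Ioc, restrict_Ioo_eq_restrict_Ico] at h0

end MeanValue

/-! ### The period parallelogram as a fundamental domain -/

section FundamentalDomain

variable (τ : UpperHalfPlane)

/-- The real-linear map `x + iy ↦ x + yτ`. -/
def periodMap : ℂ →L[ℝ] ℂ := Complex.reCLM.smulRight (1 : ℂ) + Complex.imCLM.smulRight (τ : ℂ)

lemma periodMap_apply (z : ℂ) : periodMap τ z = z.re + z.im * τ := by
  simp [periodMap]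

lemma det_periodMap : (periodMap τ).det = τ.im := by
  rw [ContinuousLinearMap.det, ← LinearMap.det_toMatrix Complex.basisOneI, Matrix.det_fin_two]
  simp [LinearMap.toMatrix_apply, periodMap_apply, UpperHalfPlane.coe_im]

lemma injective_periodMap : Function.Injective (periodMap τ) := by
  rw [injective_iff_map_eq_zero]
  intro z hz
  rw [periodMap_apply] at hz
  have h1 := congrArg Complex.im hz
  rw [im_row] at h1
  have h2 := congrArg Complex.re hz
  rw [re_row] at h2
  have hz1 : z.im = 0 := by simpa [τ.im_pos.ne'] using h1
  rw [hz1] at h2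
  exact Complex.ext (by simpa using h2) hz1

/-- The half-open unit square. -/
def unitSquare : Set ℂ := Set.Ico (0 : ℝ) 1 ×ℂ Set.Ico (0 : ℝ) 1

lemma measurableSet_unitSquare : MeasurableSet unitSquare :=
  (measurableSet_Ico.preimage Complex.measurable_re).inter
    (measurableSet_Ico.preimage Complex.measurable_im)

/-- The half-open period parallelogram. -/
def periodDomain : Set ℂ := periodMap τ '' unitSquare

lemma measurableSet_periodDomain : MeasurableSet (periodDomain τ) :=
  measurableSet_unitSquare.image_of_continuousOn_injOn (periodMap τ).continuous.continuousOn
    (injective_periodMap τ).injOn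

/-- In the real coordinates x, y with z = x + yτ, the unique translation subtracts the integer parts
of x and y. -/
lemma existsUnique_add_mem_periodDomain (z : ℂ) :
    ∃! l : periodLattice τ, (l : ℂ) + z ∈ periodDomain τ := by
  obtain ⟨y, hy⟩ : ∃ y : ℝ, y * τ.im = z.im := ⟨z.im / τ.im, div_mul_cancel₀ _ τ.im_pos.ne'⟩
  obtain ⟨x, hx⟩ : ∃ x : ℝ, x + y * τ.re = z.re := ⟨z.re - y * τ.re, by ring⟩
  have hz : z = x + y * τ := Complex.ext (by rw [re_row, hx]) (by rw [im_row, hy])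
  refine ⟨⟨-⌊x⌋ + -⌊y⌋ * τ, -⌊x⌋, -⌊y⌋, by push_cast; rfl⟩, ?_, ?_⟩
  · refine ⟨⟨Int.fract x, Int.fract y⟩, ⟨⟨Int.fract_nonneg x, Int.fract_lt_one x⟩,
      ⟨Int.fract_nonneg y, Int.fract_lt_one y⟩⟩, ?_⟩
    simp only [periodMap_apply, hz, Int.fract]
    push_cast
    ring
  · rintro ⟨_, m, n, rfl⟩ ⟨w, ⟨hw1, hw2⟩, hw⟩
    have hw1 : w.re ∈ Set.Ico (0 : ℝ) 1 := hw1
    have hw2 : w.im ∈ Set.Ico (0 : ℝ) 1 := hw2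
    simp only [periodMap_apply, hz] at hw
    have h := injective_periodMap τ (a₁ := w) (a₂ := ⟨m + x, n + y⟩) (by
      rw [periodMap_apply, periodMap_apply, hw]; push_cast; ring)
    have h1 : w.re = m + x := by rw [h]
    have h2 : w.im = n + y := by rw [h]
    rw [h1] at hw1
    rw [h2] at hw2
    have e1 : ⌊x⌋ = -m := by
      rw [Int.floor_eq_iff]; push_cast; constructor <;> linarith [hw1.1, hw1.2]
    have e2 : ⌊y⌋ = -n := by
      rw [Int.floor_eq_iff]; push_cast; constructor <;> linarith [hw2.1, hw2.2]
    simp [e1, e2]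

instance countable_periodLattice : Countable (periodLattice τ) := by
  have : Function.Surjective fun p : ℤ × ℤ =>
      (⟨p.1 + p.2 * τ, p.1, p.2, rfl⟩ : periodLattice τ) := by
    rintro ⟨_, m, n, rfl⟩
    exact ⟨(m, n), rfl⟩
  exact this.countable

lemma isAddFundamentalDomain_of_existsUnique {D : Set ℂ} (hD : MeasurableSet D)
    (h : ∀ z, ∃! l : periodLattice τ, (l : ℂ) + z ∈ D) :
    IsAddFundamentalDomain (periodLattice τ) D :=
  IsAddFundamentalDomain.mk' hD.nullMeasurableSet h

lemma isAddFundamentalDomain_periodDomain :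
    IsAddFundamentalDomain (periodLattice τ) (periodDomain τ) :=
  isAddFundamentalDomain_of_existsUnique τ (measurableSet_periodDomain τ)
    (existsUnique_add_mem_periodDomain τ)

lemma volume_periodDomain : volume (periodDomain τ) = ENNReal.ofReal τ.im := by
  have h := Measure.addHaar_image_continuousLinearMap (volume : Measure ℂ) (periodMap τ) unitSquare
  rw [show LinearMap.det (periodMap τ : ℂ →ₗ[ℝ] ℂ) = τ.im from det_periodMap τ,
    abs_of_pos τ.im_pos] at h
  have h1 : volume unitSquare = 1 := by
    have := Complex.volume_preserving_equiv_real_prod.measure_preimage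
      (s := Set.Ico (0 : ℝ) 1 ×ˢ Set.Ico (0 : ℝ) 1)
      (measurableSet_Ico.prod measurableSet_Ico).nullMeasurableSet
    rw [Measure.volume_eq_prod, Measure.prod_prod] at this
    refine this.trans ?_
    simp
  rw [periodDomain, h, h1, mul_one]

lemma integrableOn_log_greenFun : IntegrableOn (fun z => Real.log (greenFun τ z)) (periodDomain τ) ∧
    ∫ z in periodDomain τ, Real.log (greenFun τ z) = 0 := by
  obtain ⟨h1, h2⟩ := integrableOn_log_greenFun_square τ
  have hpre : Complex.measurableEquivRealProd ⁻¹' (Set.Ico (0 : ℝ) 1 ×ˢ Set.Ico (0 : ℝ) 1) =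
      unitSquare := rfl
  have hmp := Complex.volume_preserving_equiv_real_prod
  have h1' : IntegrableOn (fun z : ℂ => Real.log (greenFun τ (periodMap τ z))) unitSquare := by
    have := (hmp.integrableOn_comp_preimage
      Complex.measurableEquivRealProd.measurableEmbedding).2 h1
    simp only [periodMap_apply]
    exact this
  have h2' : ∫ z in unitSquare, Real.log (greenFun τ (periodMap τ z)) = 0 := by
    have := hmp.setIntegral_preimage_emb Complex.measurableEquivRealProd.measurableEmbedding
      (fun p : ℝ × ℝ => Real.log (greenFun τ (p.1 + p.2 * τ)))
      (Set.Ico (0 : ℝ) 1 ×ˢ Set.Ico (0 : ℝ) 1)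
    rw [h2] at this
    simp only [periodMap_apply]
    exact this
  have hd : ∀ z ∈ unitSquare, HasFDerivWithinAt (periodMap τ) (periodMap τ) unitSquare z :=
    fun z _ => (periodMap τ).hasFDerivWithinAt
  constructor
  · rw [periodDomain, integrableOn_image_iff_integrableOn_abs_det_fderiv_smul volume
      measurableSet_unitSquare hd (injective_periodMap τ).injOn]
    exact h1'.smul (|(periodMap τ).det|)
  · rw [periodDomain, integral_image_eq_integral_abs_det_fderiv_smul volume
      measurableSet_unitSquare hd (injective_periodMap τ).injOn, integral_smul, h2', smul_zero]

/-- A translate or reflected translate of the Green function has mean zero. -/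
lemma integrableOn_log_greenFun_sub (w : ℂ) :
    IntegrableOn (fun z => Real.log (greenFun τ (w - z))) (periodDomain τ) ∧
    ∫ z in periodDomain τ, Real.log (greenFun τ (w - z)) = 0 := by
  obtain ⟨h1, h2⟩ := integrableOn_log_greenFun τ
  have hmp : MeasurePreserving (fun z : ℂ => w - z) := Measure.measurePreserving_sub_left volume w
  have hemb : MeasurableEmbedding (fun z : ℂ => w - z) :=
    (MeasurableEquiv.subLeft w).measurableEmbedding
  have hF := isAddFundamentalDomain_periodDomain τ
  -- The preimage of the parallelogram under z ↦ w - z is again a fundamental domain, and a periodic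
  -- function has the same integral over both.
  have hD : IsAddFundamentalDomain (periodLattice τ) ((fun z : ℂ => w - z) ⁻¹' periodDomain τ) := by
    refine isAddFundamentalDomain_of_existsUnique τ
      ((measurableSet_periodDomain τ).preimage hmp.measurable) fun z => ?_
    obtain ⟨l, hl, hu⟩ := existsUnique_add_mem_periodDomain τ (w - z)
    refine ⟨-l, ?_, fun l' hl' => ?_⟩
    · have : w - (((-l : periodLattice τ) : ℂ) + z) = l + (w - z) := by push_cast; ring
      simpa only [Set.mem_preimage, this] using hl
    · rw [← hu (-l') ?_, neg_neg]
      have : w - ((l' : ℂ) + z) = ((-l' : periodLattice τ) : ℂ) + (w - z) := by push_cast; ring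
      simpa only [Set.mem_preimage, this] using hl'
  have hinv : ∀ (l : periodLattice τ) (z : ℂ),
      Real.log (greenFun τ (w - (l +ᵥ z))) = Real.log (greenFun τ (w - z)) := by
    intro l z
    have : w - (l +ᵥ z) = (w - z) + ((-l : periodLattice τ) : ℂ) := by
      rw [AddSubgroup.vadd_def, vadd_eq_add]; push_cast; ring
    rw [this, greenFun_add_of_mem τ (-l).2]
  constructor
  · rw [hF.integrableOn_iff hD hinv]
    exact (hmp.integrableOn_comp_preimage hemb).2 h1
  · rw [hF.setIntegral_eq hD hinv, ← h2]
    exact hmp.setIntegral_preimage_emb hemb (fun z => Real.log (greenFun τ z)) _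

end FundamentalDomain

/-! ### Uniformizations and pullback of differentials -/

section Uniformization

variable {X : Type*} [TopologicalSpace X] [ChartedSpace ℂ X]

/-- A holomorphic map `q : ℂ → X` that identifies `X` with `ℂ / (ℤ + ℤτ)`. -/
structure IsUniformization (q : ℂ → X) (τ : UpperHalfPlane) : Prop where
  holomorphic : MDifferentiable 𝓘(ℂ, ℂ) 𝓘(ℂ, ℂ) q
  surjective : Function.Surjective q
  eq_iff : ∀ z w : ℂ, q z = q w ↔ z - w ∈ periodLattice τ

lemma isTorusOfPeriod_iff {τ : UpperHalfPlane} :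
    IsTorusOfPeriod X τ ↔ ∃ q : ℂ → X, IsUniformization q τ :=
  ⟨fun ⟨q, h1, h2, h3⟩ => ⟨q, h1, h2, h3⟩, fun ⟨q, h⟩ => ⟨q, h.1, h.2, h.3⟩⟩

/-- The lattice is discrete because it is the zero set of g_τ, and near 0 this function is |z| times
a positive factor. -/
lemma eventually_notMem_periodLattice (τ : UpperHalfPlane) :
    ∀ᶠ z in 𝓝[≠] (0 : ℂ), z ∉ periodLattice τ := by
  obtain ⟨U, hU, hU0, hg⟩ := exists_greenFun_eq_norm_mul τ
  have hpos : 0 < U 0 := by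
    rw [hU0]
    have := eta_norm_pos τ
    positivity
  filter_upwards [(hU.continuousAt.eventually (lt_mem_nhds hpos)).filter_mono nhdsWithin_le_nhds,
    self_mem_nhdsWithin] with z hz hz0
  rw [← greenFun_eq_zero_iff, hg]
  exact mul_ne_zero (norm_ne_zero_iff.2 hz0) hz.ne'

lemma eventually_sub_notMem_periodLattice (τ : UpperHalfPlane) (z : ℂ) :
    ∀ᶠ w in 𝓝[≠] z, w - z ∉ periodLattice τ := by
  have h : Filter.Tendsto (fun w => w - z) (𝓝[≠] z) (𝓝[≠] 0) := by
    refine tendsto_nhdsWithin_iff.2 ⟨?_, ?_⟩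
    · have : Filter.Tendsto (fun w => w - z) (𝓝 z) (𝓝 (z - z)) := by
        exact (continuous_id.sub continuous_const).tendsto z
      rw [sub_self] at this
      exact this.mono_left nhdsWithin_le_nhds
    · filter_upwards [self_mem_nhdsWithin] with w hw
      exact sub_ne_zero.2 hw
  exact h.eventually (eventually_notMem_periodLattice τ)

namespace IsUniformization

variable {q : ℂ → X} {τ : UpperHalfPlane}

lemma apply_add (hq : IsUniformization q τ) {l : ℂ} (hl : l ∈ periodLattice τ) (z : ℂ) : q (z + l) = q z := by
  rw [hq.eq_iff]; simpa using hl

lemma continuous (hq : IsUniformization q τ) : Continuous q := hq.holomorphic.continuous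

lemma isOpen_preimage_source (hq : IsUniformization q τ) (e : OpenPartialHomeomorph X ℂ) : IsOpen (q ⁻¹' e.source) :=
  e.open_source.preimage hq.continuous

variable [IsManifold 𝓘(ℂ, ℂ) 1 X]

lemma differentiableAt_chart (hq : IsUniformization q τ) {e : OpenPartialHomeomorph X ℂ} (he : e ∈ atlas ℂ X) {z : ℂ}
    (hz : q z ∈ e.source) : DifferentiableAt ℂ (e ∘ q) z :=
  mdifferentiableAt_iff_differentiableAt.1
    ((mdifferentiableAt_atlas he hz).comp z (hq.holomorphic z))

lemma analyticAt_chart (hq : IsUniformization q τ) {e : OpenPartialHomeomorph X ℂ} (he : e ∈ atlas ℂ X) {z : ℂ}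
    (hz : q z ∈ e.source) : AnalyticAt ℂ (e ∘ q) z := by
  have h : DifferentiableOn ℂ (e ∘ q) (q ⁻¹' e.source) := fun w hw =>
    (hq.differentiableAt_chart he hw).differentiableWithinAt
  exact h.analyticAt ((hq.isOpen_preimage_source e).mem_nhds hz)

/-- The pullback of a differential to `ℂ` in terms of its coefficient in a chart. -/
lemma pullback_eq_coeff (hq : IsUniformization q τ) (α : (x : X) → (TangentSpace 𝓘(ℂ, ℂ) x →L[ℂ] ℂ))
    {e : OpenPartialHomeomorph X ℂ} (he : e ∈ atlas ℂ X) {z : ℂ} (hz : q z ∈ e.source) :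
    α (q z) (mfderiv 𝓘(ℂ, ℂ) 𝓘(ℂ, ℂ) q z (1 : ℂ)) =
      coeff α e (e (q z)) * deriv (e ∘ q) z := by
  have hm := e.map_source hz
  have hd1 : MDifferentiableAt 𝓘(ℂ, ℂ) 𝓘(ℂ, ℂ) e.symm ((e ∘ q) z) :=
    mdifferentiableAt_atlas_symm he hm
  have hd2 : MDifferentiableAt 𝓘(ℂ, ℂ) 𝓘(ℂ, ℂ) (e ∘ q) z :=
    (hq.differentiableAt_chart he hz).mdifferentiableAt
  have heq : (e.symm ∘ (e ∘ q)) =ᶠ[𝓝 z] q := by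
    filter_upwards [(hq.isOpen_preimage_source e).mem_nhds hz] with w hw
    exact e.left_inv hw
  have h1 : ∀ (y : X) (v : ℂ), y = q z → (α y : ℂ →L[ℂ] ℂ) v = (α (q z) : ℂ →L[ℂ] ℂ) v := by
    rintro _ v rfl; rfl
  have h2 : ∀ v : ℂ, (mfderiv 𝓘(ℂ, ℂ) 𝓘(ℂ, ℂ) q z : ℂ →L[ℂ] ℂ) v =
      (mfderiv 𝓘(ℂ, ℂ) 𝓘(ℂ, ℂ) e.symm ((e ∘ q) z) : ℂ →L[ℂ] ℂ) (fderiv ℂ (e ∘ q) z v) := by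
    intro v
    have := hd1.hasMFDerivAt.comp z hd2.hasMFDerivAt
    have h3 := (this.congr_of_eventuallyEq heq.symm).mfderiv
    rw [mfderiv_eq_fderiv] at h3
    exact congrArg (fun L : ℂ →L[ℂ] ℂ => L v) h3
  have key : ∀ A B C D : ℂ →L[ℂ] ℂ, (∀ v, B v = C (D v)) → A (B 1) = A (C 1) * D 1 := by
    intro A B C D h
    rw [h 1, show D 1 = D 1 • (1 : ℂ) by simp, map_smul, map_smul, smul_eq_mul, mul_comm]
    simp
  have e2 := h1 (e.symm (e (q z))) ((mfderiv 𝓘(ℂ, ℂ) 𝓘(ℂ, ℂ) e.symm ((e ∘ q) z) : ℂ →L[ℂ] ℂ) (1 : ℂ))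
    (e.left_inv hz)
  have e3 : coeff α e (e (q z)) = (α (q z) : ℂ →L[ℂ] ℂ)
      ((mfderiv 𝓘(ℂ, ℂ) 𝓘(ℂ, ℂ) e.symm ((e ∘ q) z) : ℂ →L[ℂ] ℂ) (1 : ℂ)) := e2
  rw [e3, ← fderiv_apply_one_eq_deriv]
  exact key _ _ _ _ h2

/-- A holomorphic differential pulls back to a constant multiple of `dz`. -/
lemma exists_pullback_const (hq : IsUniformization q τ) {α : (x : X) → (TangentSpace 𝓘(ℂ, ℂ) x →L[ℂ] ℂ)}
    (hα : α ∈ HolomorphicDifferentials X) :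
    ∃ c : ℂ, ∀ e ∈ atlas ℂ X, ∀ z, q z ∈ e.source →
      coeff α e (e (q z)) * deriv (e ∘ q) z = c := by
  set h : ℂ → ℂ := fun z => α (q z) (mfderiv 𝓘(ℂ, ℂ) 𝓘(ℂ, ℂ) q z (1 : ℂ)) with hdef
  have hloc : ∀ e ∈ atlas ℂ X, ∀ z, q z ∈ e.source →
      h z = coeff α e (e (q z)) * deriv (e ∘ q) z :=
    fun e he z hz => hq.pullback_eq_coeff α he hz
  have hd : Differentiable ℂ h := by
    intro z
    have he := chart_mem_atlas ℂ (q z)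
    have hz := mem_chart_source ℂ (q z)
    have heq : h =ᶠ[𝓝 z] fun w => coeff α (chartAt ℂ (q z)) ((chartAt ℂ (q z) ∘ q) w) *
        deriv (chartAt ℂ (q z) ∘ q) w := by
      filter_upwards [(hq.isOpen_preimage_source _).mem_nhds hz] with w hw
      exact hloc _ he w hw
    rw [heq.differentiableAt_iff]
    have h1 : DifferentiableAt ℂ (coeff α (chartAt ℂ (q z))) ((chartAt ℂ (q z) ∘ q) z) :=
      (hα _ he).differentiableAt ((chartAt ℂ (q z)).open_target.mem_nhds
        ((chartAt ℂ (q z)).map_source hz))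
    exact (h1.comp z (hq.differentiableAt_chart he hz)).mul
      (hq.analyticAt_chart he hz).deriv.differentiableAt
  have hper : ∀ l ∈ periodLattice τ, ∀ z, h (z + l) = h z := by
    intro l hl z
    have he := chart_mem_atlas ℂ (q z)
    have hz := mem_chart_source ℂ (q z)
    have hz' : q (z + l) ∈ (chartAt ℂ (q z)).source := by rw [hq.apply_add hl]; exact hz
    rw [hloc _ he _ hz', hloc _ he _ hz, hq.apply_add hl, ← deriv_comp_add_const]
    congr 2
    ext w
    simp [hq.apply_add hl]
  -- The pullback coefficient is entire and periodic, so all its values occur on a compact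
  -- parallelogram, and Liouville's theorem applies.
  have hb : Bornology.IsBounded (Set.range h) := by
    have hK : IsCompact (periodMap τ '' (Set.Icc (0 : ℝ) 1 ×ℂ Set.Icc (0 : ℝ) 1)) :=
      (isCompact_Icc.reProdIm isCompact_Icc).image (periodMap τ).continuous
    refine (hK.image hd.continuous).isBounded.subset ?_
    rintro _ ⟨z, rfl⟩
    obtain ⟨l, hl, -⟩ := existsUnique_add_mem_periodDomain τ z
    refine ⟨l + z, ?_, by rw [add_comm]; exact hper l l.2 z⟩
    exact Set.image_mono (Set.preimage_mono Set.Ico_subset_Icc_self |> fun h1 =>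
      Set.inter_subset_inter h1 (Set.preimage_mono Set.Ico_subset_Icc_self)) hl
  exact ⟨h 0, fun e he z hz => by
    rw [← hloc e he z hz]; exact hd.apply_eq_apply_of_bounded hb z 0⟩

/-- Otherwise q would be constant near z, whereas its fibres are cosets of a discrete lattice. -/
lemma deriv_chart_not_eventually_zero (hq : IsUniformization q τ)
    {e : OpenPartialHomeomorph X ℂ} (he : e ∈ atlas ℂ X) {z : ℂ} (hz : q z ∈ e.source) :
    ∀ᶠ w in 𝓝[≠] z, deriv (e ∘ q) w ≠ 0 := by
  rcases (hq.analyticAt_chart he hz).deriv.eventually_eq_zero_or_eventually_ne_zero with h | h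
  · exfalso
    have h2 : ∀ᶠ w in 𝓝 z, w - z ∈ periodLattice τ := by
      obtain ⟨r, hr, hball⟩ := Metric.eventually_nhds_iff_ball.1
        (h.and ((hq.isOpen_preimage_source e).mem_nhds hz))
      filter_upwards [Metric.ball_mem_nhds z hr] with w hw
      have hd : ∀ x ∈ Metric.ball z r, DifferentiableAt ℂ (e ∘ q) x := fun x hx =>
        hq.differentiableAt_chart he (hball x hx).2
      have h3 : (e ∘ q) w = (e ∘ q) z :=
        (convex_ball z r).is_const_of_fderivWithin_eq_zero (𝕜 := ℂ) (f := e ∘ q)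
          (fun x hx => (hd x hx).differentiableWithinAt) (fun x hx => by
            rw [fderivWithin_of_isOpen Metric.isOpen_ball hx]
            ext
            simpa using (hball x hx).1) hw (Metric.mem_ball_self hr)
      rw [← hq.eq_iff]
      exact e.injOn (hball w hw).2 hz h3
    obtain ⟨w, hw, hw'⟩ := ((h2.filter_mono nhdsWithin_le_nhds).and
      (eventually_sub_notMem_periodLattice τ z)).exists
    exact hw' hw
  · exact h

/-- If c = 0, the coefficient of α vanishes wherever the derivative of the chart expression does
not, that is on a punctured neighbourhood of each point, and hence at the point itself by
continuity. -/
lemma pullback_const_ne_zero (hq : IsUniformization q τ)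
    {α : (x : X) → (TangentSpace 𝓘(ℂ, ℂ) x →L[ℂ] ℂ)} (hα : α ∈ HolomorphicDifferentials X)
    (h0 : α ≠ 0) {c : ℂ} (hc : ∀ e ∈ atlas ℂ X, ∀ z, q z ∈ e.source →
      coeff α e (e (q z)) * deriv (e ∘ q) z = c) : c ≠ 0 := by
  rintro rfl
  refine h0 (funext fun x => ?_)
  obtain ⟨z, rfl⟩ := hq.surjective x
  have he := chart_mem_atlas ℂ (q z)
  have hz := mem_chart_source ℂ (q z)
  set e := chartAt ℂ (q z) with hedef
  have h1 : ContinuousAt (fun w => coeff α e ((e ∘ q) w)) z := by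
    have h2 : ContinuousAt (coeff α e) ((e ∘ q) z) :=
      ((hα _ he).differentiableAt (e.open_target.mem_nhds (e.map_source hz))).continuousAt
    exact h2.comp (hq.differentiableAt_chart he hz).continuousAt
  have h2 : coeff α e (e (q z)) = 0 := by
    have h3 : ∀ᶠ w in 𝓝[≠] z, coeff α e ((e ∘ q) w) = 0 := by
      filter_upwards [hq.deriv_chart_not_eventually_zero he hz,
        nhdsWithin_le_nhds ((hq.isOpen_preimage_source e).mem_nhds hz)] with w hw hw'
      exact (mul_eq_zero.1 (hc e he w hw')).resolve_right hw
    exact tendsto_nhds_unique (h1.tendsto.mono_left nhdsWithin_le_nhds)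
      (tendsto_const_nhds.congr' (h3.mono fun w hw => hw.symm))
  have hmd := mdifferentiable_of_mem_atlas (I := 𝓘(ℂ, ℂ)) he
  have hsurj := hmd.symm.mfderiv_surjective (x := e (q z)) (e.map_source hz)
  have key : ∀ A B : ℂ →L[ℂ] ℂ, A (B 1) = 0 → Function.Surjective B → A = 0 := by
    intro A B hAB hB
    ext
    obtain ⟨v, hv⟩ := hB 1
    rw [← hv, show v = v • (1 : ℂ) by simp, map_smul, map_smul, hAB]
    simp
  have h3 : ∀ (y : X), y = q z → (α y : ℂ →L[ℂ] ℂ) = (α (q z) : ℂ →L[ℂ] ℂ) := by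
    rintro _ rfl; rfl
  have h4 := key (α (e.symm (e (q z)))) _ h2 hsurj
  exact (h3 _ (e.left_inv hz)).symm.trans h4

/-- A uniformization is a local biholomorphism. -/
lemma deriv_chart_ne_zero (hq : IsUniformization q τ) (hX : genus X = 1)
    {e : OpenPartialHomeomorph X ℂ} (he : e ∈ atlas ℂ X) {z : ℂ} (hz : q z ∈ e.source) :
    deriv (e ∘ q) z ≠ 0 := by
  -- Genus one supplies a nonzero differential. Its pullback is a nonzero constant having the
  -- derivative of the chart expression as a factor.
  have : Nontrivial (HolomorphicDifferentials X) :=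
    Module.nontrivial_of_finrank_pos (R := ℂ) (by rw [← genus, hX]; exact one_pos)
  obtain ⟨⟨α, hα⟩, h0⟩ := exists_ne (0 : HolomorphicDifferentials X)
  obtain ⟨c, hc⟩ := hq.exists_pullback_const hα
  have := hq.pullback_const_ne_zero hα (fun h => h0 (Subtype.ext h)) hc
  rw [← hc e he z hz] at this
  exact right_ne_zero_of_mul this

end IsUniformization

end Uniformization

/-! ### The canonical measure in a uniformization -/

section AreaMeasure

variable {X : Type*} [TopologicalSpace X] [ChartedSpace ℂ X]

lemma injOn_periodDomain {q : ℂ → X} {τ : UpperHalfPlane} (hq : IsUniformization q τ) :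
    Set.InjOn q (periodDomain τ) := by
  intro z hz w hw h
  have hl := (hq.eq_iff z w).1 h
  obtain ⟨l, -, hu⟩ := existsUnique_add_mem_periodDomain τ w
  have h1 := hu 0 (by simpa using hw)
  have h2 := hu ⟨z - w, hl⟩ (by simpa using hz)
  rw [← h1] at h2
  have h3 : z - w = 0 := congrArg Subtype.val h2
  exact sub_eq_zero.1 h3

lemma exists_mem_periodDomain {q : ℂ → X} {τ : UpperHalfPlane} (hq : IsUniformization q τ) (x : X) :
    ∃ z ∈ periodDomain τ, q z = x := by
  obtain ⟨z, rfl⟩ := hq.surjective x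
  obtain ⟨l, hl, -⟩ := existsUnique_add_mem_periodDomain τ z
  exact ⟨l + z, hl, by rw [add_comm, hq.apply_add l.2]⟩

lemma det_restrictScalars_toSpanSingleton (a : ℂ) :
    ((ContinuousLinearMap.toSpanSingleton ℂ a).restrictScalars ℝ : ℂ →L[ℝ] ℂ).det = ‖a‖ ^ 2 := by
  rw [ContinuousLinearMap.det, ← LinearMap.det_toMatrix Complex.basisOneI, Matrix.det_fin_two,
    ← Complex.normSq_eq_norm_sq, Complex.normSq_apply]
  simp [LinearMap.toMatrix_apply]

variable [MeasurableSpace X]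

/-- The canonical probability measure of `X` in terms of a uniformization. -/
def torusMeasure (q : ℂ → X) (τ : UpperHalfPlane) : Measure X :=
  ENNReal.ofReal (τ.im)⁻¹ • Measure.map q (volume.restrict (periodDomain τ))

variable [BorelSpace X]

lemma integral_torusMeasure {q : ℂ → X} {τ : UpperHalfPlane}
    (hq : IsUniformization q τ) {φ : X → ℝ} (hφ : Measurable φ) :
    ∫ x, φ x ∂(torusMeasure q τ) = (τ.im)⁻¹ * ∫ z in periodDomain τ, φ (q z) := by
  rw [torusMeasure, integral_smul_measure, integral_map hq.continuous.measurable.aemeasurable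
    hφ.aestronglyMeasurable, ENNReal.toReal_ofReal (inv_nonneg.2 τ.im_pos.le), smul_eq_mul]

lemma integrable_torusMeasure_iff {q : ℂ → X} {τ : UpperHalfPlane}
    (hq : IsUniformization q τ) {φ : X → ℝ} (hφ : Measurable φ) :
    Integrable φ (torusMeasure q τ) ↔ IntegrableOn (fun z => φ (q z)) (periodDomain τ) := by
  rw [torusMeasure, integrable_smul_measure (by simpa using τ.im_pos) ENNReal.ofReal_ne_top,
    integrable_map_measure hφ.aestronglyMeasurable hq.continuous.measurable.aemeasurable]
  rfl

variable [IsManifold 𝓘(ℂ, ℂ) 1 X]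

/-- Change of variables along the chart expression of q, which is injective on the relevant part of
the parallelogram. Its real Jacobian is |(e ∘ q)'|², and the product with |h|² is the constant |c|².
-/
lemma map_chart_eq_restrict {q : ℂ → X} {τ : UpperHalfPlane} (hq : IsUniformization q τ)
    {α : (x : X) → (TangentSpace 𝓘(ℂ, ℂ) x →L[ℂ] ℂ)} {c : ℂ}
    (hc : ∀ e ∈ atlas ℂ X, ∀ z, q z ∈ e.source →
      coeff α e (e (q z)) * deriv (e ∘ q) z = c)
    {e : OpenPartialHomeomorph X ℂ} (he : e ∈ atlas ℂ X) :
    Measure.map e.symm ((volume.restrict e.target).withDensity fun z => ‖coeff α e z‖ₑ ^ 2) =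
      (‖c‖ₑ ^ 2 • Measure.map q (volume.restrict (periodDomain τ))).restrict e.source := by
  have hqm : Measurable q := hq.continuous.measurable
  have hem : AEMeasurable e.symm
      ((volume.restrict e.target).withDensity fun z => ‖coeff α e z‖ₑ ^ 2) :=
    (e.continuousOn_symm.aemeasurable e.open_target.measurableSet).mono_ac
      (withDensity_absolutelyContinuous _ _)
  ext A hA
  have hAs : MeasurableSet (A ∩ e.source) := hA.inter e.open_source.measurableSet
  set S := q ⁻¹' (A ∩ e.source) ∩ periodDomain τ with hS
  have hSm : MeasurableSet S := (hqm hAs).inter (measurableSet_periodDomain τ)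
  have himage : e.symm ⁻¹' A ∩ e.target = (e ∘ q) '' S := by
    ext w
    constructor
    · rintro ⟨h1, h2⟩
      obtain ⟨z, hz, hzw⟩ := exists_mem_periodDomain hq (e.symm w)
      exact ⟨z, ⟨⟨by rw [hzw]; exact h1, by rw [hzw]; exact e.map_target h2⟩, hz⟩,
        by rw [Function.comp_apply, hzw, e.right_inv h2]⟩
    · rintro ⟨z, ⟨⟨h1, h2⟩, hz⟩, rfl⟩
      exact ⟨by rw [Function.comp_apply, Set.mem_preimage, e.left_inv h2]; exact h1,
        e.map_source h2⟩
  have hinj : Set.InjOn (e ∘ q) S := fun z hz w hw h =>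
    injOn_periodDomain hq hz.2 hw.2 (e.injOn hz.1.2 hw.1.2 h)
  have hderiv : ∀ z ∈ S, HasFDerivWithinAt (e ∘ q)
      ((ContinuousLinearMap.toSpanSingleton ℂ (deriv (e ∘ q) z)).restrictScalars ℝ) S z :=
    fun z hz => ((hq.differentiableAt_chart he
      hz.1.2).hasDerivAt.hasFDerivAt.restrictScalars ℝ).hasFDerivWithinAt
  rw [Measure.map_apply_of_aemeasurable hem hA, withDensity_apply',
    Measure.restrict_restrict' e.open_target.measurableSet, himage,
    lintegral_image_eq_lintegral_abs_det_fderiv_mul volume hSm hderiv hinj,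
    Measure.restrict_apply hA, Measure.smul_apply, Measure.map_apply hqm hAs,
    Measure.restrict_apply (hqm hAs), ← hS, smul_eq_mul, ← setLIntegral_const]
  refine setLIntegral_congr_fun hSm fun z hz => ?_
  have h := hc e he z hz.1.2
  simp only [det_restrictScalars_toSpanSingleton, Function.comp_apply]
  rw [← h, abs_of_nonneg (by positivity), enorm_mul, mul_pow, mul_comm, ENNReal.ofReal_pow
    (norm_nonneg _), ofReal_norm]

/-- Each local measure is the restriction of one global measure ν to a chart domain, so the supremum
is at most ν; equality is tested on finitely many chart domains covering X. -/
lemma areaMeasure_eq [CompactSpace X] {q : ℂ → X} {τ : UpperHalfPlane} (hq : IsUniformization q τ)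
    {α : (x : X) → (TangentSpace 𝓘(ℂ, ℂ) x →L[ℂ] ℂ)} {c : ℂ}
    (hc : ∀ e ∈ atlas ℂ X, ∀ z, q z ∈ e.source →
      coeff α e (e (q z)) * deriv (e ∘ q) z = c) :
    areaMeasure α = ‖c‖ₑ ^ 2 • Measure.map q (volume.restrict (periodDomain τ)) := by
  set ν := ‖c‖ₑ ^ 2 • Measure.map q (volume.restrict (periodDomain τ)) with hν
  have hle : areaMeasure α ≤ ν := by
    refine iSup₂_le fun e he => ?_
    rw [map_chart_eq_restrict hq hc he]
    exact Measure.restrict_le_self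
  obtain ⟨t, ht⟩ := isCompact_univ.elim_finite_subcover (fun x : X => (chartAt ℂ x).source)
    (fun x => (chartAt ℂ x).open_source)
    (fun x _ => Set.mem_iUnion.2 ⟨x, mem_chart_source ℂ x⟩)
  have hcov : ⋃ x : t, (chartAt ℂ (x : X)).source = Set.univ := by
    refine Set.eq_univ_of_forall fun y => ?_
    obtain ⟨x, hx, hy⟩ := Set.mem_iUnion₂.1 (ht (Set.mem_univ y))
    exact Set.mem_iUnion.2 ⟨⟨x, hx⟩, hy⟩
  rw [Measure.ext_iff_of_iUnion_eq_univ hcov]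
  intro x
  refine le_antisymm (Measure.restrict_mono_measure hle _) ?_
  have he := chart_mem_atlas ℂ (x : X)
  have h1 : ν.restrict (chartAt ℂ (x : X)).source ≤ areaMeasure α := by
    rw [hν, ← map_chart_eq_restrict hq hc he]
    exact le_iSup₂_of_le (f := fun (e : OpenPartialHomeomorph X ℂ) (_ : e ∈ atlas ℂ X) =>
      Measure.map e.symm ((volume.restrict e.target).withDensity fun z => ‖coeff α e z‖ₑ ^ 2))
      _ he le_rfl
  have h2 := Measure.restrict_mono_measure h1 (chartAt ℂ (x : X)).source
  rwa [Measure.restrict_restrict (chartAt ℂ (x : X)).open_source.measurableSet, Set.inter_self] at h2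

lemma isUnitDifferential_iff [CompactSpace X] {q : ℂ → X} {τ : UpperHalfPlane}
    (hq : IsUniformization q τ)
    {α : (x : X) → (TangentSpace 𝓘(ℂ, ℂ) x →L[ℂ] ℂ)} {c : ℂ}
    (hc : ∀ e ∈ atlas ℂ X, ∀ z, q z ∈ e.source →
      coeff α e (e (q z)) * deriv (e ∘ q) z = c) :
    IsUnitDifferential α ↔ ‖c‖ ^ 2 * τ.im = 1 := by
  rw [IsUnitDifferential, areaMeasure_eq hq hc, Measure.smul_apply,
    Measure.map_apply hq.continuous.measurable MeasurableSet.univ, Set.preimage_univ,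
    Measure.restrict_apply_univ, volume_periodDomain, smul_eq_mul, ← ofReal_norm,
    ← ENNReal.ofReal_pow (norm_nonneg _), ← ENNReal.ofReal_mul (by positivity),
    ENNReal.ofReal_eq_one]

lemma areaMeasure_eq_torusMeasure [CompactSpace X] {q : ℂ → X} {τ : UpperHalfPlane}
    (hq : IsUniformization q τ)
    {α : (x : X) → (TangentSpace 𝓘(ℂ, ℂ) x →L[ℂ] ℂ)} {c : ℂ}
    (hc : ∀ e ∈ atlas ℂ X, ∀ z, q z ∈ e.source →
      coeff α e (e (q z)) * deriv (e ∘ q) z = c) (hu : IsUnitDifferential α) :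
    areaMeasure α = torusMeasure q τ := by
  have h := (isUnitDifferential_iff hq hc).1 hu
  rw [areaMeasure_eq hq hc, torusMeasure, ← ofReal_norm, ← ENNReal.ofReal_pow (norm_nonneg _),
    eq_inv_of_mul_eq_one_left h]

lemma exists_unit_differential [CompactSpace X] (hX : genus X = 1) {q : ℂ → X} {τ : UpperHalfPlane}
    (hq : IsUniformization q τ) :
    ∃ α ∈ HolomorphicDifferentials X, IsUnitDifferential α := by
  have : Nontrivial (HolomorphicDifferentials X) :=
    Module.nontrivial_of_finrank_pos (R := ℂ) (by rw [← genus, hX]; exact one_pos)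
  obtain ⟨⟨α, hα⟩, h0⟩ := exists_ne (0 : HolomorphicDifferentials X)
  obtain ⟨c, hc⟩ := hq.exists_pullback_const hα
  have hc0 := hq.pullback_const_ne_zero hα (fun h => h0 (Subtype.ext h)) hc
  have hT := τ.im_pos
  set r : ℝ := (‖c‖ * Real.sqrt τ.im)⁻¹ with hr
  refine ⟨(r : ℂ) • α, Submodule.smul_mem _ _ hα, ?_⟩
  have hc' : ∀ e ∈ atlas ℂ X, ∀ z, q z ∈ e.source →
      coeff ((r : ℂ) • α) e (e (q z)) * deriv (e ∘ q) z = r * c := by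
    intro e he z hz
    rw [← hc e he z hz, ← mul_assoc]
    rfl
  rw [isUnitDifferential_iff hq hc', norm_mul, Complex.norm_real, mul_pow, Real.norm_eq_abs,
    sq_abs, hr]
  have h1 : ‖c‖ ≠ 0 := norm_ne_zero_iff.2 hc0
  have h2 := Real.sq_sqrt hT.le
  have h3 : Real.sqrt τ.im ≠ 0 := (Real.sqrt_pos.2 hT).ne'
  rw [inv_pow, mul_pow, h2]
  field_simp

end AreaMeasure

/-! ### Joint analyticity of divided differences -/

section DividedDifference

/-- The operator on `ℂ²` with matrix `!![a, δ; 0, b]`. -/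
def upperTriangular (δ : ℂ) (p : ℂ × ℂ) : (ℂ × ℂ) →L[ℂ] (ℂ × ℂ) :=
  p.1 • (ContinuousLinearMap.inl ℂ ℂ ℂ ∘L ContinuousLinearMap.fst ℂ ℂ ℂ) +
    p.2 • (ContinuousLinearMap.inr ℂ ℂ ℂ ∘L ContinuousLinearMap.snd ℂ ℂ ℂ) +
    δ • (ContinuousLinearMap.inl ℂ ℂ ℂ ∘L ContinuousLinearMap.snd ℂ ℂ ℂ)

lemma upperTriangular_apply (δ : ℂ) (p v : ℂ × ℂ) :
    upperTriangular δ p v = (p.1 * v.1 + δ * v.2, p.2 * v.2) := by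
  simp [upperTriangular]

/-- The corner entry of the n-th power is δ times the divided difference of tⁿ at the two
eigenvalues. A power series evaluated at the matrix therefore produces the divided difference of its
sum. -/
lemma upperTriangular_pow_apply (δ : ℂ) (p : ℂ × ℂ) (n : ℕ) :
    (p.1 - p.2) * ((upperTriangular δ p ^ n) (0, 1)).1 = δ * (p.1 ^ n - p.2 ^ n) ∧
      ((upperTriangular δ p ^ n) (0, 1)).2 = p.2 ^ n := by
  induction n with
  | zero => simp
  | succ n ih =>
    obtain ⟨h1, h2⟩ := ih
    rw [pow_succ', mul_apply_eq_comp, upperTriangular_apply, h2]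
    refine ⟨?_, by simp [pow_succ']⟩
    simp only
    linear_combination p.1 * h1

/-- The divided difference of an analytic function is analytic in both variables. -/
lemma exists_divided_difference {s : ℂ → ℂ} {x₀ : ℂ} (hs : AnalyticAt ℂ s x₀) :
    ∃ D : ℂ × ℂ → ℂ, AnalyticAt ℂ D (x₀, x₀) ∧ D (x₀, x₀) = deriv s x₀ ∧
      ∀ᶠ p in 𝓝 (x₀, x₀), s p.1 - s p.2 = (p.1 - p.2) * D p := by
  obtain ⟨P, hP⟩ := hs
  -- The Taylor series of s, now with operators on ℂ² substituted for the variable; it keeps a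
  -- positive radius of convergence.
  set A := FormalMultilinearSeries.ofScalars ((ℂ × ℂ) →L[ℂ] (ℂ × ℂ)) (fun n => P.coeff n) with hA
  have hrad : 0 < A.radius := by
    refine hP.radius_pos.trans_le (FormalMultilinearSeries.radius_le_of_le fun n => ?_)
    rw [hA, FormalMultilinearSeries.ofScalars_norm, FormalMultilinearSeries.norm_apply_eq_norm_coef]
  have hball := A.hasFPowerSeriesOnBall hrad
  have hcont : Continuous fun δ : ℂ => upperTriangular δ (0, 0) := by
    unfold upperTriangular; fun_prop
  have hzero : upperTriangular 0 (0, 0) = 0 := by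
    ext <;> simp [upperTriangular_apply]
  have hnhds : Metric.eball (0 : (ℂ × ℂ) →L[ℂ] (ℂ × ℂ)) A.radius ∈ 𝓝 (upperTriangular 0 (0, 0)) := by
    rw [hzero]; exact Metric.eball_mem_nhds _ hrad
  -- The corner entry δ must be nonzero, since it is divided out later, and small enough that the
  -- matrix with zero diagonal lies in the ball of convergence.
  obtain ⟨δ, hδ, hδ0⟩ := ((hcont.continuousAt.eventually hnhds).filter_mono
    (nhdsWithin_le_nhds (s := {0}ᶜ))).and self_mem_nhdsWithin |>.exists
  have hδ0 : δ ≠ 0 := hδ0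
  set M : ℂ × ℂ → (ℂ × ℂ) →L[ℂ] (ℂ × ℂ) :=
    fun p => upperTriangular δ (p.1 - x₀, p.2 - x₀) with hM
  have hMan : ∀ p, AnalyticAt ℂ M p := by
    intro p
    have : ContDiff ℂ ω M := by
      rw [hM]; unfold upperTriangular; fun_prop
    exact this.contDiffAt.analyticAt
  have hM0 : M (x₀, x₀) = upperTriangular δ (0, 0) := by simp [hM]
  have hMmem : M (x₀, x₀) ∈ Metric.eball (0 : (ℂ × ℂ) →L[ℂ] (ℂ × ℂ)) A.radius := by
    rw [hM0]; exact hδ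
  set ev : ((ℂ × ℂ) →L[ℂ] (ℂ × ℂ)) →L[ℂ] ℂ :=
    ContinuousLinearMap.fst ℂ ℂ ℂ ∘L ContinuousLinearMap.apply ℂ (ℂ × ℂ) ((0, 1) : ℂ × ℂ) with hev
  have hevapp : ∀ B, ev B = (B (0, 1)).1 := fun B => rfl
  set D : ℂ × ℂ → ℂ := fun p => δ⁻¹ * ev (A.sum (M p)) with hD
  have hDan : AnalyticAt ℂ D (x₀, x₀) := by
    have h1 : AnalyticAt ℂ A.sum (M (x₀, x₀)) := hball.analyticAt_of_mem hMmem
    have h2 : AnalyticAt ℂ (fun p => A.sum (M p)) (x₀, x₀) := h1.comp (hMan _)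
    exact analyticAt_const.mul ((ev.analyticAt _).comp h2)
  have hsum := hP.eventually_hasSum_sub
  have heq : ∀ᶠ p in 𝓝 (x₀, x₀), s p.1 - s p.2 = (p.1 - p.2) * D p := by
    have e1 : ∀ᶠ p : ℂ × ℂ in 𝓝 (x₀, x₀), M p ∈ Metric.eball 0 A.radius :=
      (hMan _).continuousAt.eventually (Metric.isOpen_eball.mem_nhds hMmem)
    have e2 := (continuous_fst.tendsto (x₀, x₀)).eventually hsum
    have e3 := (continuous_snd.tendsto (x₀, x₀)).eventually hsum
    filter_upwards [e1, e2, e3] with p h1 h2 h3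
    have h4 := hball.hasSum h1
    rw [zero_add] at h4
    have h5 := ((ev.hasSum h4).mul_left (δ⁻¹)).mul_left (p.1 - p.2)
    refine (h2.sub h3).unique (h5.congr_fun fun n => ?_)
    have h6 := (upperTriangular_pow_apply δ (p.1 - x₀, p.2 - x₀) n).1
    simp only [sub_sub_sub_cancel_right] at h6
    rw [hA, FormalMultilinearSeries.ofScalars_apply_eq, map_smul, hevapp,
      FormalMultilinearSeries.apply_eq_pow_smul_coeff,
      FormalMultilinearSeries.apply_eq_pow_smul_coeff]
    simp only [smul_eq_mul, hM]
    rw [show (p.1 - p.2) * (δ⁻¹ * (P.coeff n *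
      ((upperTriangular δ (p.1 - x₀, p.2 - x₀) ^ n) (0, 1)).1)) = δ⁻¹ * P.coeff n * ((p.1 - p.2) *
      ((upperTriangular δ (p.1 - x₀, p.2 - x₀) ^ n) (0, 1)).1) by ring, h6]
    field_simp
  refine ⟨D, hDan, ?_, heq⟩
  have hcl : Continuous fun x : ℂ => (x, x₀) := by fun_prop
  have h1 : ∀ᶠ x in 𝓝 x₀, s x - s x₀ = (x - x₀) * D (x, x₀) :=
    (hcl.tendsto x₀).eventually heq
  have h2 : Filter.Tendsto (fun x => D (x, x₀)) (𝓝[≠] x₀) (𝓝 (D (x₀, x₀))) :=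
    ((hDan.continuousAt.tendsto).comp (hcl.tendsto x₀)).mono_left nhdsWithin_le_nhds
  have h3 : HasDerivAt s (D (x₀, x₀)) x₀ := by
    rw [hasDerivAt_iff_tendsto_slope]
    refine h2.congr' ?_
    filter_upwards [h1.filter_mono nhdsWithin_le_nhds, self_mem_nhdsWithin] with x hx hx0
    rw [slope_def_field, hx, mul_div_cancel_left₀ _ (sub_ne_zero.2 hx0)]
  exact h3.deriv.symm

end DividedDifference

/-! ### Laplacians and the curvature of the Green function -/

section Harmonic

open InnerProductSpace

/-- A harmonic function of a complex variable is locally the real part of a holomorphic one. -/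
lemma HarmonicAt.comp_analyticAt {f : ℂ → ℝ} {k : ℂ → ℂ} {x : ℂ} (hf : HarmonicAt f (k x))
    (hk : AnalyticAt ℂ k x) : HarmonicAt (f ∘ k) x := by
  obtain ⟨r, hr, hball⟩ := Metric.eventually_nhds_iff_ball.1 hf.eventually
  obtain ⟨F, hF, hFf⟩ := HarmonicOnNhd.exists_analyticOnNhd_ball_re_eq (f := f) (z := k x)
    (R := r) hball
  have h1 : AnalyticAt ℂ (F ∘ k) x := (hF _ (Metric.mem_ball_self hr)).comp hk
  refine (harmonicAt_congr_nhds ?_).1 h1.harmonicAt_re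
  filter_upwards [hk.continuousAt.eventually (Metric.ball_mem_nhds _ hr)] with w hw
  exact hFf hw

/-- Δ(u²) = 2uΔu + 2|∇u|², and the first term vanishes. -/
lemma laplacian_sq_of_harmonicAt {u : ℂ → ℝ} {x : ℂ} (hu : HarmonicAt u x) :
    Laplacian.laplacian (fun z => u z ^ 2) x =
      2 * (fderiv ℝ u x 1 ^ 2 + fderiv ℝ u x Complex.I ^ 2) := by
  have h0 : Laplacian.laplacian u x = 0 := hu.2.eq_of_nhds
  rw [laplacian_eq_iteratedFDeriv_complexPlane] at h0 ⊢
  simp only [iteratedFDeriv_two_apply] at h0 ⊢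
  have hcd : ContDiffAt ℝ 2 u x := hu.1
  have hev : ∀ᶠ y in 𝓝 x, DifferentiableAt ℝ u y :=
    (hcd.eventually (by simp)).mono fun y hy => hy.differentiableAt (by simp)
  have hfd : fderiv ℝ (fun z => u z ^ 2) =ᶠ[𝓝 x] fun y => (2 * u y) • fderiv ℝ u y := by
    filter_upwards [hev] with y hy
    rw [fderiv_fun_pow 2 hy]
    simp
  have hd1 : DifferentiableAt ℝ (fun y => 2 * u y) x := hev.self_of_nhds.const_mul 2
  have hd2 : DifferentiableAt ℝ (fderiv ℝ u) x :=
    (hcd.fderiv_right (m := 1) (by norm_num)).differentiableAt (by simp)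
  have hfd2 : fderiv ℝ (fderiv ℝ fun z => u z ^ 2) x = _ :=
    hfd.fderiv_eq.trans (fderiv_fun_smul hd1 hd2)
  rw [hfd2, fderiv_const_mul hev.self_of_nhds]
  simp at h0 ⊢
  linear_combination (2 * u x) * h0

lemma laplacian_im_sq {k : ℂ → ℂ} {x : ℂ} (hk : AnalyticAt ℂ k x) :
    Laplacian.laplacian (fun z => (k z).im ^ 2) x = 2 * ‖deriv k x‖ ^ 2 := by
  rw [laplacian_sq_of_harmonicAt hk.harmonicAt_im]
  have h : HasFDerivAt (fun z => (k z).im)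
      (Complex.imCLM ∘L (ContinuousLinearMap.toSpanSingleton ℂ (deriv k x)).restrictScalars ℝ) x :=
    Complex.imCLM.hasFDerivAt.comp x
      (hk.differentiableAt.hasDerivAt.hasFDerivAt.restrictScalars ℝ)
  rw [h.fderiv, ← Complex.normSq_eq_norm_sq, Complex.normSq_apply]
  simp
  ring

/-- The logarithm of the square is twice a harmonic function minus (2π/T)(Im k)², and Δ(Im k)² =
2|k'|² by the Cauchy–Riemann equations. -/
lemma laplacian_log_greenFun_sq {τ : UpperHalfPlane} {k : ℂ → ℂ} {x : ℂ} (hk : AnalyticAt ℂ k x)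
    (hx : k x ∉ periodLattice τ) :
    Laplacian.laplacian (fun z => Real.log (greenFun τ (k z) ^ 2)) x =
      -(4 * Real.pi / τ.im) * ‖deriv k x‖ ^ 2 := by
  have h1 := HarmonicAt.comp_analyticAt (exists_log_greenFun_add_harmonic τ hx) hk
  have h2 : ContDiffAt ℝ 2 (fun z => (k z).im ^ 2) x := (hk.harmonicAt_im.1).pow 2
  have heq : (fun z => Real.log (greenFun τ (k z) ^ 2)) =
      (2 : ℝ) • ((fun z : ℂ => Real.log (greenFun τ z) + Real.pi / τ.im * z.im ^ 2) ∘ k) +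
        (-(2 * Real.pi / τ.im)) • (fun z => (k z).im ^ 2) := by
    ext z
    simp only [Real.log_pow, Pi.add_apply, Pi.smul_apply, Function.comp_apply, smul_eq_mul]
    push_cast
    ring
  have h3 : ContDiffAt ℝ 2 ((2 : ℝ) • ((fun z : ℂ =>
      Real.log (greenFun τ z) + Real.pi / τ.im * z.im ^ 2) ∘ k)) x := h1.1.const_smul (2 : ℝ)
  have h4 : ContDiffAt ℝ 2 ((-(2 * Real.pi / τ.im)) • (fun z => (k z).im ^ 2)) x :=
    h2.const_smul (-(2 * Real.pi / τ.im))
  rw [heq, h3.laplacian_add h4,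
    laplacian_smul _ h1.1, laplacian_smul _ h2, laplacian_im_sq hk, h1.2.eq_of_nhds]
  simp only [Pi.zero_apply, smul_eq_mul]
  ring

end Harmonic

/-! ### Smoothness in charts and local sections of the uniformization -/

section LocalSection

variable {X : Type*} [TopologicalSpace X] [ChartedSpace ℂ X]

lemma contMDiffAt_prod_of_eventually_chart_eq {F : X × X → ℝ} {P Q : X} {H : ℂ × ℂ → ℝ}
    (hH : ContDiffAt ℝ ∞ H (chartAt ℂ P P, chartAt ℂ Q Q))
    (heq : ∀ᶠ p in 𝓝 (chartAt ℂ P P, chartAt ℂ Q Q),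
      F ((chartAt ℂ P).symm p.1, (chartAt ℂ Q).symm p.2) = H p) :
    ContMDiffAt (𝓘(ℝ, ℂ).prod 𝓘(ℝ, ℂ)) 𝓘(ℝ, ℝ) ∞ F (P, Q) := by
  rw [contMDiffAt_iff]
  have h1 : ContDiffAt ℝ ∞ (fun p : ℂ × ℂ =>
      F ((chartAt ℂ P).symm p.1, (chartAt ℂ Q).symm p.2)) (chartAt ℂ P P, chartAt ℂ Q Q) :=
    hH.congr_of_eventuallyEq heq
  constructor
  · have h2 : ContinuousAt (fun p : X × X => (chartAt ℂ P p.1, chartAt ℂ Q p.2)) (P, Q) :=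
      (((chartAt ℂ P).continuousAt (mem_chart_source ℂ P)).comp continuousAt_fst).prodMk
        (((chartAt ℂ Q).continuousAt (mem_chart_source ℂ Q)).comp continuousAt_snd)
    have h3 := ContinuousAt.comp (f := fun p : X × X => (chartAt ℂ P p.1, chartAt ℂ Q p.2))
      (x := (P, Q)) h1.continuousAt h2
    refine h3.congr ?_
    filter_upwards [prod_mem_nhds ((chartAt ℂ P).open_source.mem_nhds (mem_chart_source ℂ P))
      ((chartAt ℂ Q).open_source.mem_nhds (mem_chart_source ℂ Q))] with p hp
    simp only [Function.comp_apply, (chartAt ℂ P).left_inv hp.1, (chartAt ℂ Q).left_inv hp.2]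
  · exact h1.contDiffWithinAt

lemma contDiffAt_chart_of_contMDiffAt_prod {F : X × X → ℝ} {P Q : X}
    (h : ContMDiffAt (𝓘(ℝ, ℂ).prod 𝓘(ℝ, ℂ)) 𝓘(ℝ, ℝ) ∞ F (P, Q)) :
    ContDiffAt ℝ ∞ (fun p : ℂ × ℂ => F ((chartAt ℂ P).symm p.1, (chartAt ℂ Q).symm p.2))
      (chartAt ℂ P P, chartAt ℂ Q Q) := by
  have h1 := (contMDiffAt_iff.1 h).2
  have hr : Set.range (𝓘(ℝ, ℂ).prod 𝓘(ℝ, ℂ)) = Set.univ :=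
    ModelWithCorners.Boundaryless.range_eq_univ
  rw [hr] at h1
  exact h1.contDiffAt Filter.univ_mem

variable [IsManifold 𝓘(ℂ, ℂ) 1 X]

/-- In a chart, a uniformization has a holomorphic local inverse. -/
lemma IsUniformization.exists_local_section {q : ℂ → X} {τ : UpperHalfPlane}
    (hq : IsUniformization q τ) (hX : genus X = 1) {e : OpenPartialHomeomorph X ℂ}
    (he : e ∈ atlas ℂ X) {z : ℂ} (hz : q z ∈ e.source) :
    ∃ s : ℂ → ℂ, AnalyticAt ℂ s (e (q z)) ∧ s (e (q z)) = z ∧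
      (∀ᶠ w in 𝓝 (e (q z)), q (s w) = e.symm w) ∧
      deriv (e ∘ q) z * deriv s (e (q z)) = 1 := by
  have han := hq.analyticAt_chart he hz
  have hd := hq.deriv_chart_ne_zero hX he hz
  have hsan : AnalyticAt ℂ (han.hasStrictDerivAt.localInverse _ _ _ hd) (e (q z)) :=
    han.analyticAt_localInverse hd
  have hs0 : han.hasStrictDerivAt.localInverse _ _ _ hd (e (q z)) = z :=
    HasStrictFDerivAt.localInverse_apply_image ..
  have hsr := HasStrictDerivAt.eventually_right_inverse han.hasStrictDerivAt hd
  have hder := (han.hasStrictDerivAt.to_localInverse hd).hasDerivAt.deriv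
  refine ⟨_, hsan, hs0, ?_, ?_⟩
  · have h1 := hsan.continuousAt.eventually (show ∀ᶠ y in 𝓝 _, q y ∈ e.source by
      rw [hs0]; exact (hq.isOpen_preimage_source e).mem_nhds hz)
    filter_upwards [h1, hsr] with w hw1 hw2
    have hw2 : e (q (han.hasStrictDerivAt.localInverse _ _ _ hd w)) = w := hw2
    conv_rhs => rw [← hw2]
    exact (e.left_inv hw1).symm
  · have h2 : deriv (han.hasStrictDerivAt.localInverse _ _ _ hd) (e (q z)) =
      (deriv (e ∘ q) z)⁻¹ := hder
    rw [h2, mul_inv_cancel₀ hd]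

end LocalSection

/-! ### The explicit function satisfies the Arakelov–Green axioms -/

section Existence

variable {X : Type*} [TopologicalSpace X] [ChartedSpace ℂ X]

/-- The Arakelov–Green function in terms of a uniformization. -/
def torusGreen (q : ℂ → X) (τ : UpperHalfPlane) (P Q : X) : ℝ :=
  greenFun τ (Function.invFun q P - Function.invFun q Q)

variable {q : ℂ → X} {τ : UpperHalfPlane}

/-- The representatives picked by `Function.invFun` differ from z and w by periods, which do not
affect the Green function. -/
lemma torusGreen_apply (hq : IsUniformization q τ) (z w : ℂ) :
    torusGreen q τ (q z) (q w) = greenFun τ (z - w) := by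
  have h : ∀ z, Function.invFun q (q z) - z ∈ periodLattice τ := fun z =>
    (hq.eq_iff _ _).1 (Function.invFun_eq ⟨z, rfl⟩)
  rw [torusGreen, ← greenFun_add_of_mem τ ((periodLattice τ).sub_mem (h z) (h w)) (z - w)]
  congr 1
  ring

lemma torusGreen_chart_eventuallyEq (hq : IsUniformization q τ) {e e' : OpenPartialHomeomorph X ℂ}
    {x x' : ℂ} {s s' : ℂ → ℂ} (hs : ∀ᶠ w in 𝓝 x, q (s w) = e.symm w)
    (hs' : ∀ᶠ w in 𝓝 x', q (s' w) = e'.symm w) :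
    ∀ᶠ p in 𝓝 (x, x'), torusGreen q τ (e.symm p.1) (e'.symm p.2) =
      greenFun τ (s p.1 - s' p.2) := by
  filter_upwards [(continuous_fst.tendsto (x, x')).eventually hs,
    (continuous_snd.tendsto (x, x')).eventually hs'] with p h1 h2
  rw [← h1, ← h2, torusGreen_apply hq]

variable [IsManifold 𝓘(ℂ, ℂ) 1 X]

lemma contMDiff_torusGreen_sq (hq : IsUniformization q τ) (hX : genus X = 1) :
    ContMDiff (𝓘(ℝ, ℂ).prod 𝓘(ℝ, ℂ)) 𝓘(ℝ, ℝ) ∞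
      fun p : X × X => torusGreen q τ p.1 p.2 ^ 2 := by
  rintro ⟨P, Q⟩
  obtain ⟨z, rfl⟩ := hq.surjective P
  obtain ⟨w, rfl⟩ := hq.surjective Q
  obtain ⟨s, hs, hsz, hsr, -⟩ :=
    hq.exists_local_section hX (chart_mem_atlas ℂ (q z)) (mem_chart_source ℂ (q z))
  obtain ⟨s', hs', hsz', hsr', -⟩ :=
    hq.exists_local_section hX (chart_mem_atlas ℂ (q w)) (mem_chart_source ℂ (q w))
  have hsd := (hs.contDiffAt (n := ∞)).restrict_scalars ℝ
  have hsd' := (hs'.contDiffAt (n := ∞)).restrict_scalars ℝ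
  refine contMDiffAt_prod_of_eventually_chart_eq
    (H := fun p => greenFun τ (s p.1 - s' p.2) ^ 2) ?_ ?_
  · refine (contDiff_greenFun_sq τ).contDiffAt.comp (𝕜 := ℝ)
      (chartAt ℂ (q z) (q z), chartAt ℂ (q w) (q w)) (f := fun p : ℂ × ℂ => s p.1 - s' p.2) ?_
    exact (ContDiffAt.comp (chartAt ℂ (q z) (q z), chartAt ℂ (q w) (q w)) hsd contDiffAt_fst).sub
      (ContDiffAt.comp (chartAt ℂ (q z) (q z), chartAt ℂ (q w) (q w)) hsd' contDiffAt_snd)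
  · filter_upwards [torusGreen_chart_eventuallyEq hq hsr hsr'] with p hp
    rw [hp]

/-- With a local section s, the Green function is |s(x) - s(y)| U(s(x) - s(y)), and s(x) - s(y) is x
- y times the divided difference D. Joint smoothness and D ≠ 0 on the diagonal make u = |D| U
admissible. -/
lemma torusGreen_multiplicity_one (hq : IsUniformization q τ) (hX : genus X = 1) (R : X) :
    ∃ u : X × X → ℝ,
      ContMDiffAt (𝓘(ℝ, ℂ).prod 𝓘(ℝ, ℂ)) 𝓘(ℝ, ℝ) ∞ u (R, R) ∧ 0 < u (R, R) ∧
      ∀ᶠ p in 𝓝 (R, R), torusGreen q τ p.1 p.2 =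
        ‖chartAt ℂ R p.1 - chartAt ℂ R p.2‖ * u p := by
  obtain ⟨z, rfl⟩ := hq.surjective R
  have hmem := mem_chart_source ℂ (q z)
  obtain ⟨s, hs, hsz, hsr, hsd⟩ :=
    hq.exists_local_section hX (chart_mem_atlas ℂ (q z)) hmem
  set e := chartAt ℂ (q z) with he
  set x := e (q z) with hx
  obtain ⟨D, hD, hD0, hDs⟩ := exists_divided_difference hs
  obtain ⟨U, hU, hU0, hg⟩ := exists_greenFun_eq_norm_mul τ
  have hD0' : D (x, x) ≠ 0 := by
    rw [hD0]; exact right_ne_zero_of_mul (hsd.trans_ne one_ne_zero)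
  have hU0' : 0 < U 0 := by
    rw [hU0]
    have := eta_norm_pos τ
    positivity
  set H : ℂ × ℂ → ℝ := fun p => ‖D p‖ * U (s p.1 - s p.2) with hH
  have hHd : ContDiffAt ℝ ∞ H (x, x) := by
    refine (((hD.contDiffAt (n := ∞)).restrict_scalars ℝ).norm ℝ hD0').mul ?_
    have h1 : ContDiffAt ℝ ∞ U (s x - s x) := by rwa [sub_self]
    have hsd := (hs.contDiffAt (n := ∞)).restrict_scalars ℝ
    exact ContDiffAt.comp (x, x) (f := fun p : ℂ × ℂ => s p.1 - s p.2) h1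
      ((ContDiffAt.comp (x, x) hsd contDiffAt_fst).sub (ContDiffAt.comp (x, x) hsd contDiffAt_snd))
  have hsrc : ∀ᶠ p in 𝓝 (q z, q z), p.1 ∈ e.source ∧ p.2 ∈ e.source :=
    prod_mem_nhds (e.open_source.mem_nhds hmem) (e.open_source.mem_nhds hmem)
  have hcont : ContinuousAt (fun p : X × X => (e p.1, e p.2)) (q z, q z) :=
    (e.continuousAt hmem).fst'.prodMk (e.continuousAt hmem).snd'
  refine ⟨fun p => H (e p.1, e p.2), ?_, ?_, ?_⟩
  · refine contMDiffAt_prod_of_eventually_chart_eq (H := H) hHd ?_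
    filter_upwards [prod_mem_nhds (e.open_target.mem_nhds (e.map_source hmem))
      (e.open_target.mem_nhds (e.map_source hmem))] with p hp
    rw [e.right_inv hp.1, e.right_inv hp.2]
  · simp only [hH, ← hx, sub_self]
    exact mul_pos (norm_pos_iff.2 hD0') hU0'
  · filter_upwards [hsrc, hcont.eventually (torusGreen_chart_eventuallyEq hq hsr hsr),
      hcont.eventually hDs] with p h1 h2 h3
    simp only [e.left_inv h1.1, e.left_inv h1.2] at h2
    simp only [hH]
    rw [h2, hg, h3, norm_mul, mul_assoc]

/-- Both sides equal -(π/T)|s'|² for a local section s: the coefficient of α is c s', and |c|² = 1/T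
by the normalization of α. -/
lemma torusGreen_ddbar_log (hq : IsUniformization q τ) (hX : genus X = 1)
    {α : (x : X) → (TangentSpace 𝓘(ℂ, ℂ) x →L[ℂ] ℂ)} {c : ℂ}
    (hc : ∀ e ∈ atlas ℂ X, ∀ z, q z ∈ e.source →
      coeff α e (e (q z)) * deriv (e ∘ q) z = c) (hcT : ‖c‖ ^ 2 * τ.im = 1)
    (P : X) (e : OpenPartialHomeomorph X ℂ) (he : e ∈ atlas ℂ X) (Q : X) (hQ : Q ∈ e.source)
    (hQP : Q ≠ P) :
    (1 / 4 : ℂ) *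
        ((Laplacian.laplacian (fun z : ℂ => Real.log (torusGreen q τ P (e.symm z) ^ 2))
          (e Q) : ℝ) : ℂ) =
      2 * Real.pi * Complex.I * (Complex.I / 2 * ((‖coeff α e (e Q)‖ ^ 2 : ℝ) : ℂ)) := by
  obtain ⟨p, rfl⟩ := hq.surjective P
  obtain ⟨z, rfl⟩ := hq.surjective Q
  obtain ⟨s, hs, hsz, hsr, hsd⟩ := hq.exists_local_section hX he hQ
  have hk : AnalyticAt ℂ (fun w => p - s w) (e (q z)) := analyticAt_const.sub hs
  have hx : p - s (e (q z)) ∉ periodLattice τ := by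
    rw [hsz, ← hq.eq_iff]
    exact hQP.symm
  have heq : (fun z : ℂ => Real.log (torusGreen q τ (q p) (e.symm z) ^ 2)) =ᶠ[𝓝 (e (q z))]
      fun w => Real.log (greenFun τ (p - s w) ^ 2) := by
    filter_upwards [hsr] with w hw
    rw [← hw, torusGreen_apply hq]
  have hcoeff : coeff α e (e (q z)) = c * deriv s (e (q z)) := by
    rw [← hc e he z hQ, mul_assoc, hsd, mul_one]
  rw [InnerProductSpace.laplacian_congr_nhds heq |>.eq_of_nhds, laplacian_log_greenFun_sq hk hx,
    deriv_const_sub, norm_neg, hcoeff, norm_mul, mul_pow, eq_inv_of_mul_eq_one_left hcT]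
  have hI : Complex.I * Complex.I = -1 := Complex.I_mul_I
  push_cast
  linear_combination (-(Real.pi : ℂ) * (τ.im : ℂ)⁻¹ * (‖deriv s (e (q z))‖ : ℂ) ^ 2) * hI

lemma continuous_torusGreen (hq : IsUniformization q τ) (hX : genus X = 1) :
    Continuous fun p : X × X => torusGreen q τ p.1 p.2 := by
  have h := (contMDiff_torusGreen_sq hq hX).continuous.sqrt
  refine h.congr fun p => Real.sqrt_sq (greenFun_nonneg τ _)

theorem isArakelovGreen_torusGreen [CompactSpace X] [MeasurableSpace X] [BorelSpace X]
    (hq : IsUniformization q τ) (hX : genus X = 1)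
    {α : (x : X) → (TangentSpace 𝓘(ℂ, ℂ) x →L[ℂ] ℂ)} (hα : α ∈ HolomorphicDifferentials X)
    (hu : IsUnitDifferential α) : IsArakelovGreen α (torusGreen q τ) := by
  obtain ⟨c, hc⟩ := hq.exists_pullback_const hα
  have hcT := (isUnitDifferential_iff hq hc).1 hu
  have harea := areaMeasure_eq_torusMeasure hq hc hu
  have hmeas : ∀ P, Measurable fun Q => Real.log (torusGreen q τ P Q) := fun P =>
    Real.measurable_log.comp ((continuous_torusGreen hq hX).comp
      (continuous_const.prodMk continuous_id)).measurable
  refine ⟨fun P Q => greenFun_nonneg τ _, contMDiff_torusGreen_sq hq hX, ?_,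
    torusGreen_multiplicity_one hq hX, torusGreen_ddbar_log hq hX hc hcT, ?_, ?_⟩
  · intro P Q
    obtain ⟨z, rfl⟩ := hq.surjective P
    obtain ⟨w, rfl⟩ := hq.surjective Q
    rw [torusGreen_apply hq, greenFun_eq_zero_iff, hq.eq_iff]
  · intro P
    obtain ⟨p, rfl⟩ := hq.surjective P
    rw [harea, integrable_torusMeasure_iff hq (hmeas _)]
    simp only [torusGreen_apply hq]
    exact (integrableOn_log_greenFun_sub τ p).1
  · intro P
    obtain ⟨p, rfl⟩ := hq.surjective P
    rw [harea, integral_torusMeasure hq (hmeas _)]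
    simp only [torusGreen_apply hq]
    rw [(integrableOn_log_greenFun_sub τ p).2, mul_zero]

end Existence

/-! ### Removable singularities and Liouville's theorem for harmonic functions -/

section Liouville

open InnerProductSpace

lemma harmonicAt_of_eventually_punctured {k : ℂ → ℝ} {z : ℂ} (hk : ContDiffAt ℝ 2 k z)
    (h : ∀ᶠ w in 𝓝[≠] z, Laplacian.laplacian k w = 0) : HarmonicAt k z := by
  refine ⟨hk, ?_⟩
  have hcont : ContinuousAt (Laplacian.laplacian k) z := by
    have h1 : ContinuousAt (iteratedFDeriv ℝ 2 k) z :=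
      (hk.iteratedFDeriv_right (m := 0) (i := 2) (by norm_num)).continuousAt
    have h2 : ∀ v : Fin 2 → ℂ, ContinuousAt (fun x => iteratedFDeriv ℝ 2 k x v) z := fun v =>
      (ContinuousMultilinearMap.apply ℝ (fun _ : Fin 2 => ℂ) ℝ v).continuous.continuousAt.comp h1
    rw [laplacian_eq_iteratedFDeriv_complexPlane]
    exact (h2 _).add (h2 _)
  have hz : Laplacian.laplacian k z = 0 :=
    tendsto_nhds_unique (hcont.tendsto.mono_left nhdsWithin_le_nhds)
      (tendsto_const_nhds.congr' (h.mono fun w hw => hw.symm))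
  rw [← nhdsNE_sup_pure]
  exact Filter.eventually_sup.2 ⟨h, by simpa using hz⟩

/-- A doubly periodic function that is harmonic up to removable singularities is constant. -/
lemma exists_eventually_eq_const_of_harmonic {τ : UpperHalfPlane} {h : ℂ → ℝ}
    (hper : ∀ l ∈ periodLattice τ, ∀ z, h (z + l) = h z)
    (hh : ∀ z, ∃ k : ℂ → ℝ, HarmonicAt k z ∧ h =ᶠ[𝓝[≠] z] k) :
    ∃ c : ℝ, ∀ z, ∀ᶠ w in 𝓝[≠] z, h w = c := by
  choose k hk hhk using hh
  have hlim : ∀ z w, (∀ᶠ y in 𝓝[≠] w, h y = k z y) → ContinuousAt (k z) w → k w w = k z w := by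
    intro z w h1 h2
    have h3 : Filter.Tendsto h (𝓝[≠] w) (𝓝 (k w w)) :=
      ((hk w).1.continuousAt.tendsto.mono_left nhdsWithin_le_nhds).congr'
        (hhk w).symm
    have h4 : Filter.Tendsto h (𝓝[≠] w) (𝓝 (k z w)) :=
      (h2.tendsto.mono_left nhdsWithin_le_nhds).congr' (h1.mono fun y hy => hy.symm)
    exact tendsto_nhds_unique h3 h4
  -- The values of h at singular points are arbitrary, so h is replaced by w ↦ k w w. Near z this
  -- agrees with the single harmonic function k z, because both are punctured limits of h.
  have hH : ∀ z, (fun w => k w w) =ᶠ[𝓝 z] k z := by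
    intro z
    rw [Filter.EventuallyEq, ← nhdsNE_sup_pure]
    refine Filter.eventually_sup.2 ⟨?_, by simp⟩
    have h1 : ∀ᶠ w in 𝓝[≠] z, ∀ᶠ y in 𝓝[≠] w, h y = k z y := by
      have := eventually_eventually_nhdsWithin.2 (hhk z)
      filter_upwards [this, self_mem_nhdsWithin] with w hw hwz
      refine Filter.Eventually.filter_mono ?_ hw
      refine nhdsWithin_le_iff.2 ?_
      exact mem_nhdsWithin_of_mem_nhds (isOpen_compl_singleton.mem_nhds hwz)
    have h2 : ∀ᶠ w in 𝓝[≠] z, ContinuousAt (k z) w :=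
      ((hk z).eventually.filter_mono nhdsWithin_le_nhds).mono fun w hw => hw.1.continuousAt
    filter_upwards [h1, h2] with w hw1 hw2 using hlim z w hw1 hw2
  have hharm : HarmonicOnNhd (fun w => k w w) Set.univ := fun z _ =>
    (harmonicAt_congr_nhds (hH z)).2 (hk z)
  have hcont : Continuous fun w => k w w := continuous_iff_continuousAt.2 fun z =>
    (hharm z (Set.mem_univ z)).1.continuousAt
  have hHper : ∀ l ∈ periodLattice τ, ∀ z, k (z + l) (z + l) = k z z := by
    intro l hl z
    have h1 : Filter.Tendsto (fun w => w + l) (𝓝[≠] z) (𝓝[≠] (z + l)) := by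
      refine tendsto_nhdsWithin_iff.2 ⟨?_, ?_⟩
      · exact ((continuous_add_const l).tendsto z).mono_left nhdsWithin_le_nhds
      · filter_upwards [self_mem_nhdsWithin] with w hw
        exact fun h => hw (add_right_cancel h)
    have h3 : Filter.Tendsto h (𝓝[≠] (z + l)) (𝓝 (k (z + l) (z + l))) :=
      ((hk _).1.continuousAt.tendsto.mono_left nhdsWithin_le_nhds).congr' (hhk _).symm
    have h4 : Filter.Tendsto h (𝓝[≠] z) (𝓝 (k z z)) :=
      ((hk z).1.continuousAt.tendsto.mono_left nhdsWithin_le_nhds).congr' (hhk z).symm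
    refine tendsto_nhds_unique ((h3.comp h1).congr fun w => ?_) h4
    exact hper l hl w
  have hb : Bornology.IsBounded (Set.range fun w => k w w) := by
    have hK : IsCompact (periodMap τ '' (Set.Icc (0 : ℝ) 1 ×ℂ Set.Icc (0 : ℝ) 1)) :=
      (isCompact_Icc.reProdIm isCompact_Icc).image (periodMap τ).continuous
    refine (hK.image hcont).isBounded.subset ?_
    rintro _ ⟨z, rfl⟩
    obtain ⟨l, hl, -⟩ := existsUnique_add_mem_periodDomain τ z
    refine ⟨l + z, ?_, by rw [add_comm]; exact hHper l l.2 z⟩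
    exact Set.image_mono (Set.preimage_mono Set.Ico_subset_Icc_self |> fun h1 =>
      Set.inter_subset_inter h1 (Set.preimage_mono Set.Ico_subset_Icc_self)) hl
  refine ⟨k 0 0, fun z => ?_⟩
  have hc := bounded_harmonic_on_complex_plane_is_constant _ hharm hb
  filter_upwards [hhk z, (hH z).filter_mono nhdsWithin_le_nhds] with w h1 h2
  rw [h1, ← h2]
  exact hc w 0

end Liouville

/-! ### Uniqueness of the Arakelov–Green function -/

section Uniqueness

open InnerProductSpace

variable {X : Type*} [TopologicalSpace X] [ChartedSpace ℂ X] [MeasurableSpace X]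
  {α : (x : X) → (TangentSpace 𝓘(ℂ, ℂ) x →L[ℂ] ℂ)} {G : X → X → ℝ}

namespace IsArakelovGreen

lemma contDiffAt_sq (hG : IsArakelovGreen α G) (P Q : X) :
    ContDiffAt ℝ ∞ (fun w => G P ((chartAt ℂ Q).symm w) ^ 2) (chartAt ℂ Q Q) := by
  have h := contDiffAt_chart_of_contMDiffAt_prod (hG.smooth_sq (P, Q))
  have h2 : ContDiffAt ℝ ∞ (fun w : ℂ => (chartAt ℂ P P, w)) (chartAt ℂ Q Q) :=
    contDiffAt_const.prodMk contDiffAt_id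
  have h3 := ContDiffAt.comp (chartAt ℂ Q Q) (f := fun w : ℂ => (chartAt ℂ P P, w)) h h2
  simpa [Function.comp_def, (chartAt ℂ P).left_inv (mem_chart_source ℂ P)] using h3

lemma pos (hG : IsArakelovGreen α G) {P Q : X} (h : P ≠ Q) : 0 < G P Q :=
  (hG.nonneg P Q).lt_of_ne' fun h0 => h ((hG.eq_zero_iff P Q).1 h0)

lemma continuous (hG : IsArakelovGreen α G) : Continuous fun p : X × X => G p.1 p.2 :=
  hG.smooth_sq.continuous.sqrt.congr fun _ => Real.sqrt_sq (hG.nonneg _ _)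

lemma continuous_right (hG : IsArakelovGreen α G) (P : X) : Continuous (G P) :=
  hG.continuous.comp (continuous_const.prodMk continuous_id)

lemma measurable_log [BorelSpace X] (hG : IsArakelovGreen α G) (P : X) :
    Measurable fun Q => Real.log (G P Q) :=
  Real.measurable_log.comp (hG.continuous_right P).measurable

lemma contDiffAt_log (hG : IsArakelovGreen α G) {P Q : X} (h : P ≠ Q) :
    ContDiffAt ℝ ∞ (fun w => Real.log (G P ((chartAt ℂ Q).symm w) ^ 2)) (chartAt ℂ Q Q) := by
  refine (hG.contDiffAt_sq P Q).log ?_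
  rw [(chartAt ℂ Q).left_inv (mem_chart_source ℂ Q)]
  exact (pow_pos (hG.pos h) 2).ne'

variable [T2Space X] [IsManifold 𝓘(ℂ, ℂ) 1 X] {β : (x : X) → (TangentSpace 𝓘(ℂ, ℂ) x →L[ℂ] ℂ)}
  {G' : X → X → ℝ}

/-- Off the diagonal both logarithms solve the same Poisson equation, since only the modulus of the
coefficient of the differential enters. -/
lemma harmonicAt_log_sub (hG : IsArakelovGreen α G) (hG' : IsArakelovGreen β G')
    (hαβ : ∀ e ∈ atlas ℂ X, ∀ Q ∈ e.source, ‖coeff α e (e Q)‖ = ‖coeff β e (e Q)‖)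
    {q : ℂ → X} {τ : UpperHalfPlane} (hq : IsUniformization q τ) {P : X} {z : ℂ} (h : P ≠ q z) :
    HarmonicAt (fun w => Real.log (G P (q w)) - Real.log (G' P (q w))) z := by
  have he := chart_mem_atlas ℂ (q z)
  have hz := mem_chart_source ℂ (q z)
  set e := chartAt ℂ (q z) with hedef
  set A : ℂ → ℝ := fun w => Real.log (G P (e.symm w) ^ 2) with hA
  set B : ℂ → ℝ := fun w => Real.log (G' P (e.symm w) ^ 2) with hB
  have hAc : ContDiffAt ℝ 2 A (e (q z)) := (hG.contDiffAt_log h).of_le (by norm_cast)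
  have hBc : ContDiffAt ℝ 2 B (e (q z)) := (hG'.contDiffAt_log h).of_le (by norm_cast)
  have hharm : HarmonicAt (A - B) (e (q z)) := by
    refine ⟨hAc.sub hBc, ?_⟩
    have hne : ∀ᶠ w in 𝓝 (e (q z)), e.symm w ≠ P := by
      refine (e.continuousAt_symm (e.map_source hz)).eventually_ne ?_
      rw [e.left_inv hz]; exact h.symm
    filter_upwards [hAc.laplacian_sub_nhds hBc, hne, e.open_target.mem_nhds (e.map_source hz)]
      with w h1 h2 h3
    have h4 := hG.ddbar_log P e he (e.symm w) (e.map_target h3) h2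
    have h5 := hG'.ddbar_log P e he (e.symm w) (e.map_target h3) h2
    rw [hαβ e he _ (e.map_target h3), ← h5, e.right_inv h3] at h4
    have h6 := mul_left_cancel₀ (by norm_num : (1 / 4 : ℂ) ≠ 0) h4
    rw [h1]
    exact sub_eq_zero.2 (Complex.ofReal_injective h6)
  have h1 := (HarmonicAt.comp_analyticAt (k := e ∘ q) hharm (hq.analyticAt_chart he hz)).const_smul
    (c := (1 / 2 : ℝ))
  refine (harmonicAt_congr_nhds ?_).1 h1
  filter_upwards [(hq.isOpen_preimage_source e).mem_nhds hz] with w hw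
  have hw' : e.symm (e (q w)) = q w := e.left_inv hw
  simp only [Pi.smul_apply, Function.comp_apply, Pi.sub_apply, hA, hB, hw', Real.log_pow,
    smul_eq_mul]
  push_cast
  ring

/-- On the diagonal both logarithms are the logarithm of the coordinate distance plus a smooth
function. Their difference extends smoothly, and its Laplacian vanishes at the point by continuity.
-/
lemma exists_harmonicAt_log_sub (hG : IsArakelovGreen α G) (hG' : IsArakelovGreen β G')
    (hαβ : ∀ e ∈ atlas ℂ X, ∀ Q ∈ e.source, ‖coeff α e (e Q)‖ = ‖coeff β e (e Q)‖)
    {q : ℂ → X} {τ : UpperHalfPlane} (hq : IsUniformization q τ) (P : X) (z : ℂ) :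
    ∃ k : ℂ → ℝ, HarmonicAt k z ∧
      (fun w => Real.log (G P (q w)) - Real.log (G' P (q w))) =ᶠ[𝓝[≠] z] k := by
  by_cases h : P ≠ q z
  · exact ⟨_, hG.harmonicAt_log_sub hG' hαβ hq h, Filter.EventuallyEq.rfl⟩
  push Not at h
  subst h
  have he := chart_mem_atlas ℂ (q z)
  have hz := mem_chart_source ℂ (q z)
  obtain ⟨u, hu, hu0, hGu⟩ := hG.multiplicity_one (q z)
  obtain ⟨v, hv, hv0, hGv⟩ := hG'.multiplicity_one (q z)
  set e := chartAt ℂ (q z) with hedef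
  have hne : ∀ᶠ w in 𝓝[≠] z, q z ≠ q w := by
    filter_upwards [eventually_sub_notMem_periodLattice τ z] with w hw hzw
    exact hw ((hq.eq_iff _ _).1 hzw.symm)
  have hsm : ∀ u : X × X → ℝ, ContMDiffAt (𝓘(ℝ, ℂ).prod 𝓘(ℝ, ℂ)) 𝓘(ℝ, ℝ) ∞ u (q z, q z) →
      0 < u (q z, q z) → ContDiffAt ℝ ∞ (fun w => Real.log (u (q z, e.symm (e (q w))))) z := by
    intro u hu hu0
    have h1 := contDiffAt_chart_of_contMDiffAt_prod hu
    have hqr : ContDiffAt ℝ ∞ (e ∘ q) z :=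
      ((hq.analyticAt_chart he hz).contDiffAt (n := ∞)).restrict_scalars ℝ
    have h2 : ContDiffAt ℝ ∞ (fun w : ℂ => (e (q z), (e ∘ q) w)) z :=
      contDiffAt_const.prodMk hqr
    have h3 := ContDiffAt.comp z (f := fun w : ℂ => (e (q z), (e ∘ q) w)) h1 h2
    have h4 : ContDiffAt ℝ ∞ (fun w => u (q z, e.symm (e (q w)))) z := by
      simpa [Function.comp_def, e.left_inv hz, ← hedef] using h3
    refine h4.log ?_
    rw [e.left_inv hz]
    exact hu0.ne'
  set k : ℂ → ℝ := fun w => Real.log (u (q z, e.symm (e (q w)))) -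
    Real.log (v (q z, e.symm (e (q w)))) with hk
  have hkc : ContDiffAt ℝ ∞ k z := (hsm u hu hu0).sub (hsm v hv hv0)
  have hcont : Filter.Tendsto (fun w => (q z, q w)) (𝓝 z) (𝓝 (q z, q z)) :=
    (continuous_const.prodMk hq.continuous).tendsto z
  have hev : (fun w => Real.log (G (q z) (q w)) - Real.log (G' (q z) (q w))) =ᶠ[𝓝[≠] z] k := by
    filter_upwards [hne, (hcont.eventually hGu).filter_mono nhdsWithin_le_nhds,
      (hcont.eventually hGv).filter_mono nhdsWithin_le_nhds,
      nhdsWithin_le_nhds ((hq.isOpen_preimage_source e).mem_nhds hz)] with w h1 h2 h3 h4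
    have hn : ‖e (q z) - e (q w)‖ ≠ 0 :=
      norm_ne_zero_iff.2 (sub_ne_zero.2 fun h => h1 (e.injOn hz h4 h))
    have h2' := (hG.pos h1).ne'
    have h3' := (hG'.pos h1).ne'
    simp only [hk, e.left_inv h4]
    rw [h2] at h2' ⊢
    rw [h3] at h3' ⊢
    rw [Real.log_mul hn (right_ne_zero_of_mul h2'), Real.log_mul hn (right_ne_zero_of_mul h3')]
    ring
  refine ⟨k, harmonicAt_of_eventually_punctured (hkc.of_le (by norm_cast)) ?_, hev⟩
  have hev2 := eventually_eventually_nhdsWithin.2 hev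
  filter_upwards [hev2, hne, self_mem_nhdsWithin] with w h1 h2 h3
  have h4 : (fun w => Real.log (G (q z) (q w)) - Real.log (G' (q z) (q w))) =ᶠ[𝓝 w] k := by
    refine h1.filter_mono ?_
    rw [(isOpen_compl_singleton (x := z)).nhdsWithin_eq h3]
  rw [← laplacian_congr_nhds h4 |>.eq_of_nhds]
  exact (hG.harmonicAt_log_sub hG' hαβ hq h2).2.eq_of_nhds

lemma eq_of_norm_coeff_eq [CompactSpace X] [BorelSpace X] (hX : genus X = 1)
    (hG : IsArakelovGreen α G) (hG' : IsArakelovGreen β G')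
    (hα : α ∈ HolomorphicDifferentials X) (hβ : β ∈ HolomorphicDifferentials X)
    (hαu : IsUnitDifferential α) (hβu : IsUnitDifferential β)
    {q : ℂ → X} {τ : UpperHalfPlane} (hq : IsUniformization q τ) : G = G' := by
  obtain ⟨c, hc⟩ := hq.exists_pullback_const hα
  obtain ⟨d, hd⟩ := hq.exists_pullback_const hβ
  have hcT := (isUnitDifferential_iff hq hc).1 hαu
  have hdT := (isUnitDifferential_iff hq hd).1 hβu
  -- The normalized differential is unique only up to a phase. The two Green functions may come with
  -- different choices, but the area forms agree.
  have hcd : ‖c‖ = ‖d‖ := by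
    rw [← sq_eq_sq₀ (norm_nonneg _) (norm_nonneg _)]
    exact mul_right_cancel₀ τ.im_pos.ne' (hcT.trans hdT.symm)
  have hαβ : ∀ e ∈ atlas ℂ X, ∀ Q ∈ e.source, ‖coeff α e (e Q)‖ = ‖coeff β e (e Q)‖ := by
    intro e he Q hQ
    obtain ⟨z, rfl⟩ := hq.surjective Q
    rw [← hc e he z hQ, ← hd e he z hQ, norm_mul, norm_mul] at hcd
    exact mul_right_cancel₀ (norm_ne_zero_iff.2 (hq.deriv_chart_ne_zero hX he hQ)) hcd
  funext P Q
  by_cases hPQ : P = Q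
  · rw [(hG.eq_zero_iff P Q).2 hPQ, (hG'.eq_zero_iff P Q).2 hPQ]
  set h : ℂ → ℝ := fun w => Real.log (G P (q w)) - Real.log (G' P (q w)) with hh
  obtain ⟨a, ha⟩ := exists_eventually_eq_const_of_harmonic (τ := τ) (h := h)
    (fun l hl z => by simp only [hh, hq.apply_add hl])
    (hG.exists_harmonicAt_log_sub hG' hαβ hq P)
  have hoff : ∀ z, P ≠ q z → h z = a := by
    intro z hz
    have hcont : ContinuousAt h z := (hG.harmonicAt_log_sub hG' hαβ hq hz).1.continuousAt
    exact tendsto_nhds_unique (hcont.tendsto.mono_left nhdsWithin_le_nhds)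
      (tendsto_const_nhds.congr' ((ha z).mono fun w hw => hw.symm))
  have hae : ∀ᵐ z ∂(volume.restrict (periodDomain τ)), h z = a := by
    refine ae_restrict_of_ae ?_
    obtain ⟨p, rfl⟩ := hq.surjective P
    have hcount : {z : ℂ | ¬ h z = a}.Countable := by
      refine ((Set.countable_coe_iff.1 (countable_periodLattice τ)).image (fun l => p - l)).mono ?_
      intro z hz
      have : q p = q z := by
        by_contra h0
        exact hz (hoff z h0)
      exact ⟨p - z, (hq.eq_iff _ _).1 this, by ring⟩
    exact hcount.measure_zero volume
  have hint : ∫ z in periodDomain τ, h z = 0 := by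
    have e1 := hG.integral_log P
    have e2 := hG'.integral_log P
    have i1 := hG.integrable_log P
    have i2 := hG'.integrable_log P
    rw [areaMeasure_eq_torusMeasure hq hc hαu] at e1 i1
    rw [areaMeasure_eq_torusMeasure hq hd hβu] at e2 i2
    rw [integral_torusMeasure hq (hG.measurable_log P)] at e1
    rw [integral_torusMeasure hq (hG'.measurable_log P)] at e2
    rw [integrable_torusMeasure_iff hq (hG.measurable_log P)] at i1
    rw [integrable_torusMeasure_iff hq (hG'.measurable_log P)] at i2
    have hT := inv_ne_zero τ.im_pos.ne'
    rw [hh, integral_sub i1 i2, (mul_eq_zero.1 e1).resolve_left hT,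
      (mul_eq_zero.1 e2).resolve_left hT, sub_zero]
  rw [integral_congr_ae hae, integral_const, smul_eq_mul, mul_eq_zero] at hint
  have ha0 : a = 0 := by
    refine hint.resolve_left ?_
    rw [measureReal_def, Measure.restrict_apply_univ, volume_periodDomain,
      ENNReal.toReal_ofReal τ.im_pos.le]
    exact τ.im_pos.ne'
  obtain ⟨z, rfl⟩ := hq.surjective Q
  have h1 := hoff z hPQ
  rw [ha0] at h1
  exact Real.log_injOn_pos (hG.pos hPQ) (hG'.pos hPQ) (sub_eq_zero.1 h1)

end IsArakelovGreen

/-- The Arakelov–Green function of `X`, computed in any uniformization. -/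
theorem arakelovGreen_apply [T2Space X] [IsManifold 𝓘(ℂ, ℂ) 1 X] [CompactSpace X] [BorelSpace X]
    (hX : genus X = 1) {q : ℂ → X} {τ : UpperHalfPlane} (hq : IsUniformization q τ) (z w : ℂ) :
    arakelovGreen X (q z) (q w) = greenFun τ (z - w) := by
  obtain ⟨α, hα, hu⟩ := exists_unit_differential hX hq
  have hex : ∃! G : X → X → ℝ, ∃ α ∈ HolomorphicDifferentials X,
      IsUnitDifferential α ∧ IsArakelovGreen α G := by
    refine ⟨torusGreen q τ, ⟨α, hα, hu, isArakelovGreen_torusGreen hq hX hα hu⟩, ?_⟩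
    rintro G' ⟨β, hβ, hβu, hG'⟩
    exact hG'.eq_of_norm_coeff_eq hX (isArakelovGreen_torusGreen hq hX hα hu) hβ hα hβu hu hq
  have h : arakelovGreen X = torusGreen q τ := by
    rw [arakelovGreen, dif_pos hex]
    exact hex.unique hex.exists.choose_spec ⟨α, hα, hu, isArakelovGreen_torusGreen hq hX hα hu⟩
  rw [h, torusGreen_apply hq]

end Uniqueness

/-! ### The logarithm of a local group law -/

section LocalGroup

/-- A one-dimensional analytic local group law with unit `x₀` has a logarithm. -/
lemma exists_local_log {m : ℂ × ℂ → ℂ} {x₀ : ℂ} (hm : AnalyticAt ℂ m (x₀, x₀))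
    (hleft : ∀ᶠ y in 𝓝 x₀, m (x₀, y) = y) (hright : ∀ᶠ x in 𝓝 x₀, m (x, x₀) = x)
    (hassoc : ∀ᶠ p in 𝓝 (x₀, x₀), ∀ᶠ y in 𝓝 x₀, m (p.1, m (p.2, y)) = m (m p, y)) :
    ∃ L : ℂ → ℂ, AnalyticAt ℂ L x₀ ∧ L x₀ = 0 ∧ deriv L x₀ ≠ 0 ∧
      ∀ᶠ p in 𝓝 (x₀, x₀), L (m p) = L p.1 + L p.2 := by
  have hm0 : m (x₀, x₀) = x₀ := hleft.self_of_nhds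
  -- The coefficient of the left-invariant vector field with value 1 at the unit. Then dx/g is the
  -- invariant differential, and its primitive L is the logarithm.
  set g : ℂ → ℂ := fun x => fderiv ℂ m (x, x₀) (0, 1) with hg
  have hpart : ∀ a x : ℂ, DifferentiableAt ℂ m (a, x) →
      HasDerivAt (fun y => m (a, y)) (fderiv ℂ m (a, x) (0, 1)) x := by
    intro a x h
    have h1 : HasDerivAt (fun y : ℂ => (a, y)) ((0 : ℂ), (1 : ℂ)) x :=
      (hasDerivAt_const x a).prodMk (hasDerivAt_id x)
    exact h.hasFDerivAt.comp_hasDerivAt x h1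
  have hdiff : ∀ᶠ p in 𝓝 (x₀, x₀), DifferentiableAt ℂ m p :=
    hm.eventually_analyticAt.mono fun p hp => hp.differentiableAt
  have hgan : AnalyticAt ℂ g x₀ := by
    have h1 : AnalyticAt ℂ (fun x : ℂ => (x, x₀)) x₀ := analyticAt_id.prod analyticAt_const
    have h2 : AnalyticAt ℂ (fun x => fderiv ℂ m (x, x₀)) x₀ := hm.fderiv.comp_of_eq h1 rfl
    exact ((ContinuousLinearMap.apply ℂ ℂ ((0 : ℂ), (1 : ℂ))).analyticAt _).comp h2
  have hg0 : g x₀ = 1 := by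
    have h1 := (hpart x₀ x₀ hdiff.self_of_nhds).deriv
    have h2 : (fun y => m (x₀, y)) =ᶠ[𝓝 x₀] id := hleft
    rw [h2.deriv_eq, deriv_id] at h1
    exact h1.symm
  have hgne : ∀ᶠ x in 𝓝 x₀, g x ≠ 0 := hgan.continuousAt.eventually_ne (by rw [hg0]; exact one_ne_zero)
  obtain ⟨r, hr, hball⟩ := Metric.eventually_nhds_iff_ball.1
    (hgne.and hgan.eventually_analyticAt)
  have hinv : DifferentiableOn ℂ (fun x => (g x)⁻¹) (Metric.ball x₀ r) := fun x hx =>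
    ((hball x hx).2.differentiableAt.inv (hball x hx).1).differentiableWithinAt
  obtain ⟨L, hL0, hL⟩ := hinv.isExactOn_ball.with_val_at x₀ 0
  have hLd : ∀ x ∈ Metric.ball x₀ r, HasDerivAt L ((g x)⁻¹) x := fun x hx => hL x hx
  refine ⟨L, ?_, hL0, ?_, ?_⟩
  · have : DifferentiableOn ℂ L (Metric.ball x₀ r) := fun x hx =>
      (hLd x hx).differentiableAt.differentiableWithinAt
    exact this.analyticAt (Metric.ball_mem_nhds _ hr)
  · rw [(hLd x₀ (Metric.mem_ball_self hr)).deriv, hg0]; simp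
  have hmcont : Filter.Tendsto m (𝓝 (x₀, x₀)) (𝓝 x₀) := by
    have := hm.continuousAt.tendsto
    rwa [hm0] at this
  have hx0 : Continuous fun x : ℂ => (x, x₀) := by fun_prop
  have hdiff0 : ∀ᶠ x in 𝓝 x₀, DifferentiableAt ℂ m (x, x₀) := (hx0.tendsto x₀).eventually hdiff
  have hfst := continuous_fst.tendsto (x₀, x₀)
  have hsnd := continuous_snd.tendsto (x₀, x₀)
  have hall := hdiff.and (hassoc.and ((hmcont.eventually (Metric.ball_mem_nhds x₀ hr)).and
    ((hmcont.eventually hdiff0).and ((hsnd.eventually hdiff0).and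
    ((hsnd.eventually (Metric.ball_mem_nhds x₀ hr)).and
    ((hfst.eventually hright).and (hsnd.eventually hright)))))))
  obtain ⟨δ, hδ, hprod⟩ := Metric.eventually_nhds_iff_ball.1 hall
  have hmem : ∀ a ∈ Metric.ball x₀ δ, ∀ x ∈ Metric.ball x₀ δ, (a, x) ∈ Metric.ball (x₀, x₀) δ := by
    intro a ha x hx
    rw [← ball_prod_same]
    exact ⟨ha, hx⟩
  -- Differentiating m(a, m(x, y)) = m(m(a, x), y) in y at y = x₀ gives ∂₂m(a, x) g(x) = g(m(a, x)),
  -- the invariance of dx/g under left translation.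
  have hderiv : ∀ a ∈ Metric.ball x₀ δ, ∀ x ∈ Metric.ball x₀ δ,
      HasDerivAt (fun x => L (m (a, x)) - L x) 0 x := by
    intro a ha x hx
    obtain ⟨h1, h2, h3, h4, h5, h6, -, h8⟩ := hprod _ (hmem a ha x hx)
    simp only at h1 h2 h3 h4 h5 h6 h8
    have e1 : HasDerivAt (fun y => m (m (a, x), y)) (g (m (a, x))) x₀ := hpart _ _ h4
    have e2 : HasDerivAt (fun y => m (x, y)) (g x) x₀ := hpart _ _ h5
    have e3 : HasDerivAt (fun y => m (a, y)) (fderiv ℂ m (a, x) (0, 1)) (m (x, x₀)) := by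
      rw [h8]; exact hpart _ _ h1
    have e4 : HasDerivAt (fun y => m (a, m (x, y))) (fderiv ℂ m (a, x) (0, 1) * g x) x₀ :=
      HasDerivAt.comp x₀ (h₂ := fun y => m (a, y)) (h := fun y => m (x, y)) e3 e2
    have e5 : fderiv ℂ m (a, x) (0, 1) * g x = g (m (a, x)) :=
      e4.unique (e1.congr_of_eventuallyEq h2)
    have hgx := (hball x h6).1
    have hgm := (hball _ h3).1
    have e6 : HasDerivAt (fun x => L (m (a, x)))
        ((g (m (a, x)))⁻¹ * fderiv ℂ m (a, x) (0, 1)) x :=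
      (hLd _ h3).comp x (hpart _ _ h1)
    refine (e6.sub (hLd x h6)).congr_deriv ?_
    rw [← e5] at hgm ⊢
    have := left_ne_zero_of_mul hgm
    field_simp
    simp
  filter_upwards [Metric.ball_mem_nhds (x₀, x₀) hδ] with p hp
  have hp' := hp
  rw [← ball_prod_same] at hp'
  -- The difference does not depend on x, so it equals its value at the unit, where m(a, x₀) = a.
  have hconst : L (m (p.1, p.2)) - L p.2 = L (m (p.1, x₀)) - L x₀ :=
    (convex_ball x₀ δ).is_const_of_fderivWithin_eq_zero (𝕜 := ℂ)
      (f := fun x => L (m (p.1, x)) - L x)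
      (fun x hx => (hderiv _ hp'.1 x hx).differentiableAt.differentiableWithinAt) (fun x hx => by
        rw [fderivWithin_of_isOpen Metric.isOpen_ball hx]
        ext
        simpa using (hderiv _ hp'.1 x hx).deriv) hp'.2 (Metric.mem_ball_self hδ)
  have h7 := (hprod p hp).2.2.2.2.2.2.1
  rw [h7, hL0, sub_zero] at hconst
  linear_combination hconst

end LocalGroup

/-! ### The exponential map near the origin -/

section LocalExp

variable {X : Type*} [TopologicalSpace X] [ChartedSpace ℂ X] [AddCommGroup X]
  [LieAddGroup 𝓘(ℂ, ℂ) ω X]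

lemma isTopologicalAddGroup_of_lie : IsTopologicalAddGroup X :=
  topologicalAddGroup_of_lieAddGroup 𝓘(ℂ, ℂ) ω

lemma analyticAt_add_chart : AnalyticAt ℂ (fun p : ℂ × ℂ =>
    chartAt ℂ (0 : X) ((chartAt ℂ (0 : X)).symm p.1 + (chartAt ℂ (0 : X)).symm p.2))
    (chartAt ℂ (0 : X) 0, chartAt ℂ (0 : X) 0) := by
  have h := contMDiffAt_iff.1 ((contMDiff_add 𝓘(ℂ, ℂ) ω : ContMDiff _ _ _
    fun p : X × X => p.1 + p.2) ((0 : X), (0 : X)))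
  have h1 := h.2
  have hr : Set.range (𝓘(ℂ, ℂ).prod 𝓘(ℂ, ℂ)) = Set.univ :=
    ModelWithCorners.Boundaryless.range_eq_univ
  rw [hr] at h1
  have h2 := h1.contDiffAt Filter.univ_mem
  have h3 : chartAt ℂ ((0 : X) + 0) = chartAt ℂ (0 : X) := by rw [add_zero]
  have h4 : ContDiffAt ℂ ω (fun p : ℂ × ℂ =>
      chartAt ℂ ((0 : X) + 0) ((chartAt ℂ (0 : X)).symm p.1 + (chartAt ℂ (0 : X)).symm p.2))
      (chartAt ℂ (0 : X) 0, chartAt ℂ (0 : X) 0) := h2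
  rw [h3] at h4
  exact h4.analyticAt

/-- The exponential map near the origin. -/
lemma exists_local_exp : ∃ E : ℂ → X, ∃ ρ : ℝ, 0 < ρ ∧
    (∀ v ∈ Metric.ball (0 : ℂ) ρ, MDifferentiableAt 𝓘(ℂ, ℂ) 𝓘(ℂ, ℂ) E v) ∧
    Set.InjOn E (Metric.ball 0 ρ) ∧
    (∀ v ∈ Metric.ball (0 : ℂ) ρ, ∀ w ∈ Metric.ball (0 : ℂ) ρ, E (v + w) = E v + E w) ∧
    E '' Metric.ball 0 ρ ∈ 𝓝 (0 : X) := by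
  have : IsTopologicalAddGroup X := isTopologicalAddGroup_of_lie
  have : IsManifold 𝓘(ℂ, ℂ) 1 X := IsManifold.of_le (n := ω) le_top
  set φ := chartAt ℂ (0 : X) with hφ
  have h0 : (0 : X) ∈ φ.source := mem_chart_source ℂ (0 : X)
  set x₀ := φ 0 with hx₀
  have hx₀t : x₀ ∈ φ.target := φ.map_source h0
  have hsymm0 : φ.symm x₀ = 0 := φ.left_inv h0
  have htar : ∀ᶠ x in 𝓝 x₀, x ∈ φ.target := φ.open_target.mem_nhds hx₀t
  set m : ℂ × ℂ → ℂ := fun p => φ (φ.symm p.1 + φ.symm p.2) with hm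
  have hman : AnalyticAt ℂ m (x₀, x₀) := analyticAt_add_chart
  have hadd : ContinuousAt (fun p : ℂ × ℂ => φ.symm p.1 + φ.symm p.2) (x₀, x₀) :=
    (φ.continuousAt_symm hx₀t).fst'.add (φ.continuousAt_symm hx₀t).snd'
  have hsrc : ∀ᶠ p : ℂ × ℂ in 𝓝 (x₀, x₀), φ.symm p.1 + φ.symm p.2 ∈ φ.source := by
    refine hadd.eventually (φ.open_source.mem_nhds ?_)
    simp only [hsymm0, add_zero]
    exact h0
  have hassoc : ∀ᶠ p in 𝓝 (x₀, x₀), ∀ᶠ y in 𝓝 x₀, m (p.1, m (p.2, y)) = m (m p, y) := by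
    filter_upwards [hsrc, (continuous_snd.tendsto (x₀, x₀)).eventually htar] with p h1 h2
    have h3 : ContinuousAt (fun y => φ.symm p.2 + φ.symm y) x₀ :=
      continuousAt_const.add (φ.continuousAt_symm hx₀t)
    have h4 : ∀ᶠ y in 𝓝 x₀, φ.symm p.2 + φ.symm y ∈ φ.source := by
      refine h3.eventually (φ.open_source.mem_nhds ?_)
      simp only [hsymm0, add_zero]
      exact φ.map_target h2
    filter_upwards [h4] with y hy
    simp only [hm, φ.left_inv hy, φ.left_inv h1, add_assoc]
  obtain ⟨L, hLan, hL0, hLd, hLadd⟩ := exists_local_log hman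
    (htar.mono fun y hy => by simp only [hm, hsymm0, zero_add, φ.right_inv hy])
    (htar.mono fun y hy => by simp only [hm, hsymm0, add_zero, φ.right_inv hy]) hassoc
  -- The exponential is the local inverse of the logarithm followed by the inverse chart.
  set s := hLan.hasStrictDerivAt.localInverse _ _ _ hLd with hs
  have hsan : AnalyticAt ℂ s 0 := by
    have := hLan.analyticAt_localInverse hLd
    rwa [hL0] at this
  have hs0 : s 0 = x₀ := by
    have : s (L x₀) = x₀ := HasStrictFDerivAt.localInverse_apply_image ..
    rwa [hL0] at this
  have hleft : ∀ᶠ x in 𝓝 x₀, s (L x) = x :=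
    HasStrictDerivAt.eventually_left_inverse hLan.hasStrictDerivAt hLd
  have hright : ∀ᶠ w in 𝓝 (0 : ℂ), L (s w) = w := by
    have : ∀ᶠ w in 𝓝 (L x₀), L (s w) = w :=
      HasStrictDerivAt.eventually_right_inverse hLan.hasStrictDerivAt hLd
    rwa [hL0] at this
  have hst : Filter.Tendsto s (𝓝 0) (𝓝 x₀) := by
    have := hsan.continuousAt.tendsto
    rwa [hs0] at this
  have hst2 : Filter.Tendsto (fun p : ℂ × ℂ => (s p.1, s p.2)) (𝓝 ((0 : ℂ), (0 : ℂ)))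
      (𝓝 (x₀, x₀)) := by
    rw [nhds_prod_eq, nhds_prod_eq]
    exact hst.prodMap hst
  have hmt : Filter.Tendsto m (𝓝 (x₀, x₀)) (𝓝 x₀) := by
    have := hman.continuousAt.tendsto
    have hm0 : m (x₀, x₀) = x₀ := by simp only [hm, hsymm0, add_zero]; rfl
    rwa [hm0] at this
  have hE : ∀ᶠ p : ℂ × ℂ in 𝓝 ((0 : ℂ), (0 : ℂ)),
      φ.symm (s (p.1 + p.2)) = φ.symm (s p.1) + φ.symm (s p.2) := by
    filter_upwards [hst2.eventually hLadd, hst2.eventually hsrc, (hmt.comp hst2).eventually hleft,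
      (continuous_fst.tendsto ((0 : ℂ), (0 : ℂ))).eventually hright,
      (continuous_snd.tendsto ((0 : ℂ), (0 : ℂ))).eventually hright] with p h1 h2 h3 h4 h5
    simp only [Function.comp_apply] at h1 h2 h3 h4 h5
    rw [h1, h4, h5] at h3
    rw [h3]
    exact φ.left_inv h2
  have hEd : ∀ᶠ w in 𝓝 (0 : ℂ), MDifferentiableAt 𝓘(ℂ, ℂ) 𝓘(ℂ, ℂ) (fun w => φ.symm (s w)) w := by
    filter_upwards [hsan.eventually_analyticAt, hst.eventually htar] with w h1 h2
    exact (mdifferentiableAt_atlas_symm (chart_mem_atlas ℂ (0 : X)) h2).comp w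
      h1.differentiableAt.mdifferentiableAt
  obtain ⟨ρ₁, hρ₁, hb₁⟩ := Metric.eventually_nhds_iff_ball.1 hE
  obtain ⟨ρ₂, hρ₂, hb₂⟩ := Metric.eventually_nhds_iff_ball.1
    (hEd.and (hright.and (hst.eventually htar)))
  refine ⟨fun w => φ.symm (s w), min ρ₁ ρ₂, lt_min hρ₁ hρ₂, ?_, ?_, ?_, ?_⟩
  · exact fun v hv => (hb₂ v (Metric.ball_subset_ball (min_le_right _ _) hv)).1
  · intro v hv w hw hvw
    obtain ⟨-, h1, h2⟩ := hb₂ v (Metric.ball_subset_ball (min_le_right _ _) hv)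
    obtain ⟨-, h3, h4⟩ := hb₂ w (Metric.ball_subset_ball (min_le_right _ _) hw)
    rw [← h1, ← h3, φ.symm.injOn h2 h4 hvw]
  · intro v hv w hw
    refine hb₁ (v, w) ?_
    rw [← ball_prod_same]
    exact ⟨Metric.ball_subset_ball (min_le_left _ _) hv,
      Metric.ball_subset_ball (min_le_left _ _) hw⟩
  · have hφt : Filter.Tendsto φ (𝓝 0) (𝓝 x₀) := φ.continuousAt h0
    have hLt : Filter.Tendsto L (𝓝 x₀) (𝓝 0) := by
      have := hLan.continuousAt.tendsto
      rwa [hL0] at this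
    filter_upwards [hφt.eventually hleft, φ.open_source.mem_nhds h0,
      (hLt.comp hφt).eventually (Metric.ball_mem_nhds 0 (lt_min hρ₁ hρ₂))] with x h1 h2 h3
    exact ⟨L (φ x), h3, by simp only [h1, φ.left_inv h2]⟩

end LocalExp

/-! ### Extension of the exponential to ℂ -/

section GlobalExp

/-- A local homomorphism defined near the origin of `ℂ` extends to a homomorphism. -/
lemma exists_addMonoidHom_extending {A : Type*} [AddCommGroup A] {E : ℂ → A} {ρ : ℝ} (hρ : 0 < ρ)
    (hadd : ∀ v ∈ Metric.ball (0 : ℂ) ρ, ∀ w ∈ Metric.ball (0 : ℂ) ρ, E (v + w) = E v + E w) :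
    ∃ p : ℂ →+ A, ∀ v ∈ Metric.ball (0 : ℂ) ρ, p v = E v := by
  -- A homomorphism extending E has to be 2ⁿ • E(z/2ⁿ) as soon as z/2ⁿ lies in the ball; additivity
  -- makes this independent of such n.
  set P : ℕ → ℂ → A := fun n z => 2 ^ n • E (z / 2 ^ n) with hP
  have hmem : ∀ (n : ℕ) (z : ℂ), ‖z‖ < 2 ^ n * ρ → z / 2 ^ n ∈ Metric.ball (0 : ℂ) ρ := by
    intro n z hz
    rw [mem_ball_zero_iff, norm_div, norm_pow, Complex.norm_ofNat, div_lt_iff₀ (by positivity)]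
    linarith
  have hmono : ∀ (n m : ℕ), n ≤ m → ∀ z : ℂ, ‖z‖ < 2 ^ n * ρ → ‖z‖ < 2 ^ m * ρ := by
    intro n m h z hz
    refine hz.trans_le ?_
    gcongr
    norm_num
  have hle : ∀ (n m : ℕ), n ≤ m → ∀ z : ℂ, ‖z‖ < 2 ^ n * ρ → P m z = P n z := by
    intro n m h
    induction m, h using Nat.le_induction with
    | base => intro z _; rfl
    | succ m hm ih =>
      intro z hz
      rw [← ih z hz]
      have h1 := hmem (m + 1) z (hmono n (m + 1) (by omega) z hz)
      have h2 : z / 2 ^ m = z / 2 ^ (m + 1) + z / 2 ^ (m + 1) := by field_simp; ring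
      simp only [hP]
      rw [h2, hadd _ h1 _ h1, pow_succ, mul_smul, two_smul]
  have hex : ∀ r : ℝ, ∃ n : ℕ, r < 2 ^ n * ρ := by
    intro r
    obtain ⟨n, hn⟩ := pow_unbounded_of_one_lt (r / ρ) (one_lt_two)
    exact ⟨n, (div_lt_iff₀ hρ).1 hn⟩
  choose N hN using fun z : ℂ => hex ‖z‖
  have hp : ∀ (n : ℕ) (z : ℂ), ‖z‖ < 2 ^ n * ρ → P (N z) z = P n z := by
    intro n z hz
    rcases le_total n (N z) with h | h
    · exact hle _ _ h z hz
    · exact (hle _ _ h z (hN z)).symm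
  refine ⟨AddMonoidHom.mk' (fun z => P (N z) z) ?_, ?_⟩
  · intro z w
    obtain ⟨n, hn⟩ := hex (‖z‖ + ‖w‖)
    have h1 : ‖z‖ < 2 ^ n * ρ := by linarith [norm_nonneg w]
    have h2 : ‖w‖ < 2 ^ n * ρ := by linarith [norm_nonneg z]
    rw [hp n z h1, hp n w h2, hp n (z + w) ((norm_add_le z w).trans_lt hn)]
    simp only [hP]
    rw [add_div, hadd _ (hmem n z h1) _ (hmem n w h2), smul_add]
  · intro v hv
    have h1 := hp 0 v (by simpa using hv)
    simpa [hP] using h1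

variable {X : Type*} [TopologicalSpace X] [ChartedSpace ℂ X] [AddCommGroup X]
  [LieAddGroup 𝓘(ℂ, ℂ) ω X]

/-- Near w the map is z ↦ p(w) + p(z - w), so differentiability at 0 is carried to w by a
translation of the group. -/
lemma mdifferentiable_of_additive {p : ℂ →+ X} {U : Set ℂ} (hU : U ∈ 𝓝 (0 : ℂ))
    (h : ∀ v ∈ U, MDifferentiableAt 𝓘(ℂ, ℂ) 𝓘(ℂ, ℂ) p v) : MDifferentiable 𝓘(ℂ, ℂ) 𝓘(ℂ, ℂ) p := by
  intro w
  have h0 : MDifferentiableAt 𝓘(ℂ, ℂ) 𝓘(ℂ, ℂ) p ((fun z : ℂ => z - w) w) := by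
    simp only [sub_self]; exact h 0 (mem_of_mem_nhds hU)
  have h1 : MDifferentiableAt 𝓘(ℂ, ℂ) 𝓘(ℂ, ℂ) (fun z : ℂ => z - w) w :=
    (differentiableAt_id.sub_const w).mdifferentiableAt
  have h2 : MDifferentiable 𝓘(ℂ, ℂ) 𝓘(ℂ, ℂ) (fun x : X => p w + x) :=
    (contMDiff_add_left (I := 𝓘(ℂ, ℂ)) (n := ω)).mdifferentiable (by simp)
  have h3 := (h2 _).comp w (MDifferentiableAt.comp (f := fun z : ℂ => z - w) w h0 h1)
  refine h3.congr_of_eventuallyEq (Filter.Eventually.of_forall fun z => ?_)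
  simp

lemma exists_exponential [ConnectedSpace X] : ∃ p : ℂ →+ X, MDifferentiable 𝓘(ℂ, ℂ) 𝓘(ℂ, ℂ) p ∧
    Function.Surjective p ∧ ∃ ρ : ℝ, 0 < ρ ∧ Set.InjOn p (Metric.ball 0 ρ) ∧
      p '' Metric.ball 0 ρ ∈ 𝓝 (0 : X) := by
  have : IsTopologicalAddGroup X := isTopologicalAddGroup_of_lie
  obtain ⟨E, ρ, hρ, h1, h2, h3, h4⟩ := exists_local_exp (X := X)
  obtain ⟨p, hp⟩ := exists_addMonoidHom_extending hρ h3
  have himg : p '' Metric.ball 0 ρ = E '' Metric.ball 0 ρ := Set.image_congr hp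
  refine ⟨p, ?_, ?_, ρ, hρ, h2.congr fun v hv => (hp v hv).symm, himg ▸ h4⟩
  · refine mdifferentiable_of_additive (Metric.ball_mem_nhds 0 hρ) fun v hv => ?_
    refine (h1 v hv).congr_of_eventuallyEq ?_
    filter_upwards [Metric.isOpen_ball.mem_nhds hv] with w hw using hp w hw
  -- The image is a subgroup containing a neighbourhood of 0, hence open and closed, hence all of
  -- the connected group.
  · have ho : IsOpen (p.range : Set X) := AddSubgroup.isOpen_of_mem_nhds _
      (Filter.mem_of_superset (himg ▸ h4) (Set.image_subset_range _ _))
    have := IsClopen.eq_univ ⟨AddSubgroup.isClosed_of_isOpen _ ho, ho⟩ ⟨0, p.range.zero_mem⟩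
    exact Set.range_eq_univ.1 this

end GlobalExp

/-! ### The kernel of the exponential is a lattice -/

section KernelLattice

/-- Otherwise a nonzero real functional kills Λ; as every point is within R of Λ, that functional
would be bounded. -/
lemma span_eq_top_of_cobounded {Λ : AddSubgroup ℂ} {R : ℝ} (h : ∀ z : ℂ, ∃ l ∈ Λ, ‖z - l‖ ≤ R) :
    Submodule.span ℝ (Λ : Set ℂ) = ⊤ := by
  by_contra hne
  obtain ⟨φ, hφ, hle⟩ := Submodule.exists_le_ker_of_lt_top _ (lt_top_iff_ne_top.2 hne)
  set ψ := φ.toContinuousLinearMap with hψ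
  obtain ⟨v, hv⟩ : ∃ v, φ v ≠ 0 := by
    by_contra! hc
    exact hφ (LinearMap.ext hc)
  have hb : ∀ z, |φ z| ≤ ‖ψ‖ * R := by
    intro z
    obtain ⟨l, hl, hlz⟩ := h z
    have h0 : φ l = 0 := hle (Submodule.subset_span hl)
    have h1 : φ z = ψ (z - l) := by simp [hψ, h0]
    rw [h1, ← Real.norm_eq_abs]
    exact (ψ.le_opNorm _).trans (by gcongr)
  obtain ⟨n, hn⟩ := exists_nat_gt (‖ψ‖ * R / |φ v|)
  rw [div_lt_iff₀ (abs_pos.2 hv)] at hn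
  have := hb ((n : ℝ) • v)
  rw [map_smul, smul_eq_mul, abs_mul, Nat.abs_cast] at this
  linarith

lemma exists_periods {Λ : AddSubgroup ℂ} {R ρ : ℝ} (hρ : 0 < ρ)
    (hd : ∀ l ∈ Λ, ‖l‖ < ρ → l = 0) (h : ∀ z : ℂ, ∃ l ∈ Λ, ‖z - l‖ ≤ R) :
    ∃ (w : ℂ) (τ : UpperHalfPlane), w ≠ 0 ∧ ∀ z, w * z ∈ Λ ↔ z ∈ periodLattice τ := by
  set L : Submodule ℤ ℂ := AddSubgroup.toIntSubmodule Λ with hL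
  have hdisc : DiscreteTopology L := by
    have : DiscreteTopology Λ := by
      refine discreteTopology_of_isOpen_singleton_zero ?_
      have : ({0} : Set Λ) = Subtype.val ⁻¹' Metric.ball (0 : ℂ) ρ := by
        ext l
        simp only [Set.mem_singleton_iff, Set.mem_preimage, mem_ball_zero_iff]
        refine ⟨fun hl => by simpa [hl] using hρ, fun hl => Subtype.ext (hd l l.2 hl)⟩
      rw [this]
      exact Metric.isOpen_ball.preimage continuous_subtype_val
    exact this
  have hlat : IsZLattice ℝ L := ⟨span_eq_top_of_cobounded h⟩
  have hfin : Module.Finite ℤ L := ZLattice.module_finite ℝ L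
  have hfree : Module.Free ℤ L := ZLattice.module_free ℝ L
  have hrank : Module.finrank ℤ L = 2 := by
    rw [ZLattice.rank ℝ L, Complex.finrank_real_complex]
  let b : Module.Basis (Fin 2) ℤ L := Module.finBasisOfFinrankEq ℤ L hrank
  let B : Module.Basis (Fin 2) ℝ ℂ := b.ofZLatticeBasis ℝ L
  have hB : ∀ i, B i = b i := fun i => Module.Basis.ofZLatticeBasis_apply ..
  have hind := B.linearIndependent
  have hw0 : B 0 ≠ 0 := B.ne_zero 0
  have him : (B 1 / B 0).im ≠ 0 := by
    intro h0
    have h1 : B 1 = ((B 1 / B 0).re : ℂ) * B 0 := by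
      have : ((B 1 / B 0).re : ℂ) = B 1 / B 0 := Complex.ext (by simp) (by simp [h0])
      rw [this]; field_simp
    have h2 := (LinearIndependent.pair_iff.1 (by
      have : B = ![B 0, B 1] := by ext i; fin_cases i <;> rfl
      rwa [this] at hind)) ((B 1 / B 0).re) (-1) (by rw [Complex.real_smul, ← h1]; simp)
    simpa using h2.2
  have hmem : ∀ z, z ∈ Λ ↔ ∃ m n : ℤ, z = m * B 0 + n * B 1 := by
    intro z
    constructor
    · intro hz
      have h1 := b.sum_repr ⟨z, hz⟩
      rw [Fin.sum_univ_two] at h1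
      refine ⟨b.repr ⟨z, hz⟩ 0, b.repr ⟨z, hz⟩ 1, ?_⟩
      have h2 := congrArg (fun x : L => (x : ℂ)) h1
      simp only [Submodule.coe_add, Submodule.coe_smul, zsmul_eq_mul] at h2
      rw [hB, hB]; exact h2.symm
    · rintro ⟨m, n, rfl⟩
      rw [hB, hB, ← zsmul_eq_mul, ← zsmul_eq_mul]
      exact Λ.add_mem (Λ.zsmul_mem (b 0).2 m) (Λ.zsmul_mem (b 1).2 n)
  -- After scaling by the first basis vector, the second generator lies in the upper half plane up
  -- to sign.
  rcases him.lt_or_gt with hneg | hpos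
  · refine ⟨B 0, ⟨-(B 1 / B 0), by simpa using hneg⟩, hw0, fun z => ?_⟩
    rw [hmem, mem_periodLattice]
    constructor
    · rintro ⟨m, n, h⟩
      refine ⟨m, -n, mul_left_cancel₀ hw0 ?_⟩
      rw [h]; push_cast; field_simp
    · rintro ⟨m, n, rfl⟩
      refine ⟨m, -n, ?_⟩
      push_cast; field_simp
  · refine ⟨B 0, ⟨B 1 / B 0, hpos⟩, hw0, fun z => ?_⟩
    rw [hmem, mem_periodLattice]
    constructor
    · rintro ⟨m, n, h⟩
      refine ⟨m, n, mul_left_cancel₀ hw0 ?_⟩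
      rw [h]; field_simp
    · rintro ⟨m, n, rfl⟩
      refine ⟨m, n, ?_⟩
      field_simp

variable {X : Type*} [TopologicalSpace X] [ChartedSpace ℂ X] [AddCommGroup X]
  [LieAddGroup 𝓘(ℂ, ℂ) ω X]

/-- A compact connected complex Lie group of dimension one is a complex torus. -/
lemma exists_additive_uniformization [CompactSpace X] [ConnectedSpace X] :
    ∃ (p : ℂ →+ X) (τ : UpperHalfPlane), IsUniformization p τ := by
  have : IsTopologicalAddGroup X := isTopologicalAddGroup_of_lie
  obtain ⟨p, hp, hsurj, ρ, hρ, hinj, himg⟩ := exists_exponential (X := X)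
  have hd : ∀ l ∈ p.ker, ‖l‖ < ρ → l = 0 := fun l hl hlρ =>
    hinj (by simpa using hlρ) (Metric.mem_ball_self hρ) (by rw [map_zero]; exact hl)
  -- Finitely many translates of p(ball) cover X by compactness, so R can be the sum of the norms of
  -- lifts of their centres plus the radius ρ.
  obtain ⟨R, hR⟩ : ∃ R : ℝ, ∀ z : ℂ, ∃ l ∈ p.ker, ‖z - l‖ ≤ R := by
    obtain ⟨t, -, ht⟩ := isCompact_univ.elim_nhds_subcover
      (fun x : X => (fun y => y - x) ⁻¹' (p '' Metric.ball 0 ρ)) (fun x _ => by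
        have hc : Filter.Tendsto (fun y : X => y - x) (𝓝 x) (𝓝 0) := by
          have : Continuous fun y : X => y - x := by fun_prop
          simpa using this.tendsto x
        exact hc himg)
    choose s hs using hsurj
    refine ⟨∑ x ∈ t, ‖s x‖ + ρ, fun z => ?_⟩
    obtain ⟨x, hx, b, hb, hbz⟩ := Set.mem_iUnion₂.1 (ht (Set.mem_univ (p z)))
    refine ⟨z - s x - b, ?_, ?_⟩
    · rw [AddMonoidHom.mem_ker, map_sub, map_sub, hs, hbz, sub_self]
    · have e : z - (z - s x - b) = s x + b := by ring
      rw [e]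
      refine (norm_add_le _ _).trans (add_le_add ?_ (mem_ball_zero_iff.1 hb).le)
      exact Finset.single_le_sum (f := fun x => ‖s x‖) (fun _ _ => norm_nonneg _) hx
  obtain ⟨w, τ, hw, hker⟩ := exists_periods hρ hd hR
  refine ⟨p.comp (AddMonoidHom.mulLeft w), τ, ?_, ?_, ?_⟩
  · exact hp.comp (differentiable_id.const_mul w).mdifferentiable
  · refine hsurj.comp fun z => ⟨w⁻¹ * z, ?_⟩
    simp [hw]
  · intro z y
    rw [← hker, AddMonoidHom.mem_ker, mul_sub, map_sub, sub_eq_zero]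
    rfl

end KernelLattice

/-! ### Independence of the eta norm from τ -/

section EtaInvariance

variable {X : Type*} [TopologicalSpace X] [ChartedSpace ℂ X] [IsManifold 𝓘(ℂ, ℂ) 1 X]

/-- Holomorphic maps from `ℂ` lift locally along a uniformization. -/
lemma IsUniformization.exists_local_lift {q : ℂ → X} {τ : UpperHalfPlane}
    (hq : IsUniformization q τ) (hX : genus X = 1) {g : ℂ → X}
    (hg : MDifferentiable 𝓘(ℂ, ℂ) 𝓘(ℂ, ℂ) g) {z₀ y₀ : ℂ} (h : q y₀ = g z₀) :
    ∃ k : ℂ → ℂ, AnalyticAt ℂ k z₀ ∧ k z₀ = y₀ ∧ ∀ᶠ z in 𝓝 z₀, q (k z) = g z := by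
  set e := chartAt ℂ (g z₀) with he
  have hea : e ∈ atlas ℂ X := chart_mem_atlas ℂ _
  have hsrc : g z₀ ∈ e.source := mem_chart_source ℂ _
  have hopen : IsOpen (g ⁻¹' e.source) := e.open_source.preimage hg.continuous
  have hgan : AnalyticAt ℂ (e ∘ g) z₀ := by
    have h1 : DifferentiableOn ℂ (e ∘ g) (g ⁻¹' e.source) := fun w hw =>
      (mdifferentiableAt_iff_differentiableAt.1
        ((mdifferentiableAt_atlas hea hw).comp w (hg w))).differentiableWithinAt
    exact h1.analyticAt (hopen.mem_nhds hsrc)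
  obtain ⟨s, hs, hs0, hqs, -⟩ := hq.exists_local_section hX hea (z := y₀) (by rw [h]; exact hsrc)
  rw [h] at hs hs0 hqs
  refine ⟨fun z => s (e (g z)), AnalyticAt.comp (g := s) (f := e ∘ g) hs hgan, hs0, ?_⟩
  filter_upwards [hgan.continuousAt.eventually hqs, hopen.mem_nhds hsrc] with z h1 h2
  rw [show q (s (e (g z))) = _ from h1]
  exact e.left_inv h2

variable [T2Space X] [CompactSpace X]

/-- The quantity `√(Im τ) |η(τ)|²` does not depend on the uniformization. -/
lemma IsUniformization.sqrt_im_mul_norm_eta_sq_eq (hX : genus X = 1) {p q : ℂ → X}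
    {τ₀ τ : UpperHalfPlane} (hp : IsUniformization p τ₀) (hq : IsUniformization q τ) :
    √τ₀.im * ‖ModularForm.eta τ₀‖ ^ 2 = √τ.im * ‖ModularForm.eta τ‖ ^ 2 := by
  borelize X
  obtain ⟨y₀, hy₀⟩ := hq.surjective (p 0)
  obtain ⟨k, hk, hk0, hqk⟩ := hq.exists_local_lift hX hp.holomorphic hy₀
  obtain ⟨α, hα, hu⟩ := exists_unit_differential hX hq
  obtain ⟨c, hc⟩ := hq.exists_pullback_const hα
  obtain ⟨d, hd⟩ := hp.exists_pullback_const hα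
  have hcT := (isUnitDifferential_iff hq hc).1 hu
  have hdT := (isUnitDifferential_iff hp hd).1 hu
  set a := deriv k 0 with ha
  -- Near 0 the map p is q ∘ k, so the two pullbacks of one differential differ by the factor k'(0)
  -- = a.
  have hdc : d = c * a := by
    set e := chartAt ℂ (p 0)
    have hea : e ∈ atlas ℂ X := chart_mem_atlas ℂ _
    have hsrc : p 0 ∈ e.source := mem_chart_source ℂ _
    have hsrc' : q y₀ ∈ e.source := by rw [hy₀]; exact hsrc
    have h1 : (e ∘ p) =ᶠ[𝓝 0] (e ∘ q) ∘ k := hqk.mono fun z hz => by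
      simp only [Function.comp_apply, hz]
    have h2 : DifferentiableAt ℂ (e ∘ q) (k 0) := by
      rw [hk0]; exact hq.differentiableAt_chart hea hsrc'
    rw [← hd e hea 0 hsrc, ← hc e hea y₀ hsrc', h1.deriv_eq, deriv_comp _ h2
      hk.differentiableAt, hk0, hy₀, mul_assoc]
  obtain ⟨U, hU, hU0, hgU⟩ := exists_greenFun_eq_norm_mul τ
  obtain ⟨V, hV, hV0, hgV⟩ := exists_greenFun_eq_norm_mul τ₀
  -- The same Green function read in both uniformizations, divided by |z|. In the limit the leading
  -- coefficients 2π|η|² differ by the factor |a|.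
  have heq : ∀ᶠ z in 𝓝[≠] (0 : ℂ), V z = ‖slope k 0 z‖ * U (k z - y₀) := by
    filter_upwards [hqk.filter_mono nhdsWithin_le_nhds, self_mem_nhdsWithin] with z hz hz0
    have h1 : greenFun τ₀ (z - 0) = greenFun τ (k z - y₀) := by
      rw [← arakelovGreen_apply hX hp, ← arakelovGreen_apply hX hq, hz, hy₀]
    have hz0' : ‖z‖ ≠ 0 := norm_ne_zero_iff.2 hz0
    rw [sub_zero, hgU, hgV] at h1
    rw [slope_def_field, norm_div, sub_zero, hk0, div_mul_eq_mul_div, ← h1, mul_div_cancel_left₀ _ hz0']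
  have hkc : Filter.Tendsto (fun z => k z - y₀) (𝓝 0) (𝓝 0) := by
    have := hk.continuousAt.tendsto.sub_const y₀
    rwa [hk0, sub_self] at this
  have hlim : Filter.Tendsto (fun z => ‖slope k 0 z‖ * U (k z - y₀)) (𝓝[≠] 0) (𝓝 (‖a‖ * U 0)) :=
    (hasDerivAt_iff_tendsto_slope.1 hk.differentiableAt.hasDerivAt).norm.mul
      ((hU.continuousAt.tendsto.comp hkc).mono_left nhdsWithin_le_nhds)
  have hVU : V 0 = ‖a‖ * U 0 := tendsto_nhds_unique
    (hV.continuousAt.tendsto.mono_left nhdsWithin_le_nhds)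
    (hlim.congr' (heq.mono fun z hz => hz.symm))
  rw [hU0, hV0] at hVU
  have hη : ‖ModularForm.eta τ₀‖ ^ 2 = ‖a‖ * ‖ModularForm.eta τ‖ ^ 2 := by
    have := Real.pi_pos
    have h2 : (2 * Real.pi) * ‖ModularForm.eta τ₀‖ ^ 2 =
      (2 * Real.pi) * (‖a‖ * ‖ModularForm.eta τ‖ ^ 2) := by linarith
    exact mul_left_cancel₀ (by positivity) h2
  -- The differential has norm one in both uniformizations: |c|² Im τ = |d|² Im τ₀ = 1.
  have hT : ‖a‖ ^ 2 * τ₀.im = τ.im := by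
    rw [hdc, norm_mul, mul_pow] at hdT
    have hc0 : ‖c‖ ^ 2 ≠ 0 := left_ne_zero_of_mul (hcT.trans_ne one_ne_zero)
    refine mul_left_cancel₀ hc0 ?_
    linarith
  rw [hη, ← hT, Real.sqrt_mul (sq_nonneg _), Real.sqrt_sq (norm_nonneg _)]
  ring

lemma etaNorm_sq (hX : genus X = 1) {p : ℂ → X} {τ : UpperHalfPlane}
    (hp : IsUniformization p τ) : etaNorm X ^ 2 = √τ.im * ‖ModularForm.eta τ‖ ^ 2 := by
  have hex : ∃ τ : UpperHalfPlane, IsTorusOfPeriod X τ := ⟨τ, isTorusOfPeriod_iff.2 ⟨p, hp⟩⟩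
  obtain ⟨q, hq⟩ := isTorusOfPeriod_iff.1 hex.choose_spec
  rw [hp.sqrt_im_mul_norm_eta_sq_eq hX hq, etaNorm, dif_pos hex, mul_pow, ← Real.rpow_natCast,
    ← Real.rpow_mul hex.choose.im_pos.le, Real.sqrt_eq_rpow]
  norm_num

lemma etaNorm_sq_pos (hX : genus X = 1) {p : ℂ → X} {τ : UpperHalfPlane}
    (hp : IsUniformization p τ) : 0 < etaNorm X ^ 2 := by
  rw [etaNorm_sq hX hp]
  exact mul_pos (Real.sqrt_pos.2 τ.im_pos) (pow_pos (eta_norm_pos τ) 2)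

end EtaInvariance

/-! ### Lifting an isogeny to a linear map -/

section Isogeny

variable {X X' : Type*} [TopologicalSpace X] [ChartedSpace ℂ X] [AddCommGroup X]
  [TopologicalSpace X'] [ChartedSpace ℂ X'] [AddCommGroup X']

/-- An additive map `ℂ → ℂ` that is differentiable at the origin is linear. -/
lemma eq_mul_of_additive {φ : ℂ →+ ℂ} {a : ℂ} (h : HasDerivAt φ a 0) (z : ℂ) : φ z = a * z := by
  rcases eq_or_ne z 0 with rfl | hz
  · simp
  have h1 : Filter.Tendsto (fun n : ℕ => z / 2 ^ n) Filter.atTop (𝓝[≠] 0) := by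
    refine tendsto_nhdsWithin_iff.2 ⟨?_, Filter.Eventually.of_forall fun n => ?_⟩
    · have h2 : Filter.Tendsto (fun n : ℕ => ((1 : ℂ) / 2) ^ n) Filter.atTop (𝓝 0) :=
        tendsto_pow_atTop_nhds_zero_of_norm_lt_one (by norm_num)
      have h3 := h2.const_mul z
      rw [mul_zero] at h3
      exact h3.congr fun n => by rw [one_div, inv_pow, div_eq_mul_inv]
    · exact div_ne_zero hz (pow_ne_zero _ two_ne_zero)
  have h2 := (hasDerivAt_iff_tendsto_slope.1 h).comp h1
  -- By additivity all slopes along z/2ⁿ equal φ(z)/z, so this quotient is already the derivative.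
  have h3 : ∀ n : ℕ, slope φ 0 (z / 2 ^ n) = φ z / z := by
    intro n
    have h4 : φ z = 2 ^ n * φ (z / 2 ^ n) := by
      conv_lhs => rw [show z = 2 ^ n • (z / 2 ^ n) by rw [nsmul_eq_mul]; push_cast; field_simp]
      rw [map_nsmul, nsmul_eq_mul]; push_cast; ring
    rw [slope_def_field, map_zero, sub_zero, sub_zero, h4]
    field_simp
  have h5 : Filter.Tendsto (fun _ : ℕ => φ z / z) Filter.atTop (𝓝 a) := h2.congr h3
  rw [← tendsto_nhds_unique tendsto_const_nhds h5]
  field_simp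

/-- A holomorphic homomorphism lifts to multiplication by a complex number. -/
lemma exists_multiplier [IsManifold 𝓘(ℂ, ℂ) 1 X'] (hX' : genus X' = 1) {f : X →+ X'}
    (hf : MDifferentiable 𝓘(ℂ, ℂ) 𝓘(ℂ, ℂ) f) {p : ℂ →+ X} {p' : ℂ →+ X'} {τ' : UpperHalfPlane}
    (hp : MDifferentiable 𝓘(ℂ, ℂ) 𝓘(ℂ, ℂ) p) (hp' : IsUniformization p' τ') :
    ∃ a : ℂ, ∀ z, f (p z) = p' (a * z) := by
  obtain ⟨k, hk, hk0, hkp⟩ := hp'.exists_local_lift hX' (g := f ∘ p) (hf.comp hp)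
    (z₀ := 0) (y₀ := 0) (by simp)
  have hsum : Filter.Tendsto (fun x : ℂ × ℂ => x.1 + x.2) (𝓝 ((0 : ℂ), (0 : ℂ))) (𝓝 0) := by
    have : Continuous fun x : ℂ × ℂ => x.1 + x.2 := by fun_prop
    simpa using this.tendsto ((0 : ℂ), (0 : ℂ))
  have hfst := continuous_fst.tendsto ((0 : ℂ), (0 : ℂ))
  have hsnd := continuous_snd.tendsto ((0 : ℂ), (0 : ℂ))
  have hkt : Filter.Tendsto k (𝓝 0) (𝓝 0) := by
    have := hk.continuousAt.tendsto
    rwa [hk0] at this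
  have hdiff : Filter.Tendsto (fun x : ℂ × ℂ => k (x.1 + x.2) - (k x.1 + k x.2))
      (𝓝 ((0 : ℂ), (0 : ℂ))) (𝓝 0) := by
    have := (hkt.comp hsum).sub ((hkt.comp hfst).add (hkt.comp hsnd))
    simpa using this
  -- The defect k(x + y) - k(x) - k(y) is a period and tends to 0, hence vanishes near the origin
  -- because the lattice is discrete.
  have hadd : ∀ᶠ x : ℂ × ℂ in 𝓝 ((0 : ℂ), (0 : ℂ)), k (x.1 + x.2) = k x.1 + k x.2 := by
    have h0 := eventually_nhdsWithin_iff.1 (eventually_notMem_periodLattice τ')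
    filter_upwards [hdiff.eventually h0, hsum.eventually hkp, hfst.eventually hkp,
      hsnd.eventually hkp] with x h1 h2 h3 h4
    by_contra hne
    refine h1 (sub_ne_zero.2 hne) ((hp'.eq_iff _ _).1 ?_)
    rw [map_add, h2, h3, h4]
    simp
  obtain ⟨r, hr, hball⟩ := Metric.eventually_nhds_iff_ball.1 hadd
  obtain ⟨r', hr', hball'⟩ := Metric.eventually_nhds_iff_ball.1 hkp
  obtain ⟨φ, hφ⟩ := exists_addMonoidHom_extending (E := k) hr fun v hv w hw => by
    refine hball (v, w) ?_
    rw [← ball_prod_same]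
    exact ⟨hv, hw⟩
  have hφk : k =ᶠ[𝓝 0] φ := by
    filter_upwards [Metric.ball_mem_nhds 0 hr] with v hv using (hφ v hv).symm
  have hlin := eq_mul_of_additive (hk.differentiableAt.hasDerivAt.congr_of_eventuallyEq hφk.symm)
  refine ⟨deriv k 0, fun z => ?_⟩
  -- The local identity reaches all of ℂ: halve z often enough to enter the ball, then multiply back
  -- by 2ⁿ.
  obtain ⟨n, hn⟩ := pow_unbounded_of_one_lt (‖z‖ / min r r') one_lt_two
  have hmin := lt_min hr hr'
  have hmem : z / 2 ^ n ∈ Metric.ball (0 : ℂ) (min r r') := by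
    rw [mem_ball_zero_iff, norm_div, norm_pow, Complex.norm_ofNat, div_lt_iff₀ (by positivity)]
    rw [div_lt_iff₀ hmin] at hn
    linarith
  have h1 := hball' _ (Metric.ball_subset_ball (min_le_right _ _) hmem)
  rw [← hφ _ (Metric.ball_subset_ball (min_le_left _ _) hmem)] at h1
  have h2 : z = 2 ^ n • (z / 2 ^ n) := by rw [nsmul_eq_mul]; push_cast; field_simp
  rw [← hlin, h2, map_nsmul, map_nsmul, map_nsmul, map_nsmul, h1]
  rfl

end Isogeny

/-- All fibres of a surjective homomorphism have the same number of points as the kernel. -/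
lemma degree_eq_ncard_ker {X X' : Type*} [AddCommGroup X] [AddCommGroup X'] {f : X →+ X'} (hf : Function.Surjective f) :
    degree f = (f.ker : Set X).ncard := by
  have h : ∀ Q : X', (f ⁻¹' {Q}).ncard = (f.ker : Set X).ncard := by
    intro Q
    obtain ⟨x, rfl⟩ := hf Q
    have : f ⁻¹' {f x} = (fun y => x + y) '' (f.ker : Set X) := by
      ext y
      simp only [Set.mem_preimage, Set.mem_singleton_iff, Set.mem_image, SetLike.mem_coe,
        AddMonoidHom.mem_ker]
      refine ⟨fun hy => ⟨y - x, by rw [map_sub, hy, sub_self], by abel⟩, ?_⟩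
      rintro ⟨v, hv, rfl⟩
      rw [map_add, hv, add_zero]
    rw [this, Set.ncard_image_of_injective _ (add_right_injective x)]
  rw [degree, iSup_congr h, ciSup_const]

/-! ### Discreteness of the period lattice -/

section PeriodLattice

variable (τ : UpperHalfPlane)

lemma isBounded_periodDomain : Bornology.IsBounded (periodDomain τ) :=
  ((isCompact_Icc.reProdIm isCompact_Icc).image (periodMap τ).continuous).isBounded.subset
    (Set.image_mono (Set.inter_subset_inter (Set.preimage_mono Set.Ico_subset_Icc_self)
      (Set.preimage_mono Set.Ico_subset_Icc_self)))

lemma isDiscrete_periodLattice : IsDiscrete (periodLattice τ : Set ℂ) := by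
  rw [isDiscrete_iff_nhdsNE]
  intro x hx
  rw [Filter.inf_principal_eq_bot]
  filter_upwards [eventually_sub_notMem_periodLattice τ x] with w hw hwm
  exact hw ((periodLattice τ).sub_mem hwm hx)

lemma finite_inter_periodLattice {B : Set ℂ} (hB : Bornology.IsBounded B) :
    (B ∩ periodLattice τ).Finite :=
  Metric.finite_isBounded_inter_isClosed (isDiscrete_periodLattice τ) hB (isClosed_periodLattice τ)

end PeriodLattice

/-! ### Tiling the torus by copies of the target parallelogram -/

section Tiles

lemma map_mul_sub_volume {a : ℂ} (ha : a ≠ 0) (s : ℂ) :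
    Measure.map (fun z => a * (z - s)) volume = ENNReal.ofReal (‖a‖ ^ 2)⁻¹ • volume := by
  have h1 : (fun z => a * (z - s)) = (fun z => a * z) ∘ fun z => z - s := rfl
  have hdet := det_restrictScalars_toSpanSingleton a
  have h2 := Measure.map_linearMap_addHaar_eq_smul_addHaar (volume : Measure ℂ)
    (f := (((ContinuousLinearMap.toSpanSingleton ℂ a).restrictScalars ℝ : ℂ →L[ℝ] ℂ) :
      ℂ →ₗ[ℝ] ℂ)) (by
      have : ‖a‖ ≠ 0 := norm_ne_zero_iff.2 ha
      exact ne_of_eq_of_ne hdet (by positivity))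
  rw [h1, ← Measure.map_map (by fun_prop) (by fun_prop),
    (measurePreserving_sub_right volume s).map_eq]
  have h3 : (fun z => a * z) =
      ⇑(((ContinuousLinearMap.toSpanSingleton ℂ a).restrictScalars ℝ : ℂ →L[ℝ] ℂ) :
      ℂ →ₗ[ℝ] ℂ) := by
    ext z; simp [mul_comm]
  rw [h3, h2]
  congr 2
  rw [show LinearMap.det _ = _ from hdet, abs_of_nonneg (by positivity)]

variable {X X' : Type*} [TopologicalSpace X] [ChartedSpace ℂ X] [AddCommGroup X]
  [TopologicalSpace X'] [ChartedSpace ℂ X'] [AddCommGroup X']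
  {p : ℂ →+ X} {p' : ℂ →+ X'} {τ τ' : UpperHalfPlane} {f : X →+ X'} {a : ℂ}

/-- Kernel points are represented by z in the parallelogram with az a period of X', and a bounded
set contains finitely many periods. -/
lemma finite_ker (hp : IsUniformization p τ) (hp' : IsUniformization p' τ') (ha : a ≠ 0)
    (hf : ∀ z, f (p z) = p' (a * z)) : (f.ker : Set X).Finite := by
  have h1 : ((fun z => a * z) '' periodDomain τ ∩ periodLattice τ').Finite := by
    refine finite_inter_periodLattice τ' ?_
    exact (ContinuousLinearMap.lipschitz (ContinuousLinearMap.mul ℂ ℂ a)).isBounded_image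
      (isBounded_periodDomain τ)
  have h2 := h1.preimage (f := fun z => a * z) (mul_right_injective₀ ha).injOn
  refine (h2.image p).subset fun x hx => ?_
  obtain ⟨z, hz, rfl⟩ := exists_mem_periodDomain hp x
  refine ⟨z, ⟨⟨z, hz, rfl⟩, ?_⟩, rfl⟩
  have h3 : p' (a * z) = p' 0 := by rw [map_zero, ← hf]; exact hx
  simpa using (hp'.eq_iff _ _).1 h3

/-- The part of the fundamental domain of `X` obtained from that of `X'`, shifted by `s`. -/
def tile (a : ℂ) (τ' : UpperHalfPlane) (s : ℂ) : Set ℂ :=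
  (fun z => a * (z - s)) ⁻¹' periodDomain τ'

lemma measurableSet_tile (a : ℂ) (τ' : UpperHalfPlane) (s : ℂ) : MeasurableSet (tile a τ' s) :=
  (measurableSet_periodDomain τ').preimage (by fun_prop)

variable {K : Finset X} {s : X → ℂ}

lemma mul_section_mem {X : Type*} [AddCommGroup X] {p : ℂ →+ X} {f : X →+ X'} {s : X → ℂ}
    (hp' : IsUniformization p' τ') (hf : ∀ z, f (p z) = p' (a * z))
    (hs : ∀ x, p (s x) = x) {x : X} (hx : f x = 0) : a * s x ∈ periodLattice τ' := by
  have h : p' (a * s x) = p' 0 := by rw [map_zero, ← hf, hs, hx]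
  simpa using (hp'.eq_iff _ _).1 h

lemma section_eq_of_mem_tile {X : Type*} [AddCommGroup X] {p : ℂ →+ X} {f : X →+ X'} {s : X → ℂ}
    (hp' : IsUniformization p' τ') (ha : a ≠ 0)
    (hf : ∀ z, f (p z) = p' (a * z)) (hs : ∀ x, p (s x) = x) {x y : X} (hx : f x = 0)
    (hy : f y = 0) {z w : ℂ} (hz : z ∈ tile a τ' (s x)) (hw : w ∈ tile a τ' (s y))
    (hzw : f (p z) = f (p w)) : z - s x = w - s y := by
  refine mul_left_cancel₀ ha (injOn_periodDomain hp' hz hw ?_)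
  simp only [← hf, map_sub, hs, hx, hy, hzw]

lemma isAddFundamentalDomain_tiles (hp : IsUniformization p τ) (hp' : IsUniformization p' τ')
    (ha : a ≠ 0) (hf : ∀ z, f (p z) = p' (a * z)) (hK : ∀ x, x ∈ K ↔ f x = 0)
    (hs : ∀ x, p (s x) = x) :
    IsAddFundamentalDomain (periodLattice τ) (⋃ x ∈ K, tile a τ' (s x)) := by
  refine isAddFundamentalDomain_of_existsUnique τ
    (K.measurableSet_biUnion fun x _ => measurableSet_tile a τ' (s x)) fun z => ?_
  have hl0 : ∀ l : periodLattice τ, p l = 0 := fun l => by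
    rw [← map_zero p, hp.eq_iff, sub_zero]; exact l.2
  -- The period l' moving az into the target parallelogram determines everything: the tile belongs
  -- to the kernel point x = -p(l'/a), and the period l'/a + s(x) moves z into it.
  obtain ⟨l', hl', -⟩ := existsUnique_add_mem_periodDomain τ' (a * z)
  have hl'0 : p' l' = 0 := by rw [← map_zero p', hp'.eq_iff, sub_zero]; exact l'.2
  have hx : f (-p (l' / a)) = 0 := by rw [map_neg, hf, mul_div_cancel₀ _ ha, hl'0, neg_zero]
  have hl : (l' : ℂ) / a + s (-p (l' / a)) ∈ periodLattice τ := by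
    have h : p ((l' : ℂ) / a + s (-p (l' / a))) = p 0 := by rw [map_add, hs, map_zero]; abel
    simpa using (hp.eq_iff _ _).1 h
  have hmem : ((l' : ℂ) / a + s (-p (l' / a))) + z ∈ tile a τ' (s (-p (l' / a))) := by
    have : a * ((l' : ℂ) / a + s (-p (l' / a)) + z - s (-p (l' / a))) = l' + a * z := by
      field_simp; ring
    rw [tile, Set.mem_preimage, this]; exact hl'
  have hl1 : p ((l' : ℂ) / a + s (-p (l' / a))) = 0 := hl0 ⟨_, hl⟩
  refine ⟨⟨_, hl⟩, Set.mem_biUnion ((hK _).2 hx) hmem, fun m hm => Subtype.ext ?_⟩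
  obtain ⟨y, hy, hmy⟩ := Set.mem_iUnion₂.1 hm
  have h1 := section_eq_of_mem_tile hp' ha hf hs ((hK y).1 hy) hx hmy hmem (by
    rw [map_add p m.1, map_add p (_ + s _) z, hl0, hl1])
  have h2 : p (m + z - s y) = p (((l' : ℂ) / a + s (-p (l' / a))) + z - s (-p (l' / a))) := by
    rw [h1]
  rw [map_sub, map_sub, map_add p m.1, map_add p (_ + s _) z, hl0, hl1, hs, hs] at h2
  rw [sub_right_injective h2] at h1
  linear_combination h1

/-- The tiles, one for each kernel point, form a fundamental domain. Each is mapped onto the target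
parallelogram by an affine map scaling area by |a|², so all contribute equally. -/
lemma integrableOn_comp_mul (hp : IsUniformization p τ) (hp' : IsUniformization p' τ')
    (ha : a ≠ 0) (hf : ∀ z, f (p z) = p' (a * z)) (hK : ∀ x, x ∈ K ↔ f x = 0)
    {ψ : ℂ → ℝ} (hψ : ∀ l ∈ periodLattice τ', ∀ z, ψ (z + l) = ψ z)
    (hint : IntegrableOn ψ (periodDomain τ')) :
    IntegrableOn (fun z => ψ (a * z)) (periodDomain τ) ∧
      ∫ z in periodDomain τ, ψ (a * z) =
        K.card * ((‖a‖ ^ 2)⁻¹ * ∫ z in periodDomain τ', ψ z) := by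
  choose s hs using hp.surjective
  have hD := isAddFundamentalDomain_tiles hp hp' ha hf hK hs
  have hF := isAddFundamentalDomain_periodDomain τ
  have hper : ∀ (l : periodLattice τ) (z : ℂ), ψ (a * (l +ᵥ z)) = ψ (a * z) := by
    intro l z
    have hal : a * l ∈ periodLattice τ' := by
      have h : p' (a * l) = p' 0 := by
        rw [map_zero, ← hf, show p l = 0 by
          rw [← map_zero p, hp.eq_iff, sub_zero]; exact l.2, map_zero]
      simpa using (hp'.eq_iff _ _).1 h
    rw [AddSubgroup.vadd_def, vadd_eq_add, mul_add, add_comm, hψ _ hal]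
  have htile : ∀ x ∈ K, IntegrableOn (fun z => ψ (a * z)) (tile a τ' (s x)) ∧
      ∫ z in tile a τ' (s x), ψ (a * z) = (‖a‖ ^ 2)⁻¹ * ∫ z in periodDomain τ', ψ z := by
    intro x hx
    have hA : MeasurableEmbedding fun z => a * (z - s x) :=
      (((Homeomorph.subRight (s x)).trans (Homeomorph.mulLeft₀ a ha))).measurableEmbedding
    -- Since a s(x) is a period of ψ, the shift by s(x) can be inserted freely.
    have heq : (fun z => ψ (a * z)) = ψ ∘ fun z => a * (z - s x) := by
      ext z
      rw [Function.comp_apply, ← hψ _ (mul_section_mem hp' hf hs ((hK x).1 hx)) (a * (z - s x))]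
      congr 1; ring
    constructor
    · rw [heq]
      refine (hA.integrableOn_map_iff (f := ψ) (s := periodDomain τ')).1 ?_
      rw [map_mul_sub_volume ha]
      rw [IntegrableOn, Measure.restrict_smul]
      exact Integrable.smul_measure hint ENNReal.ofReal_ne_top
    · have h1 := hA.setIntegral_map (μ := volume) ψ (periodDomain τ')
      rw [map_mul_sub_volume ha, Measure.restrict_smul, integral_smul_measure,
        ENNReal.toReal_ofReal (by positivity), smul_eq_mul] at h1
      rw [h1, heq]
      rfl
  have hdisj : (K : Set X).PairwiseDisjoint fun x => tile a τ' (s x) := by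
    intro x hx y hy hxy
    refine Set.disjoint_left.2 fun z hzx hzy => hxy ?_
    have h1 := section_eq_of_mem_tile hp' ha hf hs ((hK x).1 hx) ((hK y).1 hy) hzx hzy rfl
    rw [← hs x, ← hs y, sub_right_injective h1]
  constructor
  · rw [hF.integrableOn_iff hD hper]
    exact (integrableOn_finset_iUnion).2 fun x hx => (htile x hx).1
  · rw [hF.setIntegral_eq hD hper, integral_biUnion_finset K
      (fun x _ => measurableSet_tile a τ' (s x)) hdisj fun x hx => (htile x hx).1,
      Finset.sum_congr rfl fun x hx => (htile x hx).2, Finset.sum_const, nsmul_eq_mul]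

/-- The covolumes of the period lattices are related by the degree. -/
lemma norm_sq_mul_im (hp : IsUniformization p τ) (hp' : IsUniformization p' τ')
    (ha : a ≠ 0) (hf : ∀ z, f (p z) = p' (a * z)) (hK : ∀ x, x ∈ K ↔ f x = 0) :
    ‖a‖ ^ 2 * τ.im = K.card * τ'.im := by
  have hvol : ∀ σ : UpperHalfPlane, volume.real (periodDomain σ) = σ.im := fun σ => by
    rw [measureReal_def, volume_periodDomain, ENNReal.toReal_ofReal σ.im_pos.le]
  -- Integrating the constant 1 compares the two covolumes.
  have h := (integrableOn_comp_mul hp hp' ha hf hK (ψ := fun _ => 1) (fun _ _ _ => rfl)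
    (integrableOn_const (by rw [volume_periodDomain]; exact ENNReal.ofReal_ne_top))).2
  rw [setIntegral_const, setIntegral_const, hvol, hvol, smul_eq_mul, smul_eq_mul, mul_one,
    mul_one] at h
  have : ‖a‖ ≠ 0 := norm_ne_zero_iff.2 ha
  rw [h]
  field_simp

end Tiles

/-! ### The product formula for Green functions under an isogeny -/

section PotentialDifference

open InnerProductSpace

/-- The correction (Im w)² is replaced by |w|²/2, from which it differs by a harmonic function.
Corrections for different multipliers b then become proportional and can cancel. -/
lemma harmonicAt_log_greenFun_affine {τ : UpperHalfPlane} {b s z₀ : ℂ}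
    (h : b * z₀ + s ∉ periodLattice τ) :
    HarmonicAt (fun z => Real.log (greenFun τ (b * z + s)) +
      Real.pi / (2 * τ.im) * ‖b‖ ^ 2 * ‖z‖ ^ 2) z₀ := by
  have hk : AnalyticAt ℂ (fun z : ℂ => b * z + s) z₀ := by fun_prop
  have h1 := HarmonicAt.comp_analyticAt (k := fun z : ℂ => b * z + s) (exists_log_greenFun_add_harmonic τ h) hk
  -- From 2(Im v)² + Re v² = |v|² with v = bz + s; the linear and constant terms of |bz + s|² are
  -- removed as well, leaving |bz|².
  have h2 : AnalyticAt ℂ (fun z : ℂ => (Real.pi / (2 * τ.im) : ℝ) *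
      ((b * z + s) ^ 2 - (2 * (starRingEnd ℂ s * (b * z)) + ‖s‖ ^ 2))) z₀ := by fun_prop
  convert h1.add h2.harmonicAt_re using 1
  ext z
  have hT := τ.im_pos.ne'
  have e : ‖b‖ ^ 2 * ‖z‖ ^ 2 = ‖b * z‖ ^ 2 := by rw [norm_mul, mul_pow]
  simp only [Pi.add_apply, Function.comp_apply, Complex.re_ofReal_mul, mul_assoc]
  rw [e, ← Complex.ofReal_pow, ← Complex.normSq_eq_norm_sq, ← Complex.normSq_eq_norm_sq,
    Complex.normSq_apply, Complex.normSq_apply]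
  generalize b * z = w
  simp [pow_two]
  field_simp
  ring

lemma HarmonicAt.finset_sum {ι : Type*} {K : Finset ι} {u : ι → ℂ → ℝ} {z₀ : ℂ}
    (h : ∀ i ∈ K, HarmonicAt (u i) z₀) : HarmonicAt (fun z => ∑ i ∈ K, u i z) z₀ := by
  classical
  induction K using Finset.induction_on with
  | empty =>
    exact (analyticAt_const : AnalyticAt ℂ (fun _ : ℂ => (0 : ℂ)) z₀).harmonicAt_re
  | insert i K hi ih =>
    simp only [Finset.sum_insert hi]
    exact (h i (Finset.mem_insert_self i K)).add
      (ih fun j hj => h j (Finset.mem_insert_of_mem hj))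

variable {X X' : Type*} [TopologicalSpace X] [ChartedSpace ℂ X] [AddCommGroup X]
  [TopologicalSpace X'] [ChartedSpace ℂ X'] [AddCommGroup X']
  {p : ℂ →+ X} {p' : ℂ →+ X'} {τ τ' : UpperHalfPlane} {f : X →+ X'} {a : ℂ}
  {K : Finset X} {s : X → ℂ}

/-- The difference between the pullback of `log G` from `X'` and the sum of the translates of
`log G` on `X` by the points of the kernel, as a function on `ℂ`. -/
def potentialDifference (τ τ' : UpperHalfPlane) (a : ℂ) (K : Finset X) (s : X → ℂ) (z : ℂ) : ℝ :=
  Real.log (greenFun τ' (a * z)) - ∑ x ∈ K, Real.log (greenFun τ (z + s x))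

lemma mul_mem_periodLattice_iff {X : Type*} [AddCommGroup X] {p : ℂ →+ X} {f : X →+ X'}
    (hp' : IsUniformization p' τ')
    (hf : ∀ z, f (p z) = p' (a * z)) (z : ℂ) : a * z ∈ periodLattice τ' ↔ f (p z) = 0 := by
  rw [hf, ← map_zero p', hp'.eq_iff, sub_zero]

lemma add_section_mem_iff (hp : IsUniformization p τ) (hs : ∀ x, p (s x) = x) (z : ℂ) (x : X) :
    z + s x ∈ periodLattice τ ↔ x = -p z := by
  rw [← sub_zero (z + s x), ← hp.eq_iff, map_zero, map_add, hs, add_comm, eq_neg_iff_add_eq_zero]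

lemma harmonicAt_potentialDifference (hp : IsUniformization p τ) (hp' : IsUniformization p' τ')
    (ha : a ≠ 0) (hf : ∀ z, f (p z) = p' (a * z)) (hK : ∀ x, x ∈ K ↔ f x = 0)
    (hs : ∀ x, p (s x) = x) {z₀ : ℂ} (h : a * z₀ ∉ periodLattice τ') :
    HarmonicAt (potentialDifference τ τ' a K s) z₀ := by
  have h1 := harmonicAt_log_greenFun_affine (τ := τ') (b := a) (s := 0) (z₀ := z₀)
    (by rwa [add_zero])
  have h2 := HarmonicAt.finset_sum (K := K) fun x hx =>
    harmonicAt_log_greenFun_affine (τ := τ) (b := 1) (s := s x) (z₀ := z₀) (by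
      rw [one_mul, add_section_mem_iff hp hs]
      rintro rfl
      rw [mul_mem_periodLattice_iff hp' hf] at h
      rw [hK, map_neg, neg_eq_zero] at hx
      exact h hx)
  convert h1.sub h2 using 1
  ext z
  have hT := τ.im_pos.ne'
  have hT' := τ'.im_pos.ne'
  have hN := norm_sq_mul_im hp hp' ha hf hK
  -- The quadratic correction of the pullback equals the sum of those of the translates: this is
  -- |a|² Im τ = N Im τ'.
  have e : Real.pi / (2 * τ'.im) * ‖a‖ ^ 2 = K.card * (Real.pi / (2 * τ.im)) := by
    field_simp
    linear_combination hN
  simp only [potentialDifference, Pi.sub_apply, Finset.sum_add_distrib, Finset.sum_const,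
    nsmul_eq_mul, one_mul, add_zero, norm_one, one_pow, mul_one, e]
  ring

lemma eventually_mul_notMem (τ' : UpperHalfPlane) (ha : a ≠ 0) (z₀ : ℂ) :
    ∀ᶠ z in 𝓝[≠] z₀, a * z ∉ periodLattice τ' := by
  have h1 : Filter.Tendsto (fun z => a * z) (𝓝[≠] z₀) (𝓝[≠] (a * z₀)) := by
    refine tendsto_nhdsWithin_iff.2 ⟨?_, ?_⟩
    · exact ((continuous_const_mul a).tendsto z₀).mono_left nhdsWithin_le_nhds
    · filter_upwards [self_mem_nhdsWithin] with z hz h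
      exact hz (mul_left_cancel₀ ha h)
  by_cases h : a * z₀ ∈ periodLattice τ'
  · filter_upwards [h1.eventually (eventually_sub_notMem_periodLattice τ' (a * z₀))] with z hz hm
    exact hz ((periodLattice τ').sub_mem hm h)
  · exact nhdsWithin_le_nhds (((isClosed_periodLattice τ').isOpen_compl.preimage
      (continuous_const_mul a)).mem_nhds h)

lemma exists_harmonicAt_potentialDifference (hp : IsUniformization p τ)
    (hp' : IsUniformization p' τ')
    (ha : a ≠ 0) (hf : ∀ z, f (p z) = p' (a * z)) (hK : ∀ x, x ∈ K ↔ f x = 0)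
    (hs : ∀ x, p (s x) = x) (z₀ : ℂ) :
    ∃ k, HarmonicAt k z₀ ∧ potentialDifference τ τ' a K s =ᶠ[𝓝[≠] z₀] k := by
  classical
  by_cases h : a * z₀ ∈ periodLattice τ'
  swap
  · exact ⟨_, harmonicAt_potentialDifference hp hp' ha hf hK hs h, Filter.EventuallyEq.rfl⟩
  have hx₀ : -p z₀ ∈ K := by
    rw [hK, map_neg, neg_eq_zero, ← mul_mem_periodLattice_iff hp' hf]
    exact h
  obtain ⟨U, hU, hU0, hgU⟩ := exists_greenFun_eq_norm_mul τ
  obtain ⟨V, hV, hV0, hgV⟩ := exists_greenFun_eq_norm_mul τ'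
  have hη := eta_norm_pos τ
  have hη' := eta_norm_pos τ'
  have hUne : U 0 ≠ 0 := by rw [hU0]; positivity
  have hVne : V 0 ≠ 0 := by rw [hV0]; positivity
  -- At z₀ only the term of x = -p(z₀) in the sum is singular. Its log|z - z₀| cancels the one from
  -- the pullback, and k is what remains.
  set k : ℂ → ℝ := fun z => Real.log ‖a‖ + Real.log (V (a * (z - z₀))) -
    (Real.log (U (z - z₀)) + ∑ x ∈ K.erase (-p z₀), Real.log (greenFun τ (z + s x))) with hk
  have hsub : ContDiffAt ℝ ∞ (fun z : ℂ => z - z₀) z₀ := by fun_prop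
  have hmul : ContDiffAt ℝ ∞ (fun z : ℂ => a * (z - z₀)) z₀ := by fun_prop
  have hUc : ContDiffAt ℝ ∞ (fun z => U (z - z₀)) z₀ :=
    ContDiffAt.comp (g := U) (f := fun z : ℂ => z - z₀) z₀ (by rwa [sub_self]) hsub
  have hVc : ContDiffAt ℝ ∞ (fun z => V (a * (z - z₀))) z₀ :=
    ContDiffAt.comp (g := V) (f := fun z : ℂ => a * (z - z₀)) z₀
      (by rwa [sub_self, mul_zero]) hmul
  have hUz : (fun z => U (z - z₀)) z₀ ≠ 0 := by simpa using hUne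
  have hVz : (fun z => V (a * (z - z₀))) z₀ ≠ 0 := by simpa using hVne
  have hkc : ContDiffAt ℝ 2 k z₀ := by
    have hle : (2 : ℕ∞ω) ≤ ((⊤ : ℕ∞) : ℕ∞ω) := by norm_cast
    refine ContDiffAt.sub (contDiffAt_const.add ((hVc.of_le hle).log hVz))
      (((hUc.of_le hle).log hUz).add (ContDiffAt.sum fun x hx => ?_))
    have h1 := harmonicAt_log_greenFun_affine (τ := τ) (b := 1) (s := s x) (z₀ := z₀) (by
      rw [one_mul, add_section_mem_iff hp hs]
      exact Finset.ne_of_mem_erase hx)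
    have h2 : ContDiffAt ℝ 2 (fun z : ℂ => Real.pi / (2 * τ.im) * ‖(1 : ℂ)‖ ^ 2 * ‖z‖ ^ 2) z₀ :=
      contDiffAt_const.mul (contDiff_norm_sq ℝ).contDiffAt
    have h3 := h1.1.sub h2
    simpa [Pi.sub_def] using h3
  have hev : potentialDifference τ τ' a K s =ᶠ[𝓝[≠] z₀] k := by
    filter_upwards [(hUc.continuousAt.eventually_ne hUz).filter_mono nhdsWithin_le_nhds,
      (hVc.continuousAt.eventually_ne hVz).filter_mono nhdsWithin_le_nhds,
      self_mem_nhdsWithin] with z h1 h2 h3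
    have h3' : ‖z - z₀‖ ≠ 0 := norm_ne_zero_iff.2 (sub_ne_zero.2 h3)
    have hna : ‖a‖ ≠ 0 := norm_ne_zero_iff.2 ha
    have e1 : greenFun τ' (a * z) = ‖a‖ * ‖z - z₀‖ * V (a * (z - z₀)) := by
      rw [← norm_mul, ← hgV, ← greenFun_add_of_mem τ' h (a * (z - z₀))]
      congr 1; ring
    have e2 : greenFun τ (z + s (-p z₀)) = ‖z - z₀‖ * U (z - z₀) := by
      rw [← hgU, ← greenFun_add_of_mem τ ((add_section_mem_iff hp hs z₀ _).2 rfl) (z - z₀)]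
      congr 1; ring
    simp only [potentialDifference, hk]
    rw [← Finset.add_sum_erase K _ hx₀, e1, e2, Real.log_mul (mul_ne_zero hna h3') h2,
      Real.log_mul hna h3', Real.log_mul h3' h1]
    ring
  refine ⟨k, harmonicAt_of_eventually_punctured hkc ?_, hev⟩
  filter_upwards [eventually_eventually_nhdsWithin.2 hev, eventually_mul_notMem τ' ha z₀,
    self_mem_nhdsWithin] with w h1 h2 h3
  have h4 : potentialDifference τ τ' a K s =ᶠ[𝓝 w] k := by
    refine h1.filter_mono ?_
    rw [(isOpen_compl_singleton (x := z₀)).nhdsWithin_eq h3]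
  rw [← laplacian_congr_nhds h4 |>.eq_of_nhds]
  exact (harmonicAt_potentialDifference hp hp' ha hf hK hs h2).2.eq_of_nhds

lemma potentialDifference_eq_zero (hp : IsUniformization p τ) (hp' : IsUniformization p' τ')
    (ha : a ≠ 0) (hf : ∀ z, f (p z) = p' (a * z)) (hK : ∀ x, x ∈ K ↔ f x = 0)
    (hs : ∀ x, p (s x) = x) {z₀ : ℂ} (h : a * z₀ ∉ periodLattice τ') :
    potentialDifference τ τ' a K s z₀ = 0 := by
  set D := potentialDifference τ τ' a K s with hD
  have hal : ∀ l ∈ periodLattice τ, a * l ∈ periodLattice τ' := by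
    intro l hl
    rw [mul_mem_periodLattice_iff hp' hf, show p l = 0 by
      rw [← map_zero p, hp.eq_iff, sub_zero]; exact hl, map_zero]
  obtain ⟨c, hc⟩ := exists_eventually_eq_const_of_harmonic (τ := τ) (h := D)
    (fun l hl z => by
      simp only [hD, potentialDifference, mul_add, greenFun_add_of_mem τ' (hal l hl),
        add_right_comm z l, greenFun_add_of_mem τ hl])
    (exists_harmonicAt_potentialDifference hp hp' ha hf hK hs)
  have hoff : ∀ z, a * z ∉ periodLattice τ' → D z = c := by
    intro z hz
    have hcont : ContinuousAt D z :=
      (harmonicAt_potentialDifference hp hp' ha hf hK hs hz).1.continuousAt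
    exact tendsto_nhds_unique (hcont.tendsto.mono_left nhdsWithin_le_nhds)
      (tendsto_const_nhds.congr' ((hc z).mono fun w hw => hw.symm))
  have hae : ∀ᵐ z ∂(volume.restrict (periodDomain τ)), D z = c := by
    refine ae_restrict_of_ae ?_
    have hcount : {z : ℂ | ¬ D z = c}.Countable := by
      refine ((Set.countable_coe_iff.1 (countable_periodLattice τ')).image
        (fun l => l / a)).mono fun z hz => ?_
      exact ⟨a * z, by_contra fun h0 => hz (hoff z h0), by field_simp⟩
    exact hcount.measure_zero volume
  -- The pullback integrates to a multiple of the mean on X', and each translate to the mean on X;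
  -- all of these are zero.
  have hint : ∫ z in periodDomain τ, D z = 0 := by
    obtain ⟨i0, e0⟩ := integrableOn_log_greenFun τ'
    obtain ⟨i1, e1⟩ := integrableOn_comp_mul hp hp' ha hf hK
      (ψ := fun z => Real.log (greenFun τ' z))
      (fun l hl z => by simp only [greenFun_add_of_mem τ' hl]) i0
    have heven : ∀ x, (fun z => Real.log (greenFun τ (z + s x))) =
        fun z => Real.log (greenFun τ (-s x - z)) := fun x => by
      ext z
      rw [← greenFun_neg]
      congr 2; ring
    have h2 : ∀ x, IntegrableOn (fun z => Real.log (greenFun τ (z + s x))) (periodDomain τ) ∧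
        ∫ z in periodDomain τ, Real.log (greenFun τ (z + s x)) = 0 := fun x => by
      rw [heven]; exact integrableOn_log_greenFun_sub τ _
    simp only [hD, potentialDifference]
    rw [integral_sub i1 (integrable_finsetSum K fun x _ => (h2 x).1), e1, e0,
      integral_finsetSum K fun x _ => (h2 x).1, Finset.sum_eq_zero fun x _ => (h2 x).2]
    simp
  rw [integral_congr_ae hae, integral_const, smul_eq_mul, mul_eq_zero] at hint
  rw [hoff z₀ h]
  refine hint.resolve_left ?_
  rw [measureReal_def, Measure.restrict_apply_univ, volume_periodDomain,
    ENNReal.toReal_ofReal τ.im_pos.le]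
  exact τ.im_pos.ne'

open Classical in
/-- The product of the values of the Green function at the nonzero points of the kernel. -/
lemma prod_greenFun_section (hp : IsUniformization p τ) (hp' : IsUniformization p' τ')
    (ha : a ≠ 0) (hf : ∀ z, f (p z) = p' (a * z)) (hK : ∀ x, x ∈ K ↔ f x = 0)
    (hs : ∀ x, p (s x) = x) :
    ‖ModularForm.eta τ‖ ^ 2 * ∏ x ∈ K.erase 0, greenFun τ (s x) =
      ‖a‖ * ‖ModularForm.eta τ'‖ ^ 2 := by
  obtain ⟨U, hU, hU0, hgU⟩ := exists_greenFun_eq_norm_mul τ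
  obtain ⟨V, hV, hV0, hgV⟩ := exists_greenFun_eq_norm_mul τ'
  have h0 : (0 : X) ∈ K := by rw [hK, map_zero]
  have hs0 : s 0 ∈ periodLattice τ := by
    rw [← zero_add (s 0), add_section_mem_iff hp hs, map_zero, neg_zero]
  -- Exponentiating the vanishing difference gives the product formula, which is then divided by
  -- |z|. The lift s 0 need not be 0, but it is a period, so its factor is g_τ(z) = |z| U(z).
  have heq : ∀ᶠ z in 𝓝[≠] (0 : ℂ), ‖a‖ * V (a * z) =
      U z * ∏ x ∈ K.erase 0, greenFun τ (z + s x) := by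
    filter_upwards [eventually_mul_notMem τ' ha 0, self_mem_nhdsWithin] with z hz hz0
    have h1 := potentialDifference_eq_zero hp hp' ha hf hK hs hz
    have hpos : ∀ x ∈ K, 0 < greenFun τ (z + s x) := fun x hx => by
      refine greenFun_pos τ ?_
      rw [add_section_mem_iff hp hs]
      rintro rfl
      rw [hK, map_neg, neg_eq_zero, ← mul_mem_periodLattice_iff hp' hf] at hx
      exact hz hx
    rw [potentialDifference, ← Real.log_prod fun x hx => (hpos x hx).ne', sub_eq_zero] at h1
    have h2 := Real.log_injOn_pos (greenFun_pos τ' hz) (Finset.prod_pos hpos) h1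
    rw [← Finset.mul_prod_erase K _ h0, greenFun_add_of_mem τ hs0, hgU, hgV, norm_mul] at h2
    refine mul_left_cancel₀ (norm_ne_zero_iff.2 hz0) ?_
    linear_combination h2
  have hmul : Filter.Tendsto (fun z => a * z) (𝓝 0) (𝓝 0) := by
    simpa using (continuous_const_mul a).tendsto 0
  have hl : Filter.Tendsto (fun z => ‖a‖ * V (a * z)) (𝓝[≠] 0) (𝓝 (‖a‖ * V 0)) :=
    (tendsto_const_nhds.mul (hV.continuousAt.tendsto.comp hmul)).mono_left nhdsWithin_le_nhds
  have hprod : Continuous fun z => ∏ x ∈ K.erase 0, greenFun τ (z + s x) :=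
    continuous_finsetProd _ fun x _ => (continuous_greenFun τ).comp (continuous_add_const (s x))
  have hr : Filter.Tendsto (fun z => U z * ∏ x ∈ K.erase 0, greenFun τ (z + s x)) (𝓝[≠] 0)
      (𝓝 (U 0 * ∏ x ∈ K.erase 0, greenFun τ (0 + s x))) :=
    (hU.continuousAt.tendsto.mul (hprod.tendsto 0)).mono_left nhdsWithin_le_nhds
  have hfin := tendsto_nhds_unique hl (hr.congr' (heq.mono fun z hz => hz.symm))
  simp only [hU0, hV0, zero_add] at hfin
  have hpi : (2 * Real.pi) ≠ 0 := by positivity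
  refine mul_left_cancel₀ hpi ?_
  linear_combination -hfin

end PotentialDifference

end ArakelovElliptic
end

theorem mainTheorem1
    {X : Type*} [TopologicalSpace X] [T2Space X] [CompactSpace X] [ConnectedSpace X]
    [ChartedSpace ℂ X] [AddCommGroup X] [LieAddGroup 𝓘(ℂ, ℂ) ω X]
    [MeasurableSpace X] [BorelSpace X]
    {X' : Type*} [TopologicalSpace X'] [T2Space X'] [CompactSpace X'] [ConnectedSpace X']
    [ChartedSpace ℂ X'] [AddCommGroup X'] [LieAddGroup 𝓘(ℂ, ℂ) ω X']
    (hX : ArakelovElliptic.genus X = 1) (hX' : ArakelovElliptic.genus X' = 1)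
    (f : X →+ X') (hf : ArakelovElliptic.IsIsogeny f)
    (N : ℕ) (hN : N = ArakelovElliptic.degree f) :
    (f.ker : Set X).Finite ∧
      ∏ᶠ P ∈ {P : X | P ∈ f.ker ∧ P ≠ 0}, ArakelovElliptic.arakelovGreen X 0 P =
        Real.sqrt N * ArakelovElliptic.etaNorm X' ^ 2 / ArakelovElliptic.etaNorm X ^ 2 := by
  classical
  have : IsManifold 𝓘(ℂ, ℂ) 1 X := IsManifold.of_le (n := ω) le_top
  have : IsManifold 𝓘(ℂ, ℂ) 1 X' := IsManifold.of_le (n := ω) le_top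
  obtain ⟨p, τ, hp⟩ := ArakelovElliptic.exists_additive_uniformization (X := X)
  obtain ⟨p', τ', hp'⟩ := ArakelovElliptic.exists_additive_uniformization (X := X')
  obtain ⟨a, hfp⟩ := ArakelovElliptic.exists_multiplier hX' hf.holomorphic hp.holomorphic hp'
  have ha : a ≠ 0 := by
    rintro rfl
    refine hf.ne_zero (AddMonoidHom.ext fun x => ?_)
    obtain ⟨z, rfl⟩ := hp.surjective x
    rw [hfp, zero_mul, map_zero, AddMonoidHom.zero_apply]
  have hsurj : Function.Surjective f := fun y => by
    obtain ⟨w, rfl⟩ := hp'.surjective y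
    exact ⟨p (w / a), by rw [hfp, mul_div_cancel₀ _ ha]⟩
  have hfin := ArakelovElliptic.finite_ker hp hp' ha hfp
  refine ⟨hfin, ?_⟩
  set K := hfin.toFinset
  have hK : ∀ x, x ∈ K ↔ f x = 0 := fun x => by
    rw [Set.Finite.mem_toFinset]; exact AddMonoidHom.mem_ker
  have hcard : N = K.card := by
    rw [hN, ArakelovElliptic.degree_eq_ncard_ker hsurj, Set.ncard_eq_toFinset_card _ hfin]
  choose s hs using hp.surjective
  have hset : {P : X | P ∈ f.ker ∧ P ≠ 0} = ((K.erase 0 : Finset X) : Set X) := by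
    ext x
    simp [hK, and_comm]
  have hgreen : ∀ x, ArakelovElliptic.arakelovGreen X 0 x = ArakelovElliptic.greenFun τ (s x) := by
    intro x
    have h := ArakelovElliptic.arakelovGreen_apply hX hp 0 (s x)
    rwa [map_zero, hs, zero_sub, ArakelovElliptic.greenFun_neg] at h
  have hη := ArakelovElliptic.eta_norm_pos τ
  have hprod := ArakelovElliptic.prod_greenFun_section hp hp' ha hfp hK hs
  have hN' := ArakelovElliptic.norm_sq_mul_im hp hp' ha hfp hK
  -- Square root of the covolume relation; it turns the multiplier a into √N and the ratio of the
  -- imaginary parts.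
  have hroot : ‖a‖ * √τ.im = √N * √τ'.im := by
    rw [← Real.sqrt_mul (Nat.cast_nonneg N), hcard, ← hN', Real.sqrt_mul (sq_nonneg _),
      Real.sqrt_sq (norm_nonneg a)]
  rw [hset, finprod_mem_coe_finset, Finset.prod_congr rfl fun x _ => hgreen x,
    eq_div_iff (ArakelovElliptic.etaNorm_sq_pos hX hp).ne', ArakelovElliptic.etaNorm_sq hX hp,
    ArakelovElliptic.etaNorm_sq hX' hp']
  linear_combination √τ.im * hprod + ‖ModularForm.eta τ'‖ ^ 2 * hroot
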